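/- **Definitions.** An overpartition $\lambda$ of $n$ is a partition of $n$ in which the first occurrence of each distinct part may be overlined; $\overline P=\sum_{n\ge0}\overline p(n)q^n$ is the generating function of the number $\overline p(n)$ of overpartitions of $n$ (so $\overline P=\prod_{n\ge1}\frac{1+q^n}{1-q^n}$). Let $\ell(\cdot)$ be the largest part ($0$ if there are no parts) and $n(\cdot)$ the number of parts. * The rank of $\lambda$ is $\ell(\lambda)-n(\lambda)$. The $M2$-rank of $\lambda$ is $\lceil \ell(\lambda)/2\rceil-n(\lambda)+n(\lambda_o)-\chi(\lambda)$, where $\lambda_o$ consists of the odd non-overlined parts of $\lambda$, and $\chi(\lambda)=1$ if the largest part of $\lambda$ is odd and (its first occurrence is) non-overlined, $\chi(\lambda)=0$ otherwise. Let $\overline N(m,n)$ (resp. $\overline{N2}(m,n)$) be the number of overpartitions of $n$ with rank (resp. $M2$-rank) $m$. * The crank of a partition is its largest part if $1$ does not occur ($0$ for the empty partition), and otherwise the number of parts larger than the number of $1$'s, minus the number of $1$'s. The first residual crank of $\lambda$ is the crank of the partition formed by its non-overlined parts; the second residual crank is the crank of the partition formed by its even non-overlined parts divided by two. Let $\overline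 M(m,n)$ (resp. $\overline{M2}(m,n)$) be the number of overpartitions of $n$ with first (resp. second) residual crank $m$, with the convention that an overpartition for which the partition in question is the partition of $1$ contributes $-1$ for $m=0$, $+1$ for each of $m=1$ and $m=-1$, and $0$ for all other $m$. * For $r\ge0$ put $$\overline R_r=\sum_{n\ge0}\Big(\sum_{m\in\mathbb Z}m^r\,\overline N(m,n)\Big)q^n,\qquad \overline{R2}_r=\sum_{n\ge0}\Big(\sum_{m\in\mathbb Z}m^r\,\overline{N2}(m,n)\Big)q^n,$$ $$\overline C_r=\sum_{n\ge0}\Big(\sum_{m\in\mathbb Z}m^r\,\overline M(m,n)\Big)q^n,\qquad \overline{C2}_r=\sum_{n\ge0}\Big(\sum_{m\in\mathbb Z}m^r\,\overline{M2}(m,n)\Big)q^n,$$ and let $\delta_q=q\,\frac{d}{dq}$. * Let $q=e^{2\pi i\tau}$. Quasimodular forms on $\Gamma_0(2)$ are polynomials in $E_2=1-24\sum_{n\ge1}\frac{nq^n}{1-q^n}$ (of weight $2$) whose coefficients are modular forms of non-negative weight on $\Gamma_0(2)$. For $k\ge1$ let $\overline{\mathcal W}_k$ be the complex vector space of (sums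 of) quasimodular forms on $\Gamma_0(2)$ of weight at most $2k$ whose $q$-expansion has no constant term. **Theorem.** Let $k\ge1$. The following are in $\overline P\cdot\overline{\mathcal W}_k$: (i) $\delta_q^m(\overline C_{2j})$ for all $m\ge0$ and $1\le j\le k$ with $j+m\le k$; (ii) $\delta_q^m(\overline{C2}_{2j})$ for all $m\ge0$ and $1\le j\le k$ with $j+m\le k$; (iii) for $a=2k$, the function $$(a^2-3a+2)\overline R_a+2\sum_{i=1}^{a/2-1}\binom a{2i}\left(3^{2i}-2^{2i}-1\right)\delta_q\overline R_{a-2i}$$ $$+\sum_{i=1}^{a/2-1}\left(\binom a{2i}(2^{2i}+1)+2\binom a{2i+1}\left(1-2^{2i+1}\right)+\frac12\binom a{2i+2}\left(3^{2i+2}-2^{2i+2}-1\right)\right)\overline R_{a-2i};$$ (iv) for $a=2k$, the function $$(a^2-3a+2)\overline{R2}_a+\frac12\sum_{i=1}^{a/2-1}\binom a{2i}\left(3^{2i}-2^{2i}-1\right)\delta_q\overline{R2}_{a-2i}$$ $$+\sum_{i=1}^{a/2-1}\left(\binom a{2i}(2^{2i}+1)+2\binom a{2i+1}\left(1-2^{2i+1}\right)+\frac12\binom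 a{2i+2}\left(3^{2i+2}-2^{2i+2}-1\right)\right)\overline{R2}_{a-2i}.$$ -/

import Mathlib

open scoped PowerSeries UpperHalfPlane MatrixGroups

noncomputable section

namespace OverpartitionMoments

/-- An overpartition of `n`: a partition of `n` in which the first occurrence of each distinct
part may be overlined.  `overlined` is the set of those parts whose first occurrence is overlined. -/
@[ext]
structure Overpartition (n : ℕ) where
  toPartition : n.Partition
  overlined : Finset ℕ
  overlined_subset : overlined ⊆ toPartition.parts.toFinset

namespace Overpartition

/-- An overpartition is a partition together with a subset of its set of distinct parts. -/
def equivSigma (n : ℕ) :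
    Overpartition n ≃ Σ p : n.Partition, {S : Finset ℕ // S ∈ p.parts.toFinset.powerset} where
  toFun l := ⟨l.toPartition, l.overlined, Finset.mem_powerset.mpr l.overlined_subset⟩
  invFun x := ⟨x.1, x.2.1, Finset.mem_powerset.mp x.2.2⟩
  left_inv _ := rfl
  right_inv _ := rfl

instance (n : ℕ) : Fintype (Overpartition n) := Fintype.ofEquiv _ (equivSigma n).symm

variable {n : ℕ} (l : Overpartition n)

/-- The multiset of all parts, overlined or not. -/
def parts : Multiset ℕ := l.toPartition.parts

/-- The multiset of non-overlined parts. -/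
def nonOverlined : Multiset ℕ := l.parts - l.overlined.val

/-- The largest part (`0` for the empty overpartition). -/
def largestPart : ℕ := l.parts.sup

/-- Dyson's rank: the largest part minus the number of parts. -/
def rank : ℤ := (l.largestPart : ℤ) - (l.parts.card : ℤ)

/-- `1` if the largest part is odd and non-overlined, and `0` otherwise.  A largest part that
occurs several times counts as overlined if its first occurrence is overlined. -/
def chi : ℤ := if Odd l.largestPart ∧ l.largestPart ∉ l.overlined then 1 else 0

/-- The `M2`-rank `⌈ℓ(λ)/2⌉ - n(λ) + n(λ_o) - χ(λ)`, where `λ_o` consists of the odd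
non-overlined parts of `λ`. -/
def m2Rank : ℤ :=
  ⌈(l.largestPart : ℚ) / 2⌉ - (l.parts.card : ℤ)
    + ((l.nonOverlined.filter (fun x => Odd x)).card : ℤ) - l.chi

/-- The even non-overlined parts, divided by two. -/
def halfEvenNonOverlined : Multiset ℕ :=
  (l.nonOverlined.filter (fun x => Even x)).map (fun x => x / 2)

end Overpartition

/-- The Andrews--Garvan crank of a partition, given by its multiset of parts: the largest part
if `1` does not occur, and otherwise the number of parts larger than the number of `1`s minus the
number of `1`s. -/
def crank (p : Multiset ℕ) : ℤ :=
  if p.count 1 = 0 then (p.sup : ℤ)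
  else ((p.filter (fun x => p.count 1 < x)).card : ℤ) - (p.count 1 : ℤ)

/-- The contribution of a partition to the number of partitions of crank `m`: it is `1` or `0`
according to whether the crank is `m`, except that the only partition of `1` contributes `-1` to
`m = 0` and `1` to each of `m = 1` and `m = -1`. -/
def crankCount (m : ℤ) (p : Multiset ℕ) : ℤ :=
  if p = {1} then (if m = 0 then -1 else if m = 1 ∨ m = -1 then 1 else 0)
  else if crank p = m then 1 else 0

/-- The number of overpartitions of `n` with rank `m`. -/
def Nbar (m : ℤ) (n : ℕ) : ℤ :=
  ((Finset.univ.filter (fun l : Overpartition n => l.rank = m)).card : ℤ)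

/-- The number of overpartitions of `n` with `M2`-rank `m`. -/
def N2bar (m : ℤ) (n : ℕ) : ℤ :=
  ((Finset.univ.filter (fun l : Overpartition n => l.m2Rank = m)).card : ℤ)

/-- The (modified) number of overpartitions of `n` with first residual crank `m`, which is the
crank of the non-overlined parts. -/
def Mbar (m : ℤ) (n : ℕ) : ℤ := ∑ l : Overpartition n, crankCount m l.nonOverlined

/-- The (modified) number of overpartitions of `n` with second residual crank `m`, which is the
crank of the even non-overlined parts divided by two. -/
def M2bar (m : ℤ) (n : ℕ) : ℤ := ∑ l : Overpartition n, crankCount m l.halfEvenNonOverlined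

/-- The generating function `∑ₙ (∑_{m ∈ ℤ} mᵏ A(m, n)) qⁿ` of the `k`-th moments of `A`.
For every `A` used below and each `n`, only finitely many `m` have `A m n ≠ 0`. -/
def momentSeries (A : ℤ → ℕ → ℤ) (k : ℕ) : ℂ⟦X⟧ :=
  PowerSeries.mk fun n => ((∑ᶠ m : ℤ, m ^ k * A m n : ℤ) : ℂ)

/-- Generating function of the rank moments. -/
def Rbar (k : ℕ) : ℂ⟦X⟧ := momentSeries Nbar k

/-- Generating function of the `M2`-rank moments. -/
def R2bar (k : ℕ) : ℂ⟦X⟧ := momentSeries N2bar k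

/-- Generating function of the first residual crank moments. -/
def Cbar (k : ℕ) : ℂ⟦X⟧ := momentSeries Mbar k

/-- Generating function of the second residual crank moments. -/
def C2bar (k : ℕ) : ℂ⟦X⟧ := momentSeries M2bar k

/-- The generating function for overpartitions. -/
def Pbar : ℂ⟦X⟧ := PowerSeries.mk fun n => (Fintype.card (Overpartition n) : ℂ)

/-- The operator `δ_q = q d/dq`. -/
def deltaQ (f : ℂ⟦X⟧) : ℂ⟦X⟧ := PowerSeries.X * PowerSeries.derivative ℂ f

/-- The space of quasimodular forms on `Γ₀(N)` of weight at most `w` (sums of quasimodular forms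
of weights `0, …, w`): polynomials in the Eisenstein series `E₂` whose coefficients are modular
forms of non-negative weight on `Γ₀(N)`. -/
def QuasimodularLE (N w : ℕ) : Submodule ℂ (ℍ → ℂ) :=
  Submodule.span ℂ {F | ∃ (j v : ℕ)
    (g : ModularForm ((CongruenceSubgroup.Gamma0 N : Subgroup SL(2, ℤ)) : Subgroup (GL (Fin 2) ℝ))
      (v : ℤ)),
    2 * j + v ≤ w ∧ F = fun τ => EisensteinSeries.E2 τ ^ j * g τ}

/-- `p` is the expansion of `F` in powers of `q = exp (2πiτ)`. -/
def HasQExpansion (F : ℍ → ℂ) (p : ℂ⟦X⟧) : Prop :=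
  ∀ τ : ℍ, HasSum (fun n : ℕ =>
    PowerSeries.coeff n p * Complex.exp (2 * Real.pi * Complex.I * (τ : ℂ)) ^ n) (F τ)

/-- The space of (`q`-expansions of) quasimodular forms on `Γ₀(2)` of weight at most `2k` having
no constant term. -/
def Wbar (k : ℕ) : Submodule ℂ ℂ⟦X⟧ where
  carrier := {p | PowerSeries.constantCoeff p = 0 ∧
    ∃ F ∈ QuasimodularLE 2 (2 * k), HasQExpansion F p}
  zero_mem' := ⟨map_zero _, 0, Submodule.zero_mem _, fun τ => by simp⟩
  add_mem' := by
    rintro p r ⟨hp, F, hF, hpF⟩ ⟨hr, G, hG, hrG⟩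
    refine ⟨by rw [map_add, hp, hr, add_zero], F + G, Submodule.add_mem _ hF hG, fun τ => ?_⟩
    simpa [add_mul] using (hpF τ).add (hrG τ)
  smul_mem' := by
    rintro c p ⟨hp, F, hF, hpF⟩
    refine ⟨by simp [hp], c • F, Submodule.smul_mem _ c hF, fun τ => ?_⟩
    simpa [mul_assoc] using (hpF τ).mul_left c

/-- The space `P̄ · W̄ₖ`. -/
def PbarWbar (k : ℕ) : Submodule ℂ ℂ⟦X⟧ := (Wbar k).map (LinearMap.mulLeft ℂ Pbar)

end OverpartitionMoments

end

noncomputable section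

namespace OverpartitionMoments

open UpperHalfPlane Derivative
open scoped Manifold ModularForm

/-! ### Quasimodular forms -/

/-! Every moment is a Taylor coefficient at `z = 1`: if `F` is the generating function of a
statistic in `z` and `q`, its `r`-th moment series is `δ_z^r F` at `z = 1`, where `δ_z = z d/dz`. It
is enough to have a first order linear equation `A δ_z G = B G` in which `A` and `G` take constant
values at `z = 1` (nonzero for `A`) and the Taylor coefficients of order `i` of `A` and `B` are
quasimodular of weight at most `i` and `i + 1`. Comparing orders then shows that the coefficient of
order `n` of `G` has weight at most `n` (`taylorWeight_of_equation`). The space of quasimodular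
forms is stable under products and under `δ_q`, which raises the weight by two.

Cranks. The generating function is `P̄` times a quotient of theta products (`crankGF_mul`, from
Euler's sum and the q-binomial theorem). Its logarithmic `δ_z`-derivative `kap` is a Lambert series
whose Taylor coefficients at `z = 1` are divisor sums, that is, Eisenstein series in `q` or `q²`.
Since `δ_q P̄ = φ P̄` with `φ` quasimodular of weight at most two, applying `δ_q` preserves the
shape `P̄` times quasimodular.

Ranks. Put `c = 1`, `d = 2` for the rank and `c = 2`, `d = 1` for the `M2`-rank, so that `c d = 2`.
Partial fractions and summation theorems give the coefficients of `F` in `z` (`co_rank`, `co_m2`),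
whence `(1 + z) F / (1 - z) = P̄ ((1 + z)/(1 - z) + 2 Ψ)` with `Ψ = ∑ (-1)^n q^(n² + c n m) (z^m -
z^(-m))`, after denominators are cleared (`RankForm.one_add_mul`). The heat operator `δ_z² + d² δ_q`
removes the mock behaviour: `(1 - z)³` times its value at the left side is `P̄ · yser`
(`rank_equation`), and `yser` times the cube of a theta product transforms like a theta function of
degree three. A half-period shift and two reflections show that such functions form a space of
dimension at most one (`ThetaLike.proportional`). Hence `yser · θ³` is, up to a factor free of `z`,
the product `z (1 + z) ∏ (1 + z q^i)(1 + q^i / z)`. This is a rank-crank differential equation; its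
constant need not be known, because a logarithmic derivative removes it (`one_add_mul_deltaZ_yser`),
and the principle above applies to `yser`.

Finally, `δ_z^(2k)` of `rank_equation` at `z = 1` expresses the combination in (iii) or (iv) through
a Taylor coefficient of `yser`, `φ` and a constant, all times `P̄` (`moment_identity`). The constant
terms vanish since `F` is constant in `z` modulo `q`. -/

lemma quasimodularLE_mono {N a b : ℕ} (h : a ≤ b) : QuasimodularLE N a ≤ QuasimodularLE N b := by
  refine Submodule.span_mono ?_
  rintro F ⟨j, v, g, hw, rfl⟩
  exact ⟨j, v, g, hw.trans h, rfl⟩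

lemma quasimodularLE_mul (N a b : ℕ) :
    QuasimodularLE N a * QuasimodularLE N b ≤ QuasimodularLE N (a + b) := by
  rw [QuasimodularLE, QuasimodularLE, Submodule.span_mul_span, Submodule.span_le]
  rintro _ ⟨_, ⟨j, v, g, hw, rfl⟩, _, ⟨j', v', g', hw', rfl⟩, rfl⟩
  refine Submodule.subset_span ⟨j + j', v + v', (g.mul g').mcast (by push_cast; ring), by omega, ?_⟩
  ext τ
  simp only [Pi.mul_apply, ModularForm.mcast_apply, ModularForm.coe_mul]
  ring

lemma E2_pow_mul_mem_quasimodularLE {N : ℕ} (j v : ℕ)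
    (g : ModularForm ((CongruenceSubgroup.Gamma0 N : Subgroup SL(2, ℤ)) : Subgroup (GL (Fin 2) ℝ))
      (v : ℤ)) {w : ℕ} (h : 2 * j + v ≤ w) :
    (fun τ => EisensteinSeries.E2 τ ^ j * g τ) ∈ QuasimodularLE N w :=
  Submodule.subset_span ⟨j, v, g, h, rfl⟩

lemma modularForm_mem_quasimodularLE {N : ℕ} (v : ℕ)
    (g : ModularForm ((CongruenceSubgroup.Gamma0 N : Subgroup SL(2, ℤ)) : Subgroup (GL (Fin 2) ℝ))
      (v : ℤ)) {w : ℕ} (h : v ≤ w) :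
    (g : ℍ → ℂ) ∈ QuasimodularLE N w := by
  have := E2_pow_mul_mem_quasimodularLE 0 v g (w := w) (by omega)
  simpa using this

lemma one_mem_quasimodularLE (N w : ℕ) : (1 : ℍ → ℂ) ∈ QuasimodularLE N w :=
  modularForm_mem_quasimodularLE 0 (1 : ModularForm _ 0) (Nat.zero_le _)

/-! ### Boundedness of derivatives at the cusp -/

/-- Cauchy's estimate on the closed unit disc about `z`: for `Im z ≥ max A 0 + 2` the disc stays
inside the upper half-plane and above height `A`, where `f` is bounded by `M`. -/
lemma isBoundedAtImInfty_normalizedDeriv {f : ℍ → ℂ} (hf : MDiff f)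
    (hb : IsBoundedAtImInfty f) : IsBoundedAtImInfty (normalizedDerivOfComplex f) := by
  rw [isBoundedAtImInfty_iff] at hb ⊢
  obtain ⟨M, A, hMA⟩ := hb
  refine ⟨‖(2 * Real.pi * Complex.I)⁻¹‖ * (M / 1), max A 0 + 2, fun z hz => ?_⟩
  rw [normalizedDerivOfComplex, norm_mul]
  refine mul_le_mul_of_nonneg_left ?_ (norm_nonneg _)
  have him : ∀ w ∈ Metric.closedBall (z : ℂ) 1, max A 0 + 1 ≤ w.im := by
    intro w hw
    have h1 : ‖w - z‖ ≤ 1 := by simpa [dist_eq_norm] using hw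
    have h2 := (Complex.abs_im_le_norm (w - z)).trans h1
    rw [Complex.sub_im, abs_le] at h2
    have h3 : (z : ℂ).im = z.im := rfl
    linarith [h2.1]
  have hpos : ∀ w ∈ Metric.closedBall (z : ℂ) 1, 0 < w.im := fun w hw =>
    lt_of_lt_of_le (by positivity) (him w hw)
  refine Complex.norm_deriv_le_of_forall_mem_sphere_norm_le one_pos ?_ ?_
  · rw [UpperHalfPlane.mdifferentiable_iff] at hf
    refine (hf.mono fun w hw => ?_).diffContOnCl_ball (U := Metric.closedBall (z : ℂ) 1) le_rfl
    exact hpos w hw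
  · intro w hw
    have hw' := Metric.sphere_subset_closedBall hw
    simp only [Function.comp_apply, ofComplex_apply_of_im_pos (hpos w hw')]
    exact hMA _ (le_trans (by linarith [le_max_left A 0]) (him w hw'))

/-- The Serre derivative of a modular form on an arithmetic subgroup of `SL(2, ℤ)`. -/
def serreDerivativeForm {Γ : Subgroup SL(2, ℤ)} [Γ.FiniteIndex] {k : ℤ}
    (f : ModularForm (Γ : Subgroup (GL (Fin 2) ℝ)) k) :
    ModularForm (Γ : Subgroup (GL (Fin 2) ℝ)) (k + 2) where
  toFun := serreDerivative k f
  slash_action_eq' := by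
    rintro _ ⟨γ, hγ, rfl⟩
    have h : (⇑f) ∣[k] γ = f := SlashInvariantForm.slash_action_eqn f _ ⟨γ, hγ, rfl⟩
    exact serreDerivative_slash_invariant f.holo' h
  holo' := serreDerivative_mdifferentiable _ f.holo'
  bdd_at_cusps' := by
    intro c hc
    have hc' := (Subgroup.IsArithmetic.isCusp_iff_isCusp_SL2Z _).mp hc
    rw [OnePoint.isBoundedAt_iff_forall_SL2Z hc']
    intro γ hγ
    rw [serreDerivative_slash_equivariant (F := f) f.holo']
    have hb : IsBoundedAtImInfty (⇑f ∣[k] γ) :=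
      (OnePoint.isBoundedAt_iff_forall_SL2Z hc').mp (f.bdd_at_cusps' hc) γ hγ
    have hD := isBoundedAtImInfty_normalizedDeriv (f.holo'.slash k (γ : GL (Fin 2) ℝ)) hb
    have h2 := (Filter.BoundedAtFilter.mul EisensteinSeries.isBoundedAtImInfty_E2 hb).smul
      (-((k : ℂ) * 12⁻¹))
    convert! Filter.BoundedAtFilter.add hD h2 using 1
    ext τ
    simp [serreDerivative, sub_eq_add_neg, ModularForm.SL_slash, mul_assoc]

lemma normalizedDeriv_modularForm {Γ : Subgroup SL(2, ℤ)} [Γ.FiniteIndex] {k : ℤ}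
    (f : ModularForm (Γ : Subgroup (GL (Fin 2) ℝ)) k) (τ : ℍ) :
    normalizedDerivOfComplex f τ =
      serreDerivativeForm f τ + k * 12⁻¹ * EisensteinSeries.E2 τ * f τ := by
  change _ = serreDerivative k f τ + _
  simp

-- The anomaly of `E₂` is a multiple of `c / (cτ + d)`. Differentiating it gives a multiple of its
-- square, and the weight two slash action adds a cross term with `E₂`; both are matched by those of
-- `E₂²/12`. Hence the parameter `1`, not `2`, in the Serre derivative.
open EisensteinSeries in
lemma serreDerivative_E2_slash (γ : SL(2, ℤ)) :
    serreDerivative 1 E2 ∣[(4 : ℤ)] γ = serreDerivative 1 E2 := by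
  have hE := E2_slash_action γ
  have hD := normalizedDerivOfComplex_SL_slash (k := 2) E2_mdifferentiable (γ := γ)
  ext τ
  have hj : denom γ τ ≠ 0 := denom_ne_zero _ _
  have h1 : (serreDerivative 1 E2 ∣[(4 : ℤ)] γ) τ =
      (normalizedDerivOfComplex E2 ∣[(2 + 2 : ℤ)] γ) τ - 12⁻¹ * ((E2 ∣[(2 : ℤ)] γ) τ) ^ 2 := by
    have h2 := congrFun (ModularForm.mul_slash_SL2 2 2 γ E2 E2) τ
    have h3 : (serreDerivative 1 E2 ∣[(4 : ℤ)] γ) τ =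
      (normalizedDerivOfComplex E2 ∣[(2 + 2 : ℤ)] γ) τ - 12⁻¹ * ((E2 * E2) ∣[(2 + 2 : ℤ)] γ) τ := by
      simp only [ModularForm.SL_slash_apply, serreDerivative_apply, Pi.mul_apply]
      norm_num
      ring
    rw [h3, h2, Pi.mul_apply, sq]
  have hD2 : normalizedDerivOfComplex (D2 γ) τ = -(γ 1 0 : ℂ) ^ 2 / denom γ τ ^ 2 := by
    have h := (hasDerivAt_denom_zpow (γ : GL (Fin 2) ℝ) (-1) τ).const_mul
      (2 * Real.pi * Complex.I * (γ 1 0 : ℂ))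
    have hev : (D2 γ ∘ ofComplex) =ᶠ[nhds (τ : ℂ)]
        fun w => 2 * Real.pi * Complex.I * (γ 1 0 : ℂ) * denom γ w ^ (-1 : ℤ) := by
      filter_upwards [isOpen_upperHalfPlaneSet.mem_nhds τ.im_pos] with w hw
      simp [D2, ofComplex_apply_of_im_pos hw, div_eq_mul_inv]
    rw [normalizedDerivOfComplex, hev.deriv_eq, h.deriv]
    have hpi : (Real.pi : ℂ) ≠ 0 := by exact_mod_cast Real.pi_ne_zero
    have h2 : (-1 - 1 : ℤ) = -2 := by norm_num
    rw [h2]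
    simp [zpow_neg]
    field_simp
    simp
  have hD2m : MDiff (D2 γ) := by
    have h := (mdifferentiable_inv_denom (γ : GL (Fin 2) ℝ)).const_smul
      (2 * Real.pi * Complex.I * (γ 1 0 : ℂ))
    convert! h using 1
  have h4 : normalizedDerivOfComplex (E2 ∣[(2 : ℤ)] γ) τ = normalizedDerivOfComplex E2 τ +
      (1 / (2 * riemannZeta 2)) * ((γ 1 0 : ℂ) ^ 2 / denom γ τ ^ 2) := by
    rw [hE, normalizedDerivOfComplex_sub _ _ E2_mdifferentiable
      (hD2m.const_smul _), normalizedDerivOfComplex_smul _ _ hD2m]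
    simp only [Pi.sub_apply, Pi.smul_apply, hD2, smul_eq_mul]
    ring
  rw [h1]
  have h5 := congrFun hD τ
  rw [h4] at h5
  simp only [Pi.sub_apply, hE, Pi.smul_apply, smul_eq_mul, D2] at h5 ⊢
  rw [eq_comm, sub_eq_iff_eq_add] at h5
  rw [h5, serreDerivative_apply, riemannZeta_two]
  have hpi : (Real.pi : ℂ) ≠ 0 := by exact_mod_cast Real.pi_ne_zero
  field_simp
  ring_nf
  simp only [Complex.I_sq, Complex.I_pow_three]
  ring

/-- The form `δE₂ - E₂²/12` of weight four. -/
def serreDerivativeE2 (Γ : Subgroup SL(2, ℤ)) [Γ.FiniteIndex] :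
    ModularForm (Γ : Subgroup (GL (Fin 2) ℝ)) 4 where
  toFun := serreDerivative 1 EisensteinSeries.E2
  slash_action_eq' := by
    rintro _ ⟨γ, hγ, rfl⟩
    exact serreDerivative_E2_slash γ
  holo' := serreDerivative_mdifferentiable _ E2_mdifferentiable
  bdd_at_cusps' := by
    intro c hc
    have hc' := (Subgroup.IsArithmetic.isCusp_iff_isCusp_SL2Z _).mp hc
    rw [OnePoint.isBoundedAt_iff_forall_SL2Z hc']
    intro γ hγ
    rw [serreDerivative_E2_slash]
    have hb := EisensteinSeries.isBoundedAtImInfty_E2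
    have hD := isBoundedAtImInfty_normalizedDeriv E2_mdifferentiable hb
    have h2 := (Filter.BoundedAtFilter.mul hb hb).smul (-(12⁻¹ : ℂ))
    convert! Filter.BoundedAtFilter.add hD h2 using 1
    ext τ
    simp [serreDerivative, sub_eq_add_neg, mul_assoc]

lemma normalizedDeriv_E2 (Γ : Subgroup SL(2, ℤ)) [Γ.FiniteIndex] (τ : ℍ) :
    normalizedDerivOfComplex EisensteinSeries.E2 τ =
      serreDerivativeE2 Γ τ + 12⁻¹ * EisensteinSeries.E2 τ ^ 2 := by
  change _ = serreDerivative 1 _ τ + _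
  simp [sq, mul_assoc]

/-- By the product rule it is enough to differentiate the generators: the derivative of a form of
weight `v` is its Serre derivative plus `v/12 · E₂` times the form, and that of `E₂` is a form of
weight four plus `E₂²/12`. Differentiability is carried along because linearity of the derivative
needs it. -/
lemma normalizedDeriv_mem_quasimodularLE {N w : ℕ} [NeZero N] {F : ℍ → ℂ}
    (hF : F ∈ QuasimodularLE N w) :
    MDiff F ∧ normalizedDerivOfComplex F ∈ QuasimodularLE N (w + 2) := by
  induction hF using Submodule.span_induction with
  | mem F hF =>
    obtain ⟨j, v, g, hw, rfl⟩ := hF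
    have hE : MDiff (EisensteinSeries.E2 ^ j) := E2_mdifferentiable.pow j
    have hprod : (fun τ => EisensteinSeries.E2 τ ^ j * g τ) = EisensteinSeries.E2 ^ j * ⇑g := rfl
    have hg : MDiff ⇑g := g.holo'
    refine ⟨hprod ▸ hE.mul hg, ?_⟩
    rw [hprod, normalizedDerivOfComplex_mul _ _ hE hg,
      normalizedDerivOfComplex_pow _ _ E2_mdifferentiable]
    have e1 := E2_pow_mul_mem_quasimodularLE j (v + 2)
      ((serreDerivativeForm g).mcast (b := ((v + 2 : ℕ) : ℤ)) (by push_cast; ring))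
      (w := w + 2) (by omega)
    have e2 := E2_pow_mul_mem_quasimodularLE (j + 1) v g (w := w + 2) (by omega)
    have e3 : (j : ℂ) • (fun τ => EisensteinSeries.E2 τ ^ (j - 1) *
        (((serreDerivativeE2 (CongruenceSubgroup.Gamma0 N)).mul g).mcast
          (b := ((4 + v : ℕ) : ℤ)) (by push_cast; ring)) τ) ∈ QuasimodularLE N (w + 2) := by
      -- For `j = 0` the exponent `j - 1` truncates and the weight bound would fail, but the factor
      -- `j` removes the term.
      rcases Nat.eq_zero_or_pos j with rfl | hj
      · simp
      · exact Submodule.smul_mem _ _ (E2_pow_mul_mem_quasimodularLE (j - 1) (4 + v) _ (by omega))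
    convert add_mem (add_mem e1 (Submodule.smul_mem _ ((v : ℂ) * 12⁻¹ + j * 12⁻¹) e2)) e3 using 1
    ext τ
    simp only [Pi.add_apply, Pi.mul_apply, Pi.pow_apply, Pi.smul_apply, smul_eq_mul,
      ModularForm.mcast_apply, ModularForm.coe_mul, Pi.natCast_apply]
    rw [normalizedDeriv_modularForm g, normalizedDeriv_E2 (CongruenceSubgroup.Gamma0 N)]
    rcases j with _ | j
    · simp; ring
    · simp; ring
  | zero => exact ⟨mdifferentiable_const, by
      have h0 : normalizedDerivOfComplex (0 : ℍ → ℂ) = 0 := normalizedDerivOfComplex_const 0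
      rw [h0]
      exact Submodule.zero_mem _⟩
  | add F G _ _ hF hG =>
    refine ⟨hF.1.add hG.1, ?_⟩
    rw [normalizedDerivOfComplex_add _ _ hF.1 hG.1]
    exact add_mem hF.2 hG.2
  | smul c F _ hF =>
    refine ⟨hF.1.const_smul c, ?_⟩
    rw [normalizedDerivOfComplex_smul _ _ hF.1]
    exact Submodule.smul_mem _ _ hF.2

end OverpartitionMoments

end

noncomputable section

namespace OverpartitionMoments

open UpperHalfPlane Derivative
open scoped Manifold ModularForm

/-! ### `q`-expansions -/

lemma HasQExpansion.mul {F G : ℍ → ℂ} {p r : ℂ⟦X⟧} (hF : HasQExpansion F p)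
    (hG : HasQExpansion G r) : HasQExpansion (F * G) (p * r) := by
  intro τ
  have hf := (hF τ).summable.norm
  have hg := (hG τ).summable.norm
  have h := (summable_norm_sum_mul_antidiagonal_of_summable_norm hf hg).of_norm.hasSum
  rw [← tsum_mul_tsum_eq_tsum_sum_antidiagonal_of_summable_norm hf hg, (hF τ).tsum_eq,
    (hG τ).tsum_eq] at h
  convert! h using 2 with n
  rw [PowerSeries.coeff_mul, Finset.sum_mul]
  refine Finset.sum_congr rfl fun ij hij => ?_
  rw [← Finset.HasAntidiagonal.mem_antidiagonal.mp hij, pow_add]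
  ring

lemma HasQExpansion.delta {F : ℍ → ℂ} {p : ℂ⟦X⟧} (hF : HasQExpansion F p) :
    HasQExpansion (normalizedDerivOfComplex F) (deltaQ p) := by
  intro τ
  set e : ℂ → ℂ := fun w => Complex.exp (2 * Real.pi * Complex.I * w) with he
  have hnorm : ∀ w : ℂ, ‖e w‖ = Real.exp (-(2 * Real.pi * w.im)) := by
    intro w
    simp [he, Complex.norm_exp]
  have hpos : 0 < τ.im / 2 := half_pos τ.im_pos
  -- The series at height `Im τ / 2` dominates, term by term, all values in the half-plane above
  -- that height; this permits termwise differentiation at `τ`.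
  let τ' : ℍ := ⟨(τ.im / 2 : ℝ) * Complex.I, by simpa using hpos⟩
  have hu := (hF τ').summable.norm
  have hU : IsOpen {w : ℂ | τ.im / 2 < w.im} := isOpen_lt continuous_const Complex.continuous_im
  have hd : ∀ n : ℕ, ∀ w : ℂ, HasDerivAt (fun w => PowerSeries.coeff n p * e w ^ n)
      (PowerSeries.coeff n p * (n * e w ^ n * (2 * Real.pi * Complex.I))) w := by
    intro n w
    have h1 : HasDerivAt e (e w * (2 * Real.pi * Complex.I)) w := by
      have := ((hasDerivAt_id w).const_mul (2 * Real.pi * Complex.I)).cexp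
      simpa [he] using this
    convert! (h1.pow n).const_mul (PowerSeries.coeff n p) using 1
    rcases n with _ | n
    · simp
    · push_cast
      simp only [pow_succ]
      ring
  have key := Complex.hasSum_deriv_of_summable_norm (z := (τ : ℂ)) hu
    (F := fun n w => PowerSeries.coeff n p * e w ^ n)
    (fun n w _ => (hd n w).differentiableAt.differentiableWithinAt) hU (by
      intro n w hw
      rw [norm_mul, norm_mul, norm_pow, norm_pow]
      refine mul_le_mul_of_nonneg_left (pow_le_pow_left₀ (norm_nonneg _) ?_ n) (norm_nonneg _)
      change ‖e w‖ ≤ ‖e τ'‖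
      rw [hnorm, hnorm, Real.exp_le_exp]
      have h3 : (τ' : ℂ).im = τ.im / 2 := by simp [τ']
      rw [h3]
      have : τ.im / 2 < w.im := hw
      nlinarith [Real.pi_pos]) (show (τ : ℂ) ∈ {w : ℂ | τ.im / 2 < w.im} from half_lt_self τ.im_pos)
  have hev : (F ∘ ofComplex) =ᶠ[nhds (τ : ℂ)]
      fun w => ∑' n, PowerSeries.coeff n p * e w ^ n := by
    filter_upwards [isOpen_upperHalfPlaneSet.mem_nhds τ.im_pos] with w hw
    rw [Function.comp_apply, ofComplex_apply_of_im_pos hw]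
    exact (hF ⟨w, hw⟩).tsum_eq.symm
  rw [normalizedDerivOfComplex, hev.deriv_eq]
  convert! key.mul_left (2 * Real.pi * Complex.I)⁻¹ using 2 with n
  rw [(hd n τ).deriv, deltaQ]
  have hpi : (2 * Real.pi * Complex.I : ℂ) ≠ 0 := Complex.two_pi_I_ne_zero
  have hc : PowerSeries.coeff n (PowerSeries.X * PowerSeries.derivative ℂ p) =
      n * PowerSeries.coeff n p := by
    rcases n with _ | n
    · simp
    · rw [PowerSeries.coeff_succ_X_mul, PowerSeries.coeff_derivative]
      push_cast
      ring
  rw [hc]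
  field_simp
  rfl

/-- The `q`-expansions of sums of quasimodular forms on `Γ₀(2)` of weight at most `w`. -/
def qmSeries (w : ℕ) : Submodule ℂ ℂ⟦X⟧ where
  carrier := {p | ∃ F ∈ QuasimodularLE 2 w, HasQExpansion F p}
  zero_mem' := ⟨0, Submodule.zero_mem _, fun τ => by simp⟩
  add_mem' := by
    rintro p r ⟨F, hF, hpF⟩ ⟨G, hG, hrG⟩
    refine ⟨F + G, Submodule.add_mem _ hF hG, fun τ => ?_⟩
    simpa [add_mul] using (hpF τ).add (hrG τ)
  smul_mem' := by
    rintro c p ⟨F, hF, hpF⟩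
    refine ⟨c • F, Submodule.smul_mem _ c hF, fun τ => ?_⟩
    simpa [mul_assoc] using (hpF τ).mul_left c

lemma mem_Wbar_iff {k : ℕ} {p : ℂ⟦X⟧} :
    p ∈ Wbar k ↔ PowerSeries.constantCoeff p = 0 ∧ p ∈ qmSeries (2 * k) := Iff.rfl

lemma qmSeries_mono {a b : ℕ} (h : a ≤ b) : qmSeries a ≤ qmSeries b := by
  rintro p ⟨F, hF, hp⟩
  exact ⟨F, quasimodularLE_mono h hF, hp⟩

lemma qmSeries_mul {a b : ℕ} {p r : ℂ⟦X⟧} (hp : p ∈ qmSeries a) (hr : r ∈ qmSeries b) :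
    p * r ∈ qmSeries (a + b) := by
  obtain ⟨F, hF, hp⟩ := hp
  obtain ⟨G, hG, hr⟩ := hr
  exact ⟨F * G, quasimodularLE_mul 2 a b (Submodule.mul_mem_mul hF hG), hp.mul hr⟩

lemma one_mem_qmSeries (w : ℕ) : (1 : ℂ⟦X⟧) ∈ qmSeries w := by
  refine ⟨1, one_mem_quasimodularLE 2 w, fun τ => ?_⟩
  convert hasSum_single (f := fun n => PowerSeries.coeff n (1 : ℂ⟦X⟧) *
    Complex.exp (2 * Real.pi * Complex.I * (τ : ℂ)) ^ n) 0 ?_ using 1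
  · simp
  · intro n hn
    simp [PowerSeries.coeff_one, hn]

lemma C_mem_qmSeries (w : ℕ) (c : ℂ) : PowerSeries.C c ∈ qmSeries w := by
  have := Submodule.smul_mem _ c (one_mem_qmSeries w)
  rwa [← Algebra.algebraMap_eq_smul_one] at this

lemma delta_mem_qmSeries {w : ℕ} {p : ℂ⟦X⟧} (hp : p ∈ qmSeries w) :
    deltaQ p ∈ qmSeries (w + 2) := by
  obtain ⟨F, hF, hp⟩ := hp
  exact ⟨_, (normalizedDeriv_mem_quasimodularLE hF).2, hp.delta⟩

/-! ### Eisenstein series on `Γ₀(2)` -/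

/-- The generating function `∑ σₖ(n) qⁿ`. -/
def sigmaSeries (k : ℕ) : ℂ⟦X⟧ := PowerSeries.mk fun n => (ArithmeticFunction.sigma k n : ℂ)

/-- The series `p(q²)`. -/
def sqSubst (p : ℂ⟦X⟧) : ℂ⟦X⟧ :=
  PowerSeries.mk fun n => if Even n then PowerSeries.coeff (n / 2) p else 0

/-- The matrix `diag(2, 1)`. -/
def diagTwo : GL (Fin 2) ℝ :=
  Matrix.GeneralLinearGroup.mkOfDetNeZero !![2, 0; 0, 1] (by simp)

/-- The point `2τ`. -/
def doublePt (τ : ℍ) : ℍ := ⟨2 * τ, by simpa using τ.im_pos⟩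

lemma HasQExpansion.sqSubst {F : ℍ → ℂ} {p : ℂ⟦X⟧} (hF : HasQExpansion F p) :
    HasQExpansion (fun τ => F (doublePt τ)) (sqSubst p) := by
  intro τ
  have h := hF (doublePt τ)
  have hinj : Function.Injective (fun n : ℕ => 2 * n) := fun a b h => by simpa using h
  rw [← hinj.hasSum_iff]
  · convert h using 2 with n
    simp only [Function.comp_apply, OverpartitionMoments.sqSubst, PowerSeries.coeff_mk]
    rw [pow_mul, ← Complex.exp_nat_mul]
    have h2 : ((2 : ℕ) : ℂ) * (2 * Real.pi * Complex.I * τ) =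
        2 * Real.pi * Complex.I * (doublePt τ : ℂ) := by
      simp [doublePt]; ring
    rw [h2]
    simp
  · intro n hn
    have : ¬ Even n := by
      rintro ⟨m, rfl⟩
      exact hn ⟨m, by simp; ring⟩
    simp [OverpartitionMoments.sqSubst, this]

lemma diagTwo_smul (τ : ℍ) : diagTwo • τ = doublePt τ := by
  ext
  rw [UpperHalfPlane.coe_smul_of_det_pos (by simp [diagTwo])]
  simp [diagTwo, num, denom, doublePt]

lemma slash_diagTwo (k : ℤ) (f : ℍ → ℂ) :
    f ∣[k] diagTwo = fun τ => (2 : ℂ) ^ (k - 1) * f (doublePt τ) := by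
  ext τ
  have hdet : diagTwo.det.val = 2 := by simp [diagTwo]
  rw [ModularForm.slash_apply, diagTwo_smul, σ, if_pos (by rw [hdet]; norm_num), hdet]
  simp [diagTwo, denom]
  ring

/-- Conjugation by `diag(2, 1)` sends `(a b; c d)` to `(a 2b; c/2 d)`, which is integral exactly
because `c` is even. The bottom row is recorded since the anomaly of `E₂` depends on it alone. -/
lemma exists_diagTwo_conj {γ : SL(2, ℤ)} (hγ : γ ∈ CongruenceSubgroup.Gamma0 2) :
    ∃ γ' : SL(2, ℤ), diagTwo * (γ : GL (Fin 2) ℝ) = (γ' : GL (Fin 2) ℝ) * diagTwo ∧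
      2 * γ' 1 0 = γ 1 0 ∧ γ' 1 1 = γ 1 1 := by
  rw [CongruenceSubgroup.Gamma0_mem, ZMod.intCast_zmod_eq_zero_iff_dvd] at hγ
  obtain ⟨c, hc⟩ := hγ
  have hdet := γ.det_coe
  rw [Matrix.det_fin_two] at hdet
  push_cast at hc
  obtain ⟨γ', h00, h01, h10, h11⟩ : ∃ γ' : SL(2, ℤ), γ' 0 0 = γ 0 0 ∧ γ' 0 1 = 2 * γ 0 1 ∧
      γ' 1 0 = c ∧ γ' 1 1 = γ 1 1 := by
    refine ⟨⟨!![γ 0 0, 2 * γ 0 1; c, γ 1 1], ?_⟩, rfl, rfl, rfl, rfl⟩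
    rw [Matrix.det_fin_two_of]
    linear_combination hdet + γ 0 1 * hc
  refine ⟨γ', ?_, by rw [h10, hc], h11⟩
  ext i j
  fin_cases i <;> fin_cases j <;>
    simp [diagTwo, Matrix.mul_apply, Fin.sum_univ_two, h00, h01, h10, h11, hc] <;> ring

open ConjAct Pointwise in
lemma Gamma0_two_le_conj :
    ((CongruenceSubgroup.Gamma0 2 : Subgroup SL(2, ℤ)) : Subgroup (GL (Fin 2) ℝ)) ≤
      toConjAct diagTwo⁻¹ • (𝒮ℒ : Subgroup (GL (Fin 2) ℝ)) := by
  rintro _ ⟨γ, hγ, rfl⟩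
  obtain ⟨γ', h, -⟩ := exists_diagTwo_conj hγ
  rw [Subgroup.mem_pointwise_smul_iff_inv_smul_mem]
  refine ⟨γ', ?_⟩
  simp only [← toConjAct_inv, inv_inv, ConjAct.toConjAct_smul]
  exact eq_mul_inv_of_mul_eq h.symm

/-- Restriction of a modular form to a smaller group. -/
def restrictForm {Γ Γ' : Subgroup (GL (Fin 2) ℝ)} (h : Γ' ≤ Γ) {k : ℤ} (f : ModularForm Γ k) :
    ModularForm Γ' k where
  toFun := f
  slash_action_eq' γ hγ := f.slash_action_eq' γ (h hγ)
  holo' := f.holo'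
  bdd_at_cusps' hc := f.bdd_at_cusps' (hc.mono h)

lemma Gamma0_two_le :
    ((CongruenceSubgroup.Gamma0 2 : Subgroup SL(2, ℤ)) : Subgroup (GL (Fin 2) ℝ)) ≤ 𝒮ℒ := by
  rintro _ ⟨γ, -, rfl⟩
  exact ⟨γ, rfl⟩

lemma isBoundedAtImInfty_D2 (γ : SL(2, ℤ)) : IsBoundedAtImInfty (EisensteinSeries.D2 γ) := by
  rw [isBoundedAtImInfty_iff]
  refine ⟨‖2 * Real.pi * Complex.I * (γ 1 0 : ℂ)‖, 1, fun τ hτ => ?_⟩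
  rw [EisensteinSeries.D2, norm_div]
  by_cases hc : γ 1 0 = 0
  · simp [hc]
  · refine div_le_self (norm_nonneg _) ?_
    have h1 : (1 : ℝ) ≤ |(γ 1 0 : ℝ)| := by
      exact_mod_cast Int.one_le_abs hc
    rw [ModularGroup.denom_apply]
    refine le_trans ?_ (Complex.abs_im_le_norm _)
    have h2 : ((γ 1 0 : ℂ) * τ + (γ 1 1 : ℂ)).im = (γ 1 0 : ℝ) * τ.im := by simp
    rw [h2, abs_mul, abs_of_pos τ.im_pos]
    nlinarith

lemma isBoundedAt_E2 {c : OnePoint ℝ} (hc : IsCusp c 𝒮ℒ) :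
    c.IsBoundedAt EisensteinSeries.E2 2 := by
  rw [OnePoint.isBoundedAt_iff_forall_SL2Z hc]
  intro γ _
  rw [EisensteinSeries.E2_slash_action, sub_eq_add_neg]
  exact Filter.BoundedAtFilter.add EisensteinSeries.isBoundedAtImInfty_E2
    (Filter.BoundedAtFilter.neg (Filter.BoundedAtFilter.smul _ (isBoundedAtImInfty_D2 γ)))

/-- The modular form `E₂(τ) - 2 E₂(2 τ)` of weight two. -/
def E2Two :
    ModularForm ((CongruenceSubgroup.Gamma0 2 : Subgroup SL(2, ℤ)) : Subgroup (GL (Fin 2) ℝ)) 2 where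
  toFun := EisensteinSeries.E2 - EisensteinSeries.E2 ∣[(2 : ℤ)] diagTwo
  slash_action_eq' := by
    rintro _ ⟨γ, hγ, rfl⟩
    obtain ⟨γ', h, hc, hd⟩ := exists_diagTwo_conj hγ
    change (EisensteinSeries.E2 - EisensteinSeries.E2 ∣[(2 : ℤ)] diagTwo) ∣[(2 : ℤ)]
      (γ : GL (Fin 2) ℝ) = _
    rw [sub_eq_add_neg, SlashAction.add_slash, SlashAction.neg_slash, ← SlashAction.slash_mul, h,
      SlashAction.slash_mul]
    have h1 := EisensteinSeries.E2_slash_action γ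
    have h2 := EisensteinSeries.E2_slash_action γ'
    rw [ModularForm.SL_slash] at h1 h2
    rw [h1, h2]
    ext τ
    simp only [Pi.add_apply, Pi.neg_apply, Pi.sub_apply, Pi.smul_apply, slash_diagTwo, smul_eq_mul]
    -- The anomalies of `E₂(τ)` and `2 E₂(2τ)` cancel: `(c/2)(2τ) + d = cτ + d`, and the factor `2`
    -- restores the numerator.
    have hD : 2 * EisensteinSeries.D2 γ' (doublePt τ) = EisensteinSeries.D2 γ τ := by
      simp only [EisensteinSeries.D2, ModularGroup.denom_apply, hd, ← hc]
      push_cast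
      simp only [doublePt]
      ring_nf
    rw [← hD]
    norm_num
    ring
  holo' := E2_mdifferentiable.sub (E2_mdifferentiable.slash 2 diagTwo)
  bdd_at_cusps' := by
    intro c hc
    have h1 := isBoundedAt_E2 (hc.mono Gamma0_two_le)
    have h2 : c.IsBoundedAt (EisensteinSeries.E2 ∣[(2 : ℤ)] diagTwo) 2 := by
      rw [← OnePoint.IsBoundedAt.smul_iff]
      apply isBoundedAt_E2
      have := (hc.mono Gamma0_two_le_conj).smul diagTwo
      simpa using this
    intro g hg
    have h3 := Filter.BoundedAtFilter.add (h1 g hg) (Filter.BoundedAtFilter.neg (h2 g hg))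
    rw [← SlashAction.neg_slash, ← SlashAction.add_slash, ← sub_eq_add_neg] at h3
    exact h3

lemma hasQExpansion_of_sigma {f : ℍ → ℂ} {k : ℕ} {b : ℂ}
    (h : ∀ τ : ℍ, f τ = 1 + b * ∑' n : ℕ+, (ArithmeticFunction.sigma k n : ℂ) *
      Complex.exp (2 * Real.pi * Complex.I * τ) ^ (n : ℕ)) :
    HasQExpansion f (1 + b • sigmaSeries k) := by
  intro τ
  have hS : Summable fun n : ℕ => (ArithmeticFunction.sigma k n : ℂ) *
      Complex.exp (2 * Real.pi * Complex.I * τ) ^ n :=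
    EisensteinSeries.summable_sigma_mul_cexp_pow (k := k + 1) (by omega) τ
  have h1 : HasSum (fun n : ℕ => if n = 0 then (1 : ℂ) else 0) 1 := hasSum_ite_eq 0 1
  have h2 := h1.add (hS.hasSum.mul_left b)
  rw [h τ, tsum_pnat_eq_tsum_succ (f := fun n => (ArithmeticFunction.sigma k n : ℂ) *
    Complex.exp (2 * Real.pi * Complex.I * τ) ^ n)]
  rw [hS.tsum_eq_zero_add] at h2
  simp only [ArithmeticFunction.map_zero, Nat.cast_zero, zero_mul, zero_add] at h2
  convert! h2 using 2 with n
  rcases Nat.eq_zero_or_pos n with rfl | hn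
  · simp [sigmaSeries]
  · simp [sigmaSeries, PowerSeries.coeff_one, hn.ne', mul_assoc]

lemma hasQExpansion_E2 :
    HasQExpansion EisensteinSeries.E2 (1 + (-24 : ℂ) • sigmaSeries 1) :=
  hasQExpansion_of_sigma fun τ => by
    rw [EisensteinSeries.E2_eq_tsum_cexp]
    ring

lemma hasQExpansion_E {k : ℕ} (hk : 3 ≤ k) (hk2 : Even k) :
    HasQExpansion (ModularForm.E hk) (1 + ((riemannZeta k)⁻¹ * (-2 * Real.pi * Complex.I) ^ k /
      (k - 1).factorial) • sigmaSeries (k - 1)) :=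
  hasQExpansion_of_sigma fun τ => by
    rw [EisensteinSeries.q_expansion_riemannZeta hk hk2]
    simp

lemma sqSubst_one_add (b : ℂ) (p : ℂ⟦X⟧) : sqSubst (1 + b • p) = 1 + b • sqSubst p := by
  ext n
  simp only [sqSubst, map_add, PowerSeries.coeff_mk, PowerSeries.coeff_one, map_smul]
  by_cases h : Even n
  · obtain ⟨m, rfl⟩ := h
    simp only [show (m + m) / 2 = m by omega, show m + m = 0 ↔ m = 0 by omega]
    simp
  · have : n ≠ 0 := by rintro rfl; simp at h
    simp [h, this]

/-- Weights are only bounded above, so the constant term of an Eisenstein series may be subtracted.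
-/
lemma mem_qmSeries_of_one_add_smul {w : ℕ} {b : ℂ} (hb : b ≠ 0) {p : ℂ⟦X⟧}
    (h : 1 + b • p ∈ qmSeries w) : p ∈ qmSeries w := by
  have h1 := Submodule.smul_mem _ b⁻¹ (sub_mem h (one_mem_qmSeries w))
  rwa [add_sub_cancel_left, inv_smul_smul₀ hb] at h1

/-- For even `k ≥ 4` both `E_k(τ)` and `E_k(2τ)` are modular on `Γ₀(2)`. For `k = 2`, `E₂(2τ)` is
obtained from `E₂` and the modular form `E₂(τ) - 2 E₂(2τ)`. -/
lemma sigmaSeries_mem {k : ℕ} (hk : Even k) (hk0 : k ≠ 0) :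
    sigmaSeries (k - 1) ∈ qmSeries k ∧ sqSubst (sigmaSeries (k - 1)) ∈ qmSeries k := by
  by_cases h2 : k = 2
  · subst h2
    have hE : EisensteinSeries.E2 ∈ QuasimodularLE 2 2 := by
      have := E2_pow_mul_mem_quasimodularLE (N := 2) 1 0 (1 : ModularForm _ 0) (w := 2) le_rfl
      simpa using this
    have hD : (fun τ => EisensteinSeries.E2 (doublePt τ)) ∈ QuasimodularLE 2 2 := by
      have h1 := modularForm_mem_quasimodularLE (N := 2) 2 E2Two (w := 2) le_rfl
      convert Submodule.smul_mem _ (2⁻¹ : ℂ) (sub_mem hE h1) using 1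
      ext τ
      have h3 : E2Two τ = EisensteinSeries.E2 τ -
        (EisensteinSeries.E2 ∣[(2 : ℤ)] diagTwo) τ := rfl
      simp [h3, slash_diagTwo]
    refine ⟨mem_qmSeries_of_one_add_smul (b := -24) (by norm_num) ⟨_, hE, hasQExpansion_E2⟩,
      mem_qmSeries_of_one_add_smul (b := -24) (by norm_num) ⟨_, hD, ?_⟩⟩
    rw [← sqSubst_one_add]
    exact hasQExpansion_E2.sqSubst
  · have hk3 : 3 ≤ k := by
      obtain ⟨m, rfl⟩ := hk
      omega
    have hb : (riemannZeta k)⁻¹ * (-2 * Real.pi * Complex.I) ^ k / (k - 1).factorial ≠ 0 := by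
      have h1 : riemannZeta k ≠ 0 := riemannZeta_ne_zero_of_one_lt_re (by
        simp; omega)
      have h3 : (-2 * Real.pi * Complex.I : ℂ) ≠ 0 := by
        simp [Real.pi_ne_zero]
      have h4 : ((k - 1).factorial : ℂ) ≠ 0 := by exact_mod_cast Nat.factorial_ne_zero _
      positivity
    have hE := modularForm_mem_quasimodularLE (N := 2) k
      (restrictForm Gamma0_two_le (ModularForm.E hk3)) (w := k) le_rfl
    have hD : (fun τ => ModularForm.E hk3 (doublePt τ)) ∈ QuasimodularLE 2 k := by
      have h1 := modularForm_mem_quasimodularLE (N := 2) k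
        (restrictForm Gamma0_two_le_conj (ModularForm.translate (ModularForm.E hk3) diagTwo))
        (w := k) le_rfl
      convert Submodule.smul_mem _ ((2 : ℂ) ^ ((k : ℤ) - 1))⁻¹ h1 using 1
      ext τ
      have h3 : restrictForm Gamma0_two_le_conj
          (ModularForm.translate (ModularForm.E hk3) diagTwo) τ =
        (⇑(ModularForm.E hk3) ∣[(k : ℤ)] diagTwo) τ := rfl
      rw [Pi.smul_apply, h3, slash_diagTwo, smul_eq_mul, inv_mul_cancel_left₀]
      exact zpow_ne_zero _ two_ne_zero
    refine ⟨mem_qmSeries_of_one_add_smul hb ⟨_, hE, hasQExpansion_E hk3 hk⟩,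
      mem_qmSeries_of_one_add_smul hb ⟨_, hD, ?_⟩⟩
    rw [← sqSubst_one_add]
    exact (hasQExpansion_E hk3 hk).sqSubst

end OverpartitionMoments

end

noncomputable section
namespace OverpartitionMoments
open PowerSeries

/-! ### Convergent sums and products of formal power series -/

section QAdic

variable {R : Type*} [CommRing R]

theorem eq_of_forall_X_pow_dvd_sub {A B : R⟦X⟧} (h : ∀ N : ℕ, X ^ N ∣ A - B) : A = B := by
  ext n
  have := (X_pow_dvd_iff.mp (h (n + 1))) n (Nat.lt_succ_self n)
  simpa [sub_eq_zero] using this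

theorem coeff_eq_of_X_pow_dvd_sub {A B : R⟦X⟧} {N n : ℕ} (h : X ^ N ∣ A - B) (hn : n < N) :
    coeff n A = coeff n B := by
  have := (X_pow_dvd_iff.mp h) n hn
  simpa [sub_eq_zero] using this

theorem X_pow_dvd_sub_of_coeff_eq {A B : R⟦X⟧} {N : ℕ} (h : ∀ n < N, coeff n A = coeff n B) :
    X ^ N ∣ A - B :=
  X_pow_dvd_iff.mpr fun n hn => by simp [h n hn]

theorem dvd_mul_sub_mul {d a b a' b' : R⟦X⟧} (h : d ∣ a - a') (h' : d ∣ b - b') :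
    d ∣ a * b - a' * b' := by
  have : a * b - a' * b' = (a - a') * b + a' * (b - b') := by ring
  rw [this]
  exact dvd_add (dvd_mul_of_dvd_left h _) (dvd_mul_of_dvd_right h' _)

/-- A family of power series whose `s`-th member is divisible by `X ^ s`. -/
def Adm (f : ℕ → R⟦X⟧) : Prop := ∀ s, X ^ s ∣ f s

/-- The `X`-adically convergent sum of an admissible family. -/
def qsum (f : ℕ → R⟦X⟧) : R⟦X⟧ := mk fun n => ∑ s ∈ Finset.range (n + 1), coeff n (f s)

theorem coeff_qsum {f : ℕ → R⟦X⟧} (hf : Adm f) {n N : ℕ} (h : n < N) :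
    coeff n (qsum f) = ∑ s ∈ Finset.range N, coeff n (f s) := by
  rw [qsum, coeff_mk]
  refine Finset.sum_subset (fun s hs => ?_) fun s _ hs => ?_
  · simp only [Finset.mem_range] at *; omega
  · simp only [Finset.mem_range, not_lt] at hs
    exact X_pow_dvd_iff.mp (hf s) n (by omega)

theorem X_pow_dvd_qsum_sub {f : ℕ → R⟦X⟧} (hf : Adm f) (N : ℕ) :
    X ^ N ∣ qsum f - ∑ s ∈ Finset.range N, f s :=
  X_pow_dvd_sub_of_coeff_eq fun n hn => by rw [coeff_qsum hf hn, map_sum]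

theorem eq_qsum {f : ℕ → R⟦X⟧} (hf : Adm f) {A : R⟦X⟧}
    (h : ∀ N, X ^ N ∣ A - ∑ s ∈ Finset.range N, f s) : A = qsum f :=
  eq_of_forall_X_pow_dvd_sub fun N => by
    simpa using dvd_sub (h N) (X_pow_dvd_qsum_sub hf N)

theorem Adm.mul_left {f : ℕ → R⟦X⟧} (hf : Adm f) (g : ℕ → R⟦X⟧) : Adm fun s => g s * f s :=
  fun s => dvd_mul_of_dvd_right (hf s) _

theorem Adm.mul_right {f : ℕ → R⟦X⟧} (hf : Adm f) (g : ℕ → R⟦X⟧) : Adm fun s => f s * g s :=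
  fun s => dvd_mul_of_dvd_left (hf s) _

theorem Adm.sub {f g : ℕ → R⟦X⟧} (hf : Adm f) (hg : Adm g) : Adm fun s => f s - g s :=
  fun s => dvd_sub (hf s) (hg s)

theorem qsum_add (f g : ℕ → R⟦X⟧) : qsum (fun s => f s + g s) = qsum f + qsum g := by
  ext n; simp [qsum, Finset.sum_add_distrib]

theorem qsum_sub (f g : ℕ → R⟦X⟧) : qsum (fun s => f s - g s) = qsum f - qsum g := by
  ext n; simp [qsum, Finset.sum_sub_distrib]

theorem qsum_mul_left {f : ℕ → R⟦X⟧} (hf : Adm f) (A : R⟦X⟧) :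
    A * qsum f = qsum fun s => A * f s :=
  eq_qsum (hf.mul_left fun _ => A) fun N => by
    rw [← Finset.mul_sum, ← mul_sub]
    exact dvd_mul_of_dvd_right (X_pow_dvd_qsum_sub hf N) _

theorem qsum_mul_right {f : ℕ → R⟦X⟧} (hf : Adm f) (A : R⟦X⟧) :
    qsum f * A = qsum fun s => f s * A := by
  simpa only [mul_comm] using qsum_mul_left hf A

theorem X_pow_dvd_qsum {f : ℕ → R⟦X⟧} {k : ℕ} (h : ∀ s, X ^ k ∣ f s) : X ^ k ∣ qsum f :=
  X_pow_dvd_iff.mpr fun n hn => by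
    rw [qsum, coeff_mk]
    exact Finset.sum_eq_zero fun s _ => X_pow_dvd_iff.mp (h s) n hn

theorem qsum_succ {f : ℕ → R⟦X⟧} (hf : Adm f) : qsum f = f 0 + qsum fun s => f (s + 1) := by
  ext n
  rw [coeff_qsum hf (show n < n + 2 by omega), Finset.sum_range_succ', map_add, qsum, coeff_mk,
    add_comm]

theorem Adm.succ {f : ℕ → R⟦X⟧} (hf : Adm f) : Adm fun s => f (s + 1) :=
  fun s => (pow_dvd_pow X (Nat.le_succ s)).trans (hf (s + 1))

theorem qsum_telescope {Z : ℕ → R⟦X⟧} (hZ : Adm Z) : qsum (fun s => Z s - Z (s + 1)) = Z 0 := by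
  refine (eq_qsum (hZ.sub hZ.succ) fun N => ?_).symm
  rw [Finset.sum_range_sub']
  simpa using hZ N

theorem qsum_congr {f g : ℕ → R⟦X⟧} (h : ∀ s, f s = g s) : qsum f = qsum g := by
  rw [show f = g from funext h]

theorem qsum_zero : qsum (fun _ => (0 : R⟦X⟧)) = 0 := by
  ext n; simp [qsum]

theorem X_pow_dvd_map {S : Type*} [CommRing S] (φ : R →+* S) {A : R⟦X⟧} {N : ℕ} (h : X ^ N ∣ A) :
    X ^ N ∣ PowerSeries.map φ A := by
  simpa using _root_.map_dvd (PowerSeries.map φ) h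

theorem map_qsum {S : Type*} [CommRing S] (φ : R →+* S) (f : ℕ → R⟦X⟧) :
    PowerSeries.map φ (qsum f) = qsum fun s => PowerSeries.map φ (f s) := by
  ext n; simp [qsum]

/-- The bound `X ^ (k + i)` leaves finitely many terms in each degree, so a double series may be
summed along diagonals or by rows. -/
theorem qsum_antidiagonal {f : ℕ → ℕ → R⟦X⟧} (hf : ∀ k i, X ^ (k + i) ∣ f k i) :
    qsum (fun s => ∑ x ∈ Finset.HasAntidiagonal.antidiagonal s, f x.1 x.2) = qsum fun k => qsum (f k) := by
  have h1 : ∀ k, Adm (f k) := fun k i => (pow_dvd_pow X (Nat.le_add_left i k)).trans (hf k i)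
  have h2 : Adm fun k => qsum (f k) := fun k => X_pow_dvd_qsum fun i =>
    (pow_dvd_pow X (Nat.le_add_right k i)).trans (hf k i)
  have h3 : Adm fun s => ∑ x ∈ Finset.HasAntidiagonal.antidiagonal s, f x.1 x.2 := fun s =>
    Finset.dvd_sum fun x hx => by
      rw [← Finset.HasAntidiagonal.mem_antidiagonal.mp hx]; exact hf _ _
  ext n
  rw [coeff_qsum h3 n.lt_succ_self, coeff_qsum h2 n.lt_succ_self]
  simp only [map_sum, coeff_qsum (h1 _) n.lt_succ_self]
  rw [← Finset.sum_product', Finset.sum_sigma']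
  refine Finset.sum_bij_ne_zero (fun x _ _ => x.2) (fun x hx _ => ?_) (fun x hx _ y hy _ h => ?_)
    (fun y hy hne => ?_) fun x _ _ => rfl
  · simp only [Finset.mem_sigma, Finset.mem_range, Finset.HasAntidiagonal.mem_antidiagonal,
      Finset.mem_product] at *
    omega
  · obtain ⟨x1, x2⟩ := x
    obtain ⟨y1, y2⟩ := y
    simp only [Finset.mem_sigma, Finset.mem_range, Finset.HasAntidiagonal.mem_antidiagonal] at *
    subst h
    have : x1 = y1 := by omega
    subst this; rfl
  · refine ⟨⟨y.1 + y.2, y⟩, ?_, hne, rfl⟩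
    simp only [Finset.mem_sigma, Finset.mem_range, Finset.HasAntidiagonal.mem_antidiagonal,
      and_true]
    by_contra hlt
    exact hne (X_pow_dvd_iff.mp (hf y.1 y.2) n (by omega))

/-- Two families satisfying the same first order recursion and tending to `1` agree. -/
theorem eq_of_recursion {d n f g : ℕ → R⟦X⟧} (hd : ∀ k, IsUnit (d k))
    (hf : ∀ k, d k * f k = n k * f (k + 1)) (hg : ∀ k, d k * g k = n k * g (k + 1))
    (hfg : ∀ k, X ^ k ∣ f k - g k) (k : ℕ) : f k = g k := by
  -- Each use of the recursion replaces `k` by `k + 1`, where the divisibility known is one power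
  -- better; the unit `d k` loses nothing.
  have key : ∀ j k, X ^ (k + j) ∣ f k - g k := by
    intro j
    induction j with
    | zero => exact fun k => hfg k
    | succ j ih =>
      intro k
      have h1 : d k * (f k - g k) = n k * (f (k + 1) - g (k + 1)) := by
        rw [mul_sub, mul_sub, hf, hg]
      have h2 : X ^ (k + (j + 1)) ∣ d k * (f k - g k) := by
        rw [h1]
        refine dvd_mul_of_dvd_right ?_ _
        have := ih (k + 1)
        rwa [show k + 1 + j = k + (j + 1) by ring] at this
      exact (IsUnit.dvd_mul_left (hd k)).mp h2
  exact eq_of_forall_X_pow_dvd_sub fun N => (pow_dvd_pow X (Nat.le_add_left N k)).trans (key N k)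

/-- The infinite product of a sequence of power series with `X ^ (i + 1) ∣ u i - 1`. -/
def iprod (u : ℕ → R⟦X⟧) : R⟦X⟧ := mk fun n => coeff n (∏ i ∈ Finset.range n, u i)

theorem X_pow_dvd_prod_sub_one {ι : Type*} (s : Finset ι) {u : ι → R⟦X⟧} {d : R⟦X⟧}
    (h : ∀ i ∈ s, d ∣ u i - 1) : d ∣ ∏ i ∈ s, u i - 1 := by
  classical
  induction s using Finset.induction_on with
  | empty => simp
  | insert a s ha ih =>
    rw [Finset.prod_insert ha]
    have := dvd_mul_sub_mul (h a (Finset.mem_insert_self _ _))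
      (ih fun i hi => h i (Finset.mem_insert_of_mem hi))
    simpa using this

theorem X_pow_dvd_prod_range_sub {u : ℕ → R⟦X⟧} (hu : ∀ i, X ^ (i + 1) ∣ u i - 1) {N M : ℕ}
    (h : N ≤ M) : X ^ (N + 1) ∣ ∏ i ∈ Finset.range M, u i - ∏ i ∈ Finset.range N, u i := by
  rw [← Finset.prod_range_mul_prod_Ico _ h, ← mul_sub_one]
  refine dvd_mul_of_dvd_right (X_pow_dvd_prod_sub_one _ fun i hi => ?_) _
  exact (pow_dvd_pow X (by simp at hi; omega)).trans (hu i)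

theorem X_pow_dvd_iprod_sub {u : ℕ → R⟦X⟧} (hu : ∀ i, X ^ (i + 1) ∣ u i - 1) (N : ℕ) :
    X ^ (N + 1) ∣ iprod u - ∏ i ∈ Finset.range N, u i :=
  X_pow_dvd_sub_of_coeff_eq fun n hn => by
    rw [iprod, coeff_mk]
    exact (coeff_eq_of_X_pow_dvd_sub (X_pow_dvd_prod_range_sub hu (Nat.lt_succ_iff.mp hn))
      n.lt_succ_self).symm

theorem eq_iprod {u : ℕ → R⟦X⟧} (hu : ∀ i, X ^ (i + 1) ∣ u i - 1) {A : R⟦X⟧}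
    (h : ∀ N, X ^ N ∣ A - ∏ i ∈ Finset.range N, u i) : A = iprod u :=
  eq_of_forall_X_pow_dvd_sub fun N => by
    simpa using dvd_sub (h N) ((pow_dvd_pow X (Nat.le_succ N)).trans (X_pow_dvd_iprod_sub hu N))

theorem X_pow_dvd_mul_sub_one {d u v : R⟦X⟧} (hu : d ∣ u - 1) (hv : d ∣ v - 1) :
    d ∣ u * v - 1 := by
  simpa using dvd_mul_sub_mul hu hv

theorem iprod_mul {u v : ℕ → R⟦X⟧} (hu : ∀ i, X ^ (i + 1) ∣ u i - 1)
    (hv : ∀ i, X ^ (i + 1) ∣ v i - 1) : iprod (fun i => u i * v i) = iprod u * iprod v := by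
  refine (eq_iprod (fun i => X_pow_dvd_mul_sub_one (hu i) (hv i)) fun N => ?_).symm
  rw [Finset.prod_mul_distrib]
  exact dvd_mul_sub_mul ((pow_dvd_pow X (Nat.le_succ N)).trans (X_pow_dvd_iprod_sub hu N))
    ((pow_dvd_pow X (Nat.le_succ N)).trans (X_pow_dvd_iprod_sub hv N))

theorem iprod_succ {u : ℕ → R⟦X⟧} (hu : ∀ i, X ^ (i + 1) ∣ u i - 1) :
    iprod u = u 0 * iprod fun i => u (i + 1) := by
  have hu' : ∀ i, X ^ (i + 1) ∣ u (i + 1) - 1 := fun i =>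
    (pow_dvd_pow X (by omega)).trans (hu (i + 1))
  refine eq_of_forall_X_pow_dvd_sub fun N => ?_
  have h1 := X_pow_dvd_iprod_sub hu (N + 1)
  rw [Finset.prod_range_succ', mul_comm] at h1
  have h2 : X ^ (N + 1) ∣ u 0 * iprod (fun i => u (i + 1)) -
      u 0 * ∏ i ∈ Finset.range N, u (i + 1) := by
    rw [← mul_sub]
    exact dvd_mul_of_dvd_right (X_pow_dvd_iprod_sub hu' N) _
  have := dvd_sub ((pow_dvd_pow X (by omega : N ≤ N + 1 + 1)).trans h1)
    ((pow_dvd_pow X (Nat.le_succ N)).trans h2)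
  simpa using this

theorem iprod_eq_prod_mul {u : ℕ → R⟦X⟧} (hu : ∀ i, X ^ (i + 1) ∣ u i - 1) (N : ℕ) :
    iprod u = (∏ i ∈ Finset.range N, u i) * iprod fun i => u (i + N) := by
  induction N with
  | zero => simp
  | succ N ih =>
    have hu' : ∀ i, X ^ (i + 1) ∣ u (i + N) - 1 := fun i =>
      (pow_dvd_pow X (by omega)).trans (hu (i + N))
    rw [ih, iprod_succ hu', Finset.prod_range_succ, mul_assoc, zero_add]
    simp only [add_assoc, add_comm 1 N]

theorem X_pow_dvd_iprod_sub_one {u : ℕ → R⟦X⟧} {k : ℕ} (hu : ∀ i, X ^ k ∣ u i - 1) :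
    X ^ k ∣ iprod u - 1 := by
  refine X_pow_dvd_sub_of_coeff_eq fun n hn => ?_
  rw [iprod, coeff_mk]
  exact coeff_eq_of_X_pow_dvd_sub (X_pow_dvd_prod_sub_one _ fun i _ => hu i) hn

theorem isUnit_of_X_dvd_sub_one {u : R⟦X⟧} (h : X ∣ u - 1) : IsUnit u := by
  rw [isUnit_iff_constantCoeff]
  have := X_dvd_iff.mp h
  rw [map_sub, map_one, sub_eq_zero] at this
  rw [this]; exact isUnit_one

theorem isUnit_iprod {u : ℕ → R⟦X⟧} (hu : ∀ i, X ^ (i + 1) ∣ u i - 1) : IsUnit (iprod u) :=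
  isUnit_of_X_dvd_sub_one (by
    have := X_pow_dvd_iprod_sub_one (k := 1) (fun i => (pow_dvd_pow X (by omega)).trans (hu i))
    simpa using this)

theorem map_iprod {S : Type*} [CommRing S] (φ : R →+* S) (u : ℕ → R⟦X⟧) :
    PowerSeries.map φ (iprod u) = iprod fun s => PowerSeries.map φ (u s) := by
  ext n; simp [iprod, ← map_prod]

end QAdic

end OverpartitionMoments

end

noncomputable section
namespace OverpartitionMoments
open PowerSeries

/-! ### Product formulas for weighted overpartitions -/

section GeneratingFunction

variable {R : Type*} [CommRing R]

/-- The generating function of a weight on overpartitions. -/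
def ovGF (W : ∀ n, Overpartition n → R) : R⟦X⟧ := mk fun n => ∑ l : Overpartition n, W n l

/-- The multiplicative weight attaching `a i` to an overlined part `i` and `g i c` to `c`
non-overlined parts `i`. -/
def ovWeight (a : ℕ → R) (g : ℕ → ℕ → R) (n : ℕ) (l : Overpartition n) : R :=
  (∏ i ∈ l.overlined, a i) * ∏ i ∈ l.parts.toFinset, g i (l.nonOverlined.count i)

/-- `∑ c, g c X ^ (i * c)`. -/
def partSeries (i : ℕ) (g : ℕ → R) : R⟦X⟧ := mk fun n => if i ∣ n then g (n / i) else 0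

theorem count_nonOverlined {n : ℕ} (l : Overpartition n) (i : ℕ) :
    l.nonOverlined.count i = l.parts.count i - if i ∈ l.overlined then 1 else 0 := by
  rw [Overpartition.nonOverlined, Multiset.count_sub,
    Multiset.count_eq_of_nodup l.overlined.nodup]
  rfl

theorem sum_overpartition {M : Type*} [AddCommMonoid M] (n : ℕ) (F : Overpartition n → M) :
    ∑ l, F l = ∑ p : n.Partition, ∑ S ∈ p.parts.toFinset.powerset.attach,
      F ⟨p, S.1, Finset.mem_powerset.mp S.2⟩ := by
  rw [← (Overpartition.equivSigma n).symm.sum_comp, Fintype.sum_sigma]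
  rfl

/-- Summing over the overlined subset is expanding a product of two-term sums: a part of
multiplicity `e` either has one overlined copy and `e - 1` others, or `e` non-overlined copies. -/
theorem sum_ovWeight (a : ℕ → R) (g : ℕ → ℕ → R) (n : ℕ) :
    ∑ l, ovWeight a g n l = ∑ p : n.Partition, ∏ i ∈ p.parts.toFinset,
      (a i * g i (p.parts.count i - 1) + g i (p.parts.count i)) := by
  rw [sum_overpartition]
  refine Finset.sum_congr rfl fun p _ => ?_
  rw [Finset.prod_add, ← Finset.sum_attach (p.parts.toFinset.powerset)]
  refine Finset.sum_congr rfl fun S _ => ?_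
  have hS := Finset.mem_powerset.mp S.2
  rw [ovWeight, Finset.prod_mul_distrib, mul_assoc]
  congr 1
  simp only [count_nonOverlined, Overpartition.parts]
  rw [← Finset.prod_sdiff hS, mul_comm]
  congr 1
  · exact Finset.prod_congr rfl fun i hi => by rw [if_pos hi]
  · exact Finset.prod_congr rfl fun i hi => by
      rw [if_neg (Finset.mem_sdiff.mp hi).2, Nat.sub_zero]

/-- Degree zero is separate because the truncated `0 / i - 1` would otherwise count a spurious term
`a * g 0`. -/
theorem partSeries_factor {i : ℕ} (hi : 0 < i) (a : R) {g : ℕ → R} (n : ℕ) :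
    coeff n ((1 + C a * X ^ i) * partSeries i g) =
      if i ∣ n then (if n = 0 then g 0 else a * g (n / i - 1) + g (n / i)) else 0 := by
  rw [add_mul, one_mul, map_add, mul_assoc, coeff_C_mul, coeff_X_pow_mul', partSeries, coeff_mk,
    coeff_mk]
  by_cases h : i ∣ n
  · obtain ⟨m, rfl⟩ := h
    rcases m with _ | m
    · simp [hi.ne']
    · have h1 : i ≤ i * (m + 1) := Nat.le_mul_of_pos_right i (by omega)
      have h2 : i * (m + 1) - i = i * m := by rw [Nat.mul_succ]; simp
      have h3 : i * (m + 1) ≠ 0 := by positivity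
      simp only [h1, if_true, h2, dvd_mul_right, h3, if_false, Nat.mul_div_cancel_left _ hi,
        Nat.add_sub_cancel]
      ring
  · by_cases h1 : i ≤ n
    · have : ¬ i ∣ n - i := fun h2 => h (by simpa [h1] using (Nat.dvd_add_right (dvd_refl i)).mpr h2)
      simp [h, this]
    · simp [h, h1]

theorem X_pow_dvd_partSeries_sub_one {i : ℕ} (a : R) {g : ℕ → R} (hg : g 0 = 1) :
    X ^ (i + 1) ∣ (1 + C a * X ^ (i + 1)) * partSeries (i + 1) g - 1 :=
  X_pow_dvd_sub_of_coeff_eq fun n hn => by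
    rw [partSeries_factor i.succ_pos, coeff_one]
    rcases Nat.eq_zero_or_pos n with rfl | h
    · simp [hg]
    · simp [Nat.not_dvd_of_pos_of_lt h hn, h.ne']

/-- The product formula for the generating function of a multiplicative weight. -/
theorem ovGF_eq_iprod (a : ℕ → R) {g : ℕ → ℕ → R} (hg : ∀ i, g i 0 = 1) :
    ovGF (ovWeight a g) =
      iprod fun i => (1 + C (a (i + 1)) * X ^ (i + 1)) * partSeries (i + 1) (g (i + 1)) := by
  -- With the discrete topology on `R`, convergence of the infinite product means that each
  -- coefficient is eventually constant, which is what `iprod` encodes.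
  let _ : TopologicalSpace R := ⊥
  have : DiscreteTopology R := ⟨rfl⟩
  let _ : TopologicalSpace R⟦X⟧ := PowerSeries.WithPiTopology.instTopologicalSpace R
  have : T2Space R⟦X⟧ := PowerSeries.WithPiTopology.instT2Space R
  set f : ℕ → ℕ → R := fun i c => a i * g i (c - 1) + g i c with hf
  have h1 : ovGF (ovWeight a g) = Nat.Partition.genFun f := by
    ext n
    rw [ovGF, coeff_mk, sum_ovWeight, Nat.Partition.coeff_genFun]
    refine Finset.sum_congr rfl fun p _ => ?_
    simp [Finsupp.prod, hf]
  set u : ℕ → R⟦X⟧ :=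
    fun i => (1 + C (a (i + 1)) * X ^ (i + 1)) * partSeries (i + 1) (g (i + 1)) with hu
  have hu1 : ∀ i, X ^ (i + 1) ∣ u i - 1 := fun i => X_pow_dvd_partSeries_sub_one _ (hg _)
  have h2 : ∀ i, 1 + ∑' j, f (i + 1) (j + 1) • (X : R⟦X⟧) ^ ((i + 1) * (j + 1)) = u i := by
    intro i
    ext n
    rw [map_add, (Nat.Partition.summable_genFun_term f i).map_tsum _
      (PowerSeries.WithPiTopology.continuous_coeff R n), hu, partSeries_factor i.succ_pos]
    by_cases h : (i + 1) ∣ n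
    · obtain ⟨m, rfl⟩ := h
      rcases m with _ | m
      · simp [hg, coeff_X_pow]
      · rw [tsum_eq_single m]
        · simp [hf, coeff_one]
        · intro b hb
          simp [coeff_X_pow, Ne.symm hb]
    · have h0 : n ≠ 0 := by rintro rfl; simp at h
      have : ∀ j, n ≠ (i + 1) * (j + 1) := fun j hj => h ⟨_, hj⟩
      simp [coeff_X_pow, this, h, coeff_one, h0]
  have h3 := Nat.Partition.hasProd_genFun f
  simp only [h2] at h3
  rw [h1]
  refine eq_iprod hu1 fun N => ?_
  refine X_pow_dvd_sub_of_coeff_eq fun n hn => ?_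
  have h4 : Filter.Tendsto (fun s : Finset ℕ => coeff n (∏ i ∈ s, u i)) Filter.atTop
      (nhds (coeff n (Nat.Partition.genFun f))) :=
    ((PowerSeries.WithPiTopology.continuous_coeff R n).tendsto _).comp h3
  rw [nhds_discrete, Filter.tendsto_pure] at h4
  obtain ⟨s, hs1, hs2⟩ := (h4.and (Filter.eventually_ge_atTop (Finset.range N))).exists
  rw [← hs1]
  refine coeff_eq_of_X_pow_dvd_sub (N := N) ?_ hn
  have hs3 : Finset.range N ⊆ s := hs2
  rw [← Finset.prod_sdiff hs3, mul_comm, ← mul_sub_one]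
  refine dvd_mul_of_dvd_right (X_pow_dvd_prod_sub_one _ fun i hi => ?_) _
  exact (pow_dvd_pow X (by simp at hi; omega)).trans (hu1 i)

theorem partSeries_pow_mul {i : ℕ} (hi : 0 < i) (b : R) :
    partSeries i (fun c => b ^ c) * (1 - C b * X ^ i) = 1 := by
  have := fun n => partSeries_factor hi (-b) (g := fun c => b ^ c) n
  ext n
  rw [mul_comm, sub_eq_add_neg, ← neg_mul, ← map_neg, this, coeff_one]
  by_cases h : i ∣ n
  · obtain ⟨m, rfl⟩ := h
    rcases m with _ | m
    · simp
    · simp [Nat.mul_div_cancel_left _ hi, pow_succ, hi.ne']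
      ring
  · have h0 : n ≠ 0 := by rintro rfl; simp at h
    simp [h, h0]

theorem X_pow_dvd_one_add_C_mul_sub_one (a : R) (i : ℕ) :
    X ^ (i + 1) ∣ (1 + C a * X ^ (i + 1)) - 1 := by simp

theorem X_pow_dvd_one_sub_C_mul_sub_one (a : R) (i : ℕ) :
    X ^ (i + 1) ∣ (1 - C a * X ^ (i + 1)) - 1 := by simp

/-- The weight attaching `a i` to overlined and `b i` to non-overlined parts. -/
def ovMulWeight (a b : ℕ → R) (n : ℕ) (l : Overpartition n) : R :=
  (∏ i ∈ l.overlined, a i) * (l.nonOverlined.map b).prod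

theorem ovMulWeight_eq (a b : ℕ → R) (n : ℕ) (l : Overpartition n) :
    ovMulWeight a b n l = ovWeight a (fun i c => b i ^ c) n l := by
  rw [ovMulWeight, ovWeight, Finset.prod_multiset_map_count]
  congr 1
  refine Finset.prod_subset (fun i hi => ?_) fun i _ hi => ?_
  · rw [Multiset.mem_toFinset] at *
    exact Multiset.mem_of_le (Multiset.sub_le_self _ _) hi
  · rw [Multiset.mem_toFinset, ← Multiset.count_eq_zero] at hi
    rw [hi, pow_zero]

theorem ovGF_mulWeight (a b : ℕ → R) :
    ovGF (ovMulWeight a b) * iprod (fun i => 1 - C (b (i + 1)) * X ^ (i + 1)) =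
      iprod fun i => 1 + C (a (i + 1)) * X ^ (i + 1) := by
  have h1 : ovGF (ovMulWeight a b) = ovGF (ovWeight a fun i c => b i ^ c) := by
    ext n; simp [ovGF, ovMulWeight_eq]
  rw [h1, ovGF_eq_iprod a (fun i => pow_zero _), ← iprod_mul
    (fun i => X_pow_dvd_partSeries_sub_one _ (pow_zero _))
    (fun i => X_pow_dvd_one_sub_C_mul_sub_one _ _)]
  congr 1
  ext1 i
  rw [mul_assoc, partSeries_pow_mul i.succ_pos, mul_one]

/-- The largest value of a part, where overlined parts have value `vo` and the others `vn`. -/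
def maxValue (vo vn : ℕ → ℕ) {n : ℕ} (l : Overpartition n) : ℕ :=
  max (l.overlined.sup vo) (l.nonOverlined.map vn).sup

theorem le_of_mem_parts {n : ℕ} (l : Overpartition n) {i : ℕ} (h : i ∈ l.parts) : i ≤ n := by
  have := Multiset.single_le_sum (fun _ _ => Nat.zero_le _) i h
  simpa [Overpartition.parts, l.toPartition.parts_sum] using this

theorem mem_parts_of_mem_overlined {n : ℕ} (l : Overpartition n) {i : ℕ} (h : i ∈ l.overlined) :
    i ∈ l.parts := Multiset.mem_toFinset.mp (l.overlined_subset h)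

theorem mem_parts_of_mem_nonOverlined {n : ℕ} (l : Overpartition n) {i : ℕ}
    (h : i ∈ l.nonOverlined) : i ∈ l.parts := Multiset.mem_of_le (Multiset.sub_le_self _ _) h

theorem maxValue_le_iff {vo vn : ℕ → ℕ} {n : ℕ} (l : Overpartition n) (s : ℕ) :
    maxValue vo vn l ≤ s ↔ (∀ i ∈ l.overlined, vo i ≤ s) ∧ ∀ i ∈ l.nonOverlined, vn i ≤ s := by
  simp [maxValue, Finset.sup_le_iff, Multiset.sup_le]

theorem maxValue_le {vo vn : ℕ → ℕ} (ho : ∀ i, vo i ≤ i) (hn : ∀ i, vn i ≤ i) {n : ℕ}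
    (l : Overpartition n) : maxValue vo vn l ≤ n :=
  (maxValue_le_iff l n).mpr
    ⟨fun i hi => (ho i).trans (le_of_mem_parts l (mem_parts_of_mem_overlined l hi)),
     fun i hi => (hn i).trans (le_of_mem_parts l (mem_parts_of_mem_nonOverlined l hi))⟩

/-- The weight restricted to the parts of value at most `s`. -/
def cutWeight (v : ℕ → ℕ) (a : ℕ → R) (s i : ℕ) : R := if v i ≤ s then a i else 0

theorem ovMulWeight_cut (vo vn : ℕ → ℕ) (a b : ℕ → R) (s n : ℕ) (l : Overpartition n) :
    ovMulWeight (cutWeight vo a s) (cutWeight vn b s) n l =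
      if maxValue vo vn l ≤ s then ovMulWeight a b n l else 0 := by
  split_ifs with h
  · obtain ⟨h1, h2⟩ := (maxValue_le_iff l s).mp h
    rw [ovMulWeight, ovMulWeight]
    congr 1
    · exact Finset.prod_congr rfl fun i hi => if_pos (h1 i hi)
    · congr 1
      exact Multiset.map_congr rfl fun i hi => if_pos (h2 i hi)
  · rw [maxValue_le_iff, not_and_or] at h
    rcases h with h | h
    · push Not at h
      obtain ⟨i, hi, hs⟩ := h
      rw [ovMulWeight, Finset.prod_eq_zero hi (if_neg (not_le.mpr hs)), zero_mul]
    · push Not at h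
      obtain ⟨i, hi, hs⟩ := h
      rw [ovMulWeight, Multiset.prod_eq_zero, mul_zero]
      exact Multiset.mem_map.mpr ⟨i, hi, if_neg (not_le.mpr hs)⟩

/-- Sorting overpartitions by the largest value of a part. -/
theorem ovGF_maxValue {vo vn : ℕ → ℕ} (ho : ∀ i, vo i ≤ i) (hn : ∀ i, vn i ≤ i) (a b : ℕ → R)
    (t : R) :
    ovGF (fun n l => t ^ maxValue vo vn l * ovMulWeight a b n l) =
      ovGF (ovMulWeight (cutWeight vo a 0) (cutWeight vn b 0)) +
      qsum fun s => C (t ^ (s + 1)) *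
        (ovGF (ovMulWeight (cutWeight vo a (s + 1)) (cutWeight vn b (s + 1))) -
          ovGF (ovMulWeight (cutWeight vo a s) (cutWeight vn b s))) := by
  ext n
  simp only [ovGF, qsum, map_add, coeff_mk, coeff_C_mul, map_sub, ovMulWeight_cut,
    ← Finset.sum_sub_distrib]
  simp only [Finset.mul_sum]
  rw [Finset.sum_comm, ← Finset.sum_add_distrib]
  refine Finset.sum_congr rfl fun l _ => ?_
  have hle := maxValue_le ho hn l
  set m := maxValue vo vn l
  set W := ovMulWeight a b n l
  -- The difference of the cuts at `s + 1` and `s` selects the overpartitions with maximal value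
  -- exactly `s + 1`, so only `s = m - 1` contributes.
  rcases Nat.eq_zero_or_pos m with h0 | hpos
  · simp [h0]
  · obtain ⟨k, hk⟩ : ∃ k, m = k + 1 := ⟨m - 1, by omega⟩
    rw [Finset.sum_eq_single k, hk]
    · simp
    · intro s _ hs
      by_cases h : m ≤ s
      · simp [h, h.trans (Nat.le_succ s)]
      · have h' : ¬ m ≤ s + 1 := by omega
        simp [h, h']
    · intro h; simp at h; omega

end GeneratingFunction

end OverpartitionMoments

end

noncomputable section
namespace OverpartitionMoments
open PowerSeries

/-! ### Two-variable series: coefficients, evaluations and derivations -/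

section Laurent

/-- Laurent polynomials in the rank variable `z`. -/
abbrev LP := LaurentPolynomial ℂ

theorem LP.coeff_C_mul (a : ℂ) (f : LP) (m : ℤ) :
    (LaurentPolynomial.C a * f).coeff m = a * f.coeff m := by
  rw [← LaurentPolynomial.smul_eq_C_mul]; rfl

theorem LP.coeff_T_mul (j : ℤ) (f : LP) (m : ℤ) :
    (LaurentPolynomial.T j * f).coeff m = f.coeff (m - j) := by
  induction f using LaurentPolynomial.induction_on' with
  | add p q hp hq =>
    rw [mul_add, AddMonoidAlgebra.coeff_add, Finsupp.add_apply, hp, hq,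
      AddMonoidAlgebra.coeff_add, Finsupp.add_apply]
  | C_mul_T n a =>
    rw [mul_left_comm, LP.coeff_C_mul, LP.coeff_C_mul, ← LaurentPolynomial.T_add,
      LaurentPolynomial.T_apply, LaurentPolynomial.T_apply]
    congr 1
    exact if_congr (by constructor <;> intro h <;> omega) rfl rfl

/-- The derivation `z d/dz` on Laurent polynomials. -/
def lpDelta : LP →ₗ[ℂ] LP where
  toFun f := .ofCoeff (Finsupp.onFinset f.coeff.support (fun m => (m : ℂ) * f.coeff m)
    (fun m h => by simp only [ne_eq, mul_eq_zero, not_or] at h; simpa using h.2))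
  map_add' f g := by
    apply LaurentPolynomial.ext; intro m; simp [mul_add]
  map_smul' a f := by
    apply LaurentPolynomial.ext; intro m; simp; ring

theorem coeff_lpDelta (f : LP) (m : ℤ) : (lpDelta f).coeff m = m * f.coeff m := rfl

theorem lpDelta_C_mul_T (a : ℂ) (n : ℤ) :
    lpDelta (LaurentPolynomial.C a * LaurentPolynomial.T n) =
      LaurentPolynomial.C (n * a) * LaurentPolynomial.T n := by
  apply LaurentPolynomial.ext; intro m
  rw [coeff_lpDelta, LP.coeff_C_mul, LP.coeff_C_mul, LaurentPolynomial.T_apply]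
  split_ifs with h
  · subst h; ring
  · ring

theorem lpDelta_mul (f g : LP) : lpDelta (f * g) = lpDelta f * g + f * lpDelta g := by
  induction f using LaurentPolynomial.induction_on' with
  | add p q hp hq => simp only [add_mul, map_add, hp, hq]; ring
  | C_mul_T n a =>
    induction g using LaurentPolynomial.induction_on' with
    | add p q hp hq => simp only [mul_add, map_add, hp, hq]; ring
    | C_mul_T m b =>
      rw [show LaurentPolynomial.C a * LaurentPolynomial.T n *
        (LaurentPolynomial.C b * LaurentPolynomial.T m) =
        LaurentPolynomial.C (a * b) * LaurentPolynomial.T (n + m) by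
          rw [map_mul, LaurentPolynomial.T_add]; ring]
      rw [lpDelta_C_mul_T, lpDelta_C_mul_T, lpDelta_C_mul_T]
      simp only [LaurentPolynomial.T_add, map_mul, Int.cast_add, map_add]
      ring

/-- The coefficient of `z ^ m`. -/
def co (m : ℤ) : LP⟦X⟧ →+ ℂ⟦X⟧ where
  toFun F := mk fun n => (coeff n F).coeff m
  map_zero' := by ext n; simp
  map_add' F G := by ext n; simp

theorem coeff_co (m : ℤ) (n : ℕ) (F : LP⟦X⟧) : coeff n (co m F) = (coeff n F).coeff m := by
  simp [co]

theorem ext_co {F G : LP⟦X⟧} (h : ∀ m, co m F = co m G) : F = G := by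
  ext1 n
  refine LaurentPolynomial.ext fun m => ?_
  rw [← coeff_co, ← coeff_co, h]

/-- Power series in `q` as series with coefficients constant in `z`. -/
def emb : ℂ⟦X⟧ →+* LP⟦X⟧ := PowerSeries.map LaurentPolynomial.C

/-- The monomial `z ^ n`. -/
def zT (n : ℤ) : LP⟦X⟧ := C (LaurentPolynomial.T n)

theorem zT_zero : zT 0 = 1 := by simp [zT]

theorem zT_add (m n : ℤ) : zT (m + n) = zT m * zT n := by
  rw [zT, LaurentPolynomial.T_add, map_mul]; rfl

theorem zT_pow (m : ℤ) (n : ℕ) : zT m ^ n = zT (n * m) := by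
  rw [zT, ← map_pow, LaurentPolynomial.T_pow]; rfl

theorem emb_X : emb X = X := by simp [emb]

theorem co_emb_mul (m : ℤ) (a : ℂ⟦X⟧) (F : LP⟦X⟧) : co m (emb a * F) = a * co m F := by
  ext n
  rw [coeff_co, coeff_mul, coeff_mul, AddMonoidAlgebra.coeff_sum, Finsupp.finsetSum_apply]
  refine Finset.sum_congr rfl fun x _ => ?_
  rw [emb, coeff_map, LP.coeff_C_mul, coeff_co]

theorem co_X_pow_mul (m : ℤ) (k : ℕ) (F : LP⟦X⟧) : co m (X ^ k * F) = X ^ k * co m F := by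
  rw [← co_emb_mul, map_pow, emb_X]

theorem co_zT_mul (m j : ℤ) (F : LP⟦X⟧) : co m (zT j * F) = co (m - j) F := by
  ext n
  rw [coeff_co, zT, coeff_C_mul, LP.coeff_T_mul, coeff_co]

theorem co_emb (m : ℤ) (a : ℂ⟦X⟧) : co m (emb a) = if m = 0 then a else 0 := by
  ext n
  rw [coeff_co, emb, coeff_map, LaurentPolynomial.C_apply]
  split_ifs <;> simp

theorem co_one (m : ℤ) : co m 1 = if m = 0 then 1 else 0 := by
  rw [← map_one emb, co_emb]

theorem co_zT (m j : ℤ) : co m (zT j) = if m = j then 1 else 0 := by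
  rw [← mul_one (zT j), co_zT_mul, co_one]
  exact if_congr sub_eq_zero rfl rfl

theorem co_qsum (m : ℤ) (f : ℕ → LP⟦X⟧) : co m (qsum f) = qsum fun s => co m (f s) := by
  ext n
  simp [coeff_co, qsum, AddMonoidAlgebra.coeff_sum, Finsupp.finsetSum_apply]

theorem X_pow_dvd_co {F : LP⟦X⟧} {N : ℕ} (h : X ^ N ∣ F) (m : ℤ) : X ^ N ∣ co m F := by
  obtain ⟨G, rfl⟩ := h
  rw [co_X_pow_mul]; exact dvd_mul_right _ _

/-- Evaluation of `z` at a unit. -/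
def evz (u : ℂˣ) : LP⟦X⟧ →+* ℂ⟦X⟧ :=
  PowerSeries.map (LaurentPolynomial.eval₂ (RingHom.id ℂ) u)

/-- The specialization `z = 1`. -/
def ev1 : LP⟦X⟧ →+* ℂ⟦X⟧ := evz 1

theorem evz_emb (u : ℂˣ) (a : ℂ⟦X⟧) : evz u (emb a) = a := by
  ext n; simp [evz, emb]

theorem evz_zT (u : ℂˣ) (m : ℤ) : evz u (zT m) = C ((u ^ m : ℂˣ) : ℂ) := by
  simp [evz, zT]

theorem ev1_emb (a : ℂ⟦X⟧) : ev1 (emb a) = a := evz_emb 1 a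

theorem ev1_zT (m : ℤ) : ev1 (zT m) = 1 := by simp [ev1, evz_zT]

theorem eval_eq_sum (u : ℂˣ) (f : LP) : LaurentPolynomial.eval₂ (RingHom.id ℂ) u f =
    f.coeff.sum fun m a => a * ((u ^ m : ℂˣ) : ℂ) := by
  induction f using LaurentPolynomial.induction_on' with
  | add p q hp hq =>
    rw [map_add, hp, hq, AddMonoidAlgebra.coeff_add, Finsupp.sum_add_index'] <;> simp [add_mul]
  | C_mul_T n a =>
    rw [← LaurentPolynomial.single_eq_C_mul_T, AddMonoidAlgebra.coeff_single,
      Finsupp.sum_single_index (by simp), LaurentPolynomial.single_eq_C_mul_T,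
      LaurentPolynomial.eval₂_C_mul_T]
    rfl

/-- `δ_z = z d/dz`. -/
def deltaZ : LP⟦X⟧ →+ LP⟦X⟧ where
  toFun F := mk fun n => lpDelta (coeff n F)
  map_zero' := by ext1 n; simp
  map_add' F G := by ext1 n; simp

theorem coeff_deltaZ (n : ℕ) (F : LP⟦X⟧) : coeff n (deltaZ F) = lpDelta (coeff n F) := by
  simp [deltaZ]

theorem co_deltaZ (m : ℤ) (F : LP⟦X⟧) : co m (deltaZ F) = C (m : ℂ) * co m F := by
  ext n; rw [coeff_co, coeff_deltaZ, coeff_lpDelta, coeff_C_mul, coeff_co]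

theorem deltaZ_mul (F G : LP⟦X⟧) : deltaZ (F * G) = deltaZ F * G + F * deltaZ G := by
  ext1 n
  simp only [coeff_deltaZ, coeff_mul, map_add, map_sum, lpDelta_mul, Finset.sum_add_distrib]

theorem deltaZ_emb (a : ℂ⟦X⟧) : deltaZ (emb a) = 0 := by
  refine ext_co fun m => ?_
  rw [co_deltaZ, co_emb, map_zero]
  split_ifs with h
  · simp [h]
  · simp

theorem deltaZ_zT (m : ℤ) : deltaZ (zT m) = emb (C (m : ℂ)) * zT m := by
  refine ext_co fun j => ?_
  rw [co_deltaZ, co_emb_mul, co_zT]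
  split_ifs with h
  · simp [h]
  · simp

theorem deltaZ_emb_mul (a : ℂ⟦X⟧) (F : LP⟦X⟧) : deltaZ (emb a * F) = emb a * deltaZ F := by
  rw [deltaZ_mul, deltaZ_emb, zero_mul, zero_add]

theorem deltaZ_qsum (f : ℕ → LP⟦X⟧) : deltaZ (qsum f) = qsum fun s => deltaZ (f s) := by
  ext1 n
  simp [coeff_deltaZ, qsum]

/-- `δ_q` on series with Laurent polynomial coefficients. -/
def deltaQL : LP⟦X⟧ →+ LP⟦X⟧ where
  toFun F := X * derivative LP F
  map_zero' := by simp
  map_add' F G := by simp [mul_add]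

theorem deltaQL_mul (F G : LP⟦X⟧) : deltaQL (F * G) = deltaQL F * G + F * deltaQL G := by
  simp only [deltaQL, AddMonoidHom.coe_mk, ZeroHom.coe_mk, Derivation.leibniz, smul_eq_mul]
  ring

theorem coeff_deltaQ (n : ℕ) (F : ℂ⟦X⟧) : coeff n (deltaQ F) = n * coeff n F := by
  rw [deltaQ]
  cases n with
  | zero => simp
  | succ n => rw [coeff_succ_X_mul, coeff_derivative]; push_cast; ring

theorem coeff_deltaQL (n : ℕ) (F : LP⟦X⟧) : coeff n (deltaQL F) = n * coeff n F := by
  simp only [deltaQL, AddMonoidHom.coe_mk, ZeroHom.coe_mk]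
  cases n with
  | zero => simp
  | succ n => rw [coeff_succ_X_mul, coeff_derivative]; push_cast; ring

theorem LP.coeff_natCast_mul (n : ℕ) (f : LP) (m : ℤ) :
    ((n : LP) * f).coeff m = n * f.coeff m := by
  rw [← map_natCast LaurentPolynomial.C, LP.coeff_C_mul]

theorem co_deltaQL (m : ℤ) (F : LP⟦X⟧) : co m (deltaQL F) = deltaQ (co m F) := by
  ext n; rw [coeff_co, coeff_deltaQL, coeff_deltaQ, coeff_co, LP.coeff_natCast_mul]

theorem deltaQ_zero : deltaQ 0 = 0 := by simp [deltaQ]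

theorem deltaQ_add (F G : ℂ⟦X⟧) : deltaQ (F + G) = deltaQ F + deltaQ G := by simp [deltaQ, mul_add]

theorem deltaQ_mul (F G : ℂ⟦X⟧) : deltaQ (F * G) = deltaQ F * G + F * deltaQ G := by
  simp only [deltaQ, Derivation.leibniz, smul_eq_mul]
  ring

theorem deltaQL_emb (a : ℂ⟦X⟧) : deltaQL (emb a) = emb (deltaQ a) := by
  refine ext_co fun m => ?_
  rw [co_deltaQL, co_emb, co_emb]
  split_ifs <;> simp [deltaQ_zero]

theorem deltaQL_zT (m : ℤ) : deltaQL (zT m) = 0 := by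
  ext1 n
  rw [coeff_deltaQL, zT, coeff_C]
  split_ifs with h <;> simp [h]

theorem evz_deltaQL (u : ℂˣ) (F : LP⟦X⟧) : evz u (deltaQL F) = deltaQ (evz u F) := by
  ext n; simp [evz, coeff_deltaQ, coeff_deltaQL]

theorem ev1_deltaQL (F : LP⟦X⟧) : ev1 (deltaQL F) = deltaQ (ev1 F) := evz_deltaQL 1 F

theorem deltaZ_deltaQL (F : LP⟦X⟧) : deltaZ (deltaQL F) = deltaQL (deltaZ F) := by
  refine ext_co fun m => ?_
  rw [co_deltaZ, co_deltaQL, co_deltaQL, co_deltaZ, deltaQ_mul]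
  simp [deltaQ]

/-- The involution `z ↦ z⁻¹`. -/
def zInv : LP⟦X⟧ →+* LP⟦X⟧ :=
  PowerSeries.map (LaurentPolynomial.invert (R := ℂ) : LP ≃ₐ[ℂ] LP).toRingEquiv.toRingHom

theorem co_zInv (m : ℤ) (F : LP⟦X⟧) : co m (zInv F) = co (-m) F := by
  ext n
  rw [coeff_co, coeff_co, zInv, coeff_map]
  exact LaurentPolynomial.invert_apply _ _

end Laurent

end OverpartitionMoments

end

noncomputable section
namespace OverpartitionMoments
open PowerSeries

/-! ### Rank generating functions as q-hypergeometric series and their symmetry -/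

section Hypergeometric

variable {R : Type*} [CommRing R]

theorem isUnit_one_sub_of_X_dvd {a : R⟦X⟧} (h : X ∣ a) : IsUnit (1 - a) :=
  isUnit_of_X_dvd_sub_one (by simpa using h)

theorem isUnit_one_add_of_X_dvd {a : R⟦X⟧} (h : X ∣ a) : IsUnit (1 + a) :=
  isUnit_of_X_dvd_sub_one (by simpa using h)

theorem X_dvd_mul_X_pow_succ (a : R⟦X⟧) (k : ℕ) : X ∣ a * X ^ (k + 1) :=
  dvd_mul_of_dvd_right (dvd_pow_self _ k.succ_ne_zero) _

/-- The product of the first `s` quotients `n i / d i`. -/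
def hyp (n d : ℕ → R⟦X⟧) (s : ℕ) : R⟦X⟧ :=
  (∏ i ∈ Finset.range s, n i) * Ring.inverse (∏ i ∈ Finset.range s, d i)

/-- `(∏_{i < s} n i) / ∏_{i ≤ s} d i`. -/
def ratio (n d : ℕ → R⟦X⟧) (s : ℕ) : R⟦X⟧ := hyp n d s * Ring.inverse (d s)

theorem hyp_zero (n d : ℕ → R⟦X⟧) : hyp n d 0 = 1 := by simp [hyp]

theorem ratio_mul {n d : ℕ → R⟦X⟧} (hd : ∀ i, IsUnit (d i)) (s : ℕ) :
    ratio n d s * d s = hyp n d s := by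
  rw [ratio, mul_assoc, Ring.inverse_mul_cancel _ (hd s), mul_one]

theorem hyp_succ (n d : ℕ → R⟦X⟧) (s : ℕ) :
    hyp n d (s + 1) = ratio n d s * n s := by
  rw [ratio, hyp, hyp, Finset.prod_range_succ, Finset.prod_range_succ, Ring.mul_inverse_rev]
  ring

theorem hyp_mul_prod {n d : ℕ → R⟦X⟧} (hd : ∀ i, IsUnit (d i)) (s : ℕ) :
    hyp n d s * ∏ i ∈ Finset.range s, d i = ∏ i ∈ Finset.range s, n i := by
  rw [hyp, mul_assoc, Ring.inverse_mul_cancel, mul_one]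
  rw [IsUnit.prod_iff]; exact fun i _ => hd i

theorem eq_hyp {n d : ℕ → R⟦X⟧} (hd : ∀ i, IsUnit (d i)) {s : ℕ} {A : R⟦X⟧}
    (h : A * ∏ i ∈ Finset.range s, d i = ∏ i ∈ Finset.range s, n i) : A = hyp n d s := by
  rw [← hyp_mul_prod (n := n) hd s] at h
  exact (IsUnit.mul_left_inj (by rw [IsUnit.prod_iff]; exact fun i _ => hd i)).mp h

theorem X_pow_dvd_hyp {n : ℕ → R⟦X⟧} (hn : ∀ i, X ∣ n i) (d : ℕ → R⟦X⟧) : Adm (hyp n d) := by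
  intro s
  refine dvd_mul_of_dvd_left ?_ _
  simpa using Finset.prod_dvd_prod_of_dvd (s := Finset.range s) (fun _ => X) n fun i _ => hn i

/-- Iterating a first order linear recursion. -/
theorem eq_qsum_ratio {n d D : ℕ → R⟦X⟧} (hd : ∀ i, IsUnit (d i)) (hn : ∀ i, X ∣ n i)
    (h : ∀ j, d j * D j = 1 + n j * D (j + 1)) : D 0 = qsum (ratio n d) := by
  refine eq_qsum (f := ratio n d) ((X_pow_dvd_hyp hn d).mul_right _) fun N => ?_
  have key : D 0 - ∑ s ∈ Finset.range N, ratio n d s = hyp n d N * D N := by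
    induction N with
    | zero => simp [hyp_zero]
    | succ N ih =>
      rw [Finset.sum_range_succ, ← sub_sub, ih, hyp_succ, ← ratio_mul hd, mul_assoc, h]
      ring
  rw [key]
  exact dvd_mul_of_dvd_left (X_pow_dvd_hyp hn d N) _

theorem iprod_eq_prod {u : ℕ → R⟦X⟧} (hu : ∀ i, X ^ (i + 1) ∣ u i - 1) {N : ℕ}
    (h : ∀ i, N ≤ i → u i = 1) : iprod u = ∏ i ∈ Finset.range N, u i := by
  rw [iprod_eq_prod_mul hu N]
  have : iprod (fun i => u (i + N)) = 1 := by
    ext n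
    rw [iprod, coeff_mk, Finset.prod_eq_one]
    exact fun i _ => h _ (Nat.le_add_left _ _)
  rw [this, mul_one]

/-- Numerators of the rank series. -/
def rkN (w : R) (i : ℕ) : R⟦X⟧ := 1 + C w * X ^ (i + 1)

/-- Denominators of the rank series. -/
def rkD (w : R) (i : ℕ) : R⟦X⟧ := 1 - C w * X ^ (i + 1)

theorem isUnit_rkD (w : R) (i : ℕ) : IsUnit (rkD w i) :=
  isUnit_one_sub_of_X_dvd (X_dvd_mul_X_pow_succ _ _)

/-- The series `∑ₛ (z q)^s (-wq)_s / (wq)_{s+1}`. -/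
def rkSeries (z w : R) : R⟦X⟧ :=
  qsum fun s => (C z * X ^ 1) ^ s * ratio (rkN w) (rkD w) s

theorem adm_pow_mul (a : R⟦X⟧) (k : ℕ) (f : ℕ → R⟦X⟧) : Adm fun s => (a * X ^ (k + 1)) ^ s * f s :=
  fun s => dvd_mul_of_dvd_left (by
    rw [mul_pow, ← pow_mul]
    exact dvd_mul_of_dvd_right (pow_dvd_pow _ (Nat.le_mul_of_pos_left s k.succ_pos)) _) _

theorem ovGF_rank_cut (w : R) (s : ℕ) :
    ovGF (ovMulWeight (cutWeight id (fun _ => w) s) (cutWeight id (fun _ => w) s)) =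
      hyp (rkN w) (rkD w) s := by
  refine eq_hyp (isUnit_rkD w) ?_
  have h := ovGF_mulWeight (cutWeight id (fun _ => w) s) (cutWeight id (fun _ => w) s)
  rw [iprod_eq_prod (N := s) (fun i => X_pow_dvd_one_sub_C_mul_sub_one _ _),
    iprod_eq_prod (N := s) (fun i => X_pow_dvd_one_add_C_mul_sub_one _ _)] at h
  · convert! h using 1
    · congr 1
      refine Finset.prod_congr rfl fun i hi => ?_
      rw [cutWeight, if_pos (by simp at hi ⊢; omega), rkD]
    · refine Finset.prod_congr rfl fun i hi => ?_
      rw [cutWeight, if_pos (by simp at hi ⊢; omega), rkN]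
  · intro i hi; simp [cutWeight, show ¬ (i + 1 ≤ s) by omega]
  · intro i hi; simp [cutWeight, show ¬ (i + 1 ≤ s) by omega]

/-- Overpartitions with largest part `s + 1` are counted by a difference of two consecutive
products. It equals a common factor times `(1 + w q^(s+1)) - (1 - w q^(s+1))`, and `z w = 1`
simplifies the resulting `2 w q^(s+1)`. -/
theorem ovGF_rank {z w : R} (hzw : z * w = 1) :
    ovGF (fun n l => z ^ maxValue id id l * ovMulWeight (fun _ => w) (fun _ => w) n l) =
      1 + 2 * X * rkSeries z w := by
  have hZW : C z * C w = (1 : R⟦X⟧) := by rw [← map_mul, hzw, map_one]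
  rw [ovGF_maxValue (vo := id) (vn := id) (fun _ => le_rfl) (fun _ => le_rfl)]
  simp only [ovGF_rank_cut]
  rw [hyp_zero, rkSeries, qsum_mul_left (adm_pow_mul _ 0 _)]
  congr 1
  refine qsum_congr fun s => ?_
  rw [hyp_succ, ← ratio_mul (isUnit_rkD w), rkN, rkD, map_pow]
  linear_combination (2 * C z ^ s * X ^ (s + 1) * ratio (rkN w) (rkD w) s) * hZW

/-- Regard the series as a function of `z q^(j+1)` with `w` fixed. The first order recursion of the
summands in `s` becomes a recursion from `D j` to `D (j + 1)`, and iterating it produces the same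
series with `z` and `w` exchanged. -/
theorem rkSeries_symm {z w : R} (hzw : z * w = 1) : rkSeries z w = rkSeries w z := by
  have hZW : C z * C w = (1 : R⟦X⟧) := by rw [← map_mul, hzw, map_one]
  let h := ratio (rkN w) (rkD w)
  let D : ℕ → R⟦X⟧ := fun j => qsum fun s => (C z * X ^ (j + 1)) ^ s * h s
  have hadm : ∀ j, Adm fun s => (C z * X ^ (j + 1)) ^ s * h s := fun j => adm_pow_mul _ j _
  have hD : ∀ j, rkD z j * D j = 1 + (C w * X ^ 1 * rkN z j) * D (j + 1) := by
    intro j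
    set y := C z * X ^ (j + 1) with hy
    have e1 : qsum (fun s => y ^ s * h s * (rkD w s)) = 1 + y * qsum fun s => y ^ s * h s *
        rkN w s := by
      rw [qsum_succ ((hadm j).mul_right _), qsum_mul_left ((hadm j).mul_right _)]
      congr 1
      · rw [pow_zero, one_mul, ratio_mul (isUnit_rkD w), hyp_zero]
      · refine qsum_congr fun s => ?_
        rw [mul_assoc, ratio_mul (isUnit_rkD w), hyp_succ]
        ring
    have e2 : qsum (fun s => y ^ s * h s * rkD w s) = D j - C w * X ^ 1 * D (j + 1) := by
      rw [qsum_mul_left (hadm (j + 1)), ← qsum_sub]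
      refine qsum_congr fun s => ?_
      rw [rkD, hy]; ring
    have e3 : qsum (fun s => y ^ s * h s * rkN w s) = D j + C w * X ^ 1 * D (j + 1) := by
      rw [qsum_mul_left (hadm (j + 1)), ← qsum_add]
      refine qsum_congr fun s => ?_
      rw [rkN, hy]; ring
    rw [e2, e3] at e1
    rw [rkD, rkN]
    linear_combination e1
  have := eq_qsum_ratio (isUnit_rkD z) (fun i => by
    rw [pow_one]; exact dvd_mul_of_dvd_left (dvd_mul_left _ _) _) hD
  change D 0 = _
  rw [this, rkSeries]
  refine qsum_congr fun s => ?_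
  rw [ratio, ratio, hyp, hyp, Finset.prod_mul_distrib, Finset.prod_const, Finset.card_range]
  ring

/-- Numerators of the `M2`-rank series. -/
def m2N (w : R) (i : ℕ) : R⟦X⟧ := (1 + C w * X ^ (2 * i + 1)) * (1 + C w * X ^ (2 * i + 2))

/-- Denominators of the `M2`-rank series. -/
def m2D (w : R) (j i : ℕ) : R⟦X⟧ := (1 - C w * X ^ (2 * i + 2)) * (1 - X ^ (2 * i + 2 * j + 1))

theorem isUnit_one_sub_X_pow (k : ℕ) : IsUnit (1 - X ^ (k + 1) : R⟦X⟧) :=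
  isUnit_one_sub_of_X_dvd (dvd_pow_self _ k.succ_ne_zero)

theorem isUnit_one_add_X_pow (k : ℕ) : IsUnit (1 + X ^ (k + 1) : R⟦X⟧) :=
  isUnit_one_add_of_X_dvd (dvd_pow_self _ k.succ_ne_zero)

theorem isUnit_m2D (w : R) (j i : ℕ) : IsUnit (m2D w j i) :=
  (isUnit_one_sub_of_X_dvd (X_dvd_mul_X_pow_succ _ _)).mul (isUnit_one_sub_X_pow _)

/-- The series `∑ₛ (z q²)^s (-wq;q)_{2 s} / ((wq²;q²)_{s+1} (q;q²)_{s+1})`. -/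
def m2Series (z w : R) : R⟦X⟧ :=
  qsum fun s => (C z * X ^ 2) ^ s * ratio (m2N w) (m2D w 0) s

theorem prod_range_two_mul {M : Type*} [CommMonoid M] (f : ℕ → M) (s : ℕ) :
    ∏ i ∈ Finset.range (2 * s), f i = ∏ i ∈ Finset.range s, f (2 * i) * f (2 * i + 1) := by
  induction s with
  | zero => simp
  | succ s ih => rw [Nat.mul_succ, Finset.prod_range_succ, Finset.prod_range_succ, ih,
      Finset.prod_range_succ, mul_assoc]

/-- The weight of non-overlined parts for the `M2`-rank. -/
def m2W (w : R) (i : ℕ) : R := if Even i then w else 1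

/-- Overlined parts have value `⌈i/2⌉` and non-overlined ones `⌊i/2⌋`. Value at most `s` therefore
allows overlined parts up to `2s` and non-overlined parts up to `2s + 1`; the factor `1 - X ^ (2 * s
+ 1)` compensates for this last part. -/
theorem ovGF_m2_cut (w : R) (s : ℕ) :
    ovGF (ovMulWeight (cutWeight (fun i => (i + 1) / 2) (fun _ => w) s)
      (cutWeight (fun i => i / 2) (m2W w) s)) * (1 - X ^ (2 * s + 1)) =
      hyp (m2N w) (m2D w 0) s := by
  refine eq_hyp (isUnit_m2D w 0) ?_
  have h := ovGF_mulWeight (cutWeight (fun i => (i + 1) / 2) (fun _ => w) s)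
    (cutWeight (fun i => i / 2) (m2W w) s)
  rw [iprod_eq_prod (N := 2 * s + 1) (fun i => X_pow_dvd_one_sub_C_mul_sub_one _ _),
    iprod_eq_prod (N := 2 * s) (fun i => X_pow_dvd_one_add_C_mul_sub_one _ _),
    Finset.prod_range_succ, prod_range_two_mul, prod_range_two_mul] at h
  · rw [mul_right_comm, mul_assoc]
    refine Eq.trans ?_ (h.trans ?_)
    · congr 2
      · refine Finset.prod_congr rfl fun i hi => ?_
        have hi' := Finset.mem_range.mp hi
        have h1 : (2 * i + 1) / 2 ≤ s := by omega
        have h2 : (2 * i + 1 + 1) / 2 ≤ s := by omega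
        simp only [cutWeight, m2D, m2W, if_pos h1, if_pos h2,
          show ¬ Even (2 * i + 1) by simp, show Even (2 * i + 1 + 1) from ⟨i + 1, by ring⟩,
          if_true, if_false, map_one, one_mul, mul_zero, add_zero]
        ring
      · have h1 : (2 * s + 1) / 2 ≤ s := by omega
        simp [cutWeight, m2W, if_pos h1]
    · refine Finset.prod_congr rfl fun i hi => ?_
      have hi' := Finset.mem_range.mp hi
      have h1 : (2 * i + 1 + 1) / 2 ≤ s := by omega
      have h2 : (2 * i + 1 + 1 + 1) / 2 ≤ s := by omega
      simp only [cutWeight, m2N, if_pos h1, if_pos h2]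
  · intro i hi
    have h1 : ¬ (i + 1 + 1) / 2 ≤ s := by omega
    simp [cutWeight, if_neg h1]
  · intro i hi
    have h1 : ¬ (i + 1) / 2 ≤ s := by omega
    simp [cutWeight, if_neg h1]

set_option maxHeartbeats 1000000 in
theorem ovGF_m2 {z w : R} (hzw : z * w = 1) :
    ovGF (fun n l => z ^ maxValue (fun i => (i + 1) / 2) (fun i => i / 2) l *
      ovMulWeight (fun _ => w) (m2W w) n l) = 1 + 2 * (1 + X) * X * m2Series z w := by
  have hZW : C z * C w = (1 : R⟦X⟧) := by rw [← map_mul, hzw, map_one]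
  rw [ovGF_maxValue (fun i => by omega) (fun i => by omega)]
  set G : ℕ → R⟦X⟧ := fun s => ovGF (ovMulWeight (cutWeight (fun i => (i + 1) / 2) (fun _ => w) s)
      (cutWeight (fun i => i / 2) (m2W w) s)) with hG
  set u := ratio (m2N w) (m2D w 0) with hu
  have hG1 : ∀ s, G s = u s * (1 - C w * X ^ (2 * s + 2)) := by
    intro s
    refine (IsUnit.mul_left_inj (isUnit_one_sub_X_pow (2 * s))).mp ?_
    rw [hG, ovGF_m2_cut, ← ratio_mul (isUnit_m2D w 0), m2D, ← hu]
    ring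
  have hG2 : ∀ s, G (s + 1) * (1 - X ^ (2 * s + 3)) =
      u s * ((1 + C w * X ^ (2 * s + 1)) * (1 + C w * X ^ (2 * s + 2))) := by
    intro s
    have := ovGF_m2_cut w (s + 1)
    rw [hyp_succ] at this
    exact this
  change G 0 + qsum (fun s => C (z ^ (s + 1)) * (G (s + 1) - G s)) = _
  -- Adding the telescoping series of `Z`, whose sum is `Z 0 = G 0 - 1`, turns the summands into the
  -- hypergeometric term.
  set Z : ℕ → R⟦X⟧ := fun s => X ^ (2 * s + 1) * (C z ^ s * G s) with hZ
  have hZa : Adm Z := fun s => dvd_mul_of_dvd_left (pow_dvd_pow _ (by omega)) _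
  have h0 : G 0 = 1 + Z 0 := by
    have h1 := ovGF_m2_cut w 0
    rw [hyp_zero] at h1
    have h2 : G 0 * (1 - X) = 1 := by simpa using h1
    rw [hZ]
    simp only [mul_zero, zero_add, pow_one, pow_zero, one_mul]
    linear_combination h2
  rw [h0, ← qsum_telescope hZa, add_assoc, ← qsum_add, m2Series,
    qsum_mul_left (adm_pow_mul _ 1 _)]
  congr 1
  refine qsum_congr fun s => ?_
  rw [hZ]
  simp only [map_pow]
  have h2 := hG2 s
  have h1 := hG1 s
  linear_combination C z ^ (s + 1) * h2 + (X ^ (2 * s + 1) * C z ^ s - C z ^ (s + 1)) * h1 +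
    (u s * C z ^ s * (X ^ (2 * s + 1) + 2 * X ^ (2 * s + 2) + C w * X ^ (4 * s + 3))) * hZW

-- The argument is that of `rkSeries_symm`, except that the odd factors of the denominator must be
-- shifted together with `j`; the contiguous relation `hu` expresses the effect of this shift on the
-- summands.
set_option maxHeartbeats 1000000 in
theorem m2Series_symm {z w : R} (hzw : z * w = 1) : m2Series z w = m2Series w z := by
  have hZW : C z * C w = (1 : R⟦X⟧) := by rw [← map_mul, hzw, map_one]
  let u : ℕ → ℕ → R⟦X⟧ := fun j => ratio (m2N w) (m2D w j)
  let D : ℕ → R⟦X⟧ := fun j => qsum fun s => (C z * X ^ (2 * j + 2)) ^ s * u j s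
  have hadm : ∀ j, Adm fun s => (C z * X ^ (2 * j + 2)) ^ s * u j s :=
    fun j => adm_pow_mul _ (2 * j + 1) _
  have hu : ∀ j s, u (j + 1) s * (1 - X ^ (2 * s + 2 * j + 3)) = u j s * (1 - X ^ (2 * j + 1)) := by
    intro j s
    have h1 : ∀ j s, u j s * ∏ i ∈ Finset.range (s + 1), m2D w j i =
        ∏ i ∈ Finset.range s, m2N w i := by
      intro j s
      rw [Finset.prod_range_succ, mul_comm (Finset.prod _ _), ← mul_assoc, ratio_mul (isUnit_m2D w j),
        hyp_mul_prod (isUnit_m2D w j)]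
    have h2 := h1 j s
    rw [← h1 (j + 1) s] at h2
    have h3 : ∀ s, (∏ i ∈ Finset.range (s + 1), m2D w (j + 1) i) * (1 - X ^ (2 * j + 1)) =
        (∏ i ∈ Finset.range (s + 1), m2D w j i) * (1 - X ^ (2 * s + 2 * j + 3)) := by
      intro s
      induction s with
      | zero => simp [m2D]; ring
      | succ s ih =>
        rw [Finset.prod_range_succ, mul_right_comm, ih, Finset.prod_range_succ _ (s + 1)]
        simp only [m2D]
        ring
    have h4 : IsUnit (∏ i ∈ Finset.range (s + 1), m2D w j i) := by
      rw [IsUnit.prod_iff]; exact fun i _ => isUnit_m2D w j i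
    refine (IsUnit.mul_left_inj h4).mp ?_
    rw [mul_assoc, mul_comm (1 - X ^ (2 * s + 2 * j + 3)), ← h3, mul_right_comm (u j s), h2]
    ring
  have hD : ∀ j, ((1 - C z * X ^ (2 * j + 2)) * (1 - X ^ (2 * j + 1))) * D j =
      1 + (C w * X ^ 2 * m2N z j) * D (j + 1) := by
    intro j
    -- A telescoping certificate: the summand on the left minus the one on the right is `Z s - Z (s
    -- + 1)`, and `Z 0 = 1` is the inhomogeneous term.
    let Z : ℕ → R⟦X⟧ := fun s => (C z * X ^ (2 * j + 2)) ^ s * u j s *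
      ((1 - C w * X ^ (2 * s + 2)) * (1 - X ^ (2 * j + 1)))
    have hZ : Adm Z := (hadm j).mul_right _
    have hZ0 : Z 0 = 1 := by
      have := ratio_mul (n := m2N w) (isUnit_m2D w j) 0
      rw [hyp_zero] at this
      simpa [Z, m2D] using this
    refine Eq.trans ?_ (congrArg (· + C w * X ^ 2 * m2N z j * D (j + 1))
      ((qsum_telescope hZ).trans hZ0))
    rw [qsum_mul_left (hadm j), qsum_mul_left (hadm (j + 1)), ← qsum_add]
    refine qsum_congr fun s => ?_
    have h1 := hu j s
    have h2 : u j (s + 1) * m2D w j (s + 1) = u j s * m2N w s := by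
      rw [ratio_mul (isUnit_m2D w j), hyp_succ]
    simp only [m2D, m2N] at h2
    refine (IsUnit.mul_left_inj (isUnit_one_sub_X_pow (R := R) (2 * s + 2 * j + 2))).mp ?_
    simp only [Z, m2N]
    linear_combination (-(C w * X ^ 2 * ((1 + C z * X ^ (2 * j + 1)) * (1 + C z * X ^ (2 * j + 2))) *
        (C z * X ^ (2 * (j + 1) + 2)) ^ s)) * h1 +
      ((C z * X ^ (2 * j + 2)) ^ (s + 1) * (1 - X ^ (2 * j + 1))) * h2 -
      ((C z * X ^ (2 * j + 2)) ^ s * u j s * (1 - X ^ (2 * j + 1)) *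
        (C z * X ^ (4 * j + 2) * X ^ (2 * s + 3) - C w * X ^ (2 * j + 1) * X ^ (4 * s + 4))) * hZW
  have := eq_qsum_ratio (fun j => (isUnit_one_sub_of_X_dvd (X_dvd_mul_X_pow_succ _ _)).mul
      (isUnit_one_sub_X_pow _)) (fun i => by
    exact dvd_mul_of_dvd_left (dvd_mul_of_dvd_right (dvd_pow_self _ two_ne_zero) _) _) hD
  change D 0 = _
  rw [this, m2Series]
  refine qsum_congr fun s => ?_
  rw [ratio, ratio, hyp, hyp, Finset.prod_mul_distrib, Finset.prod_const, Finset.card_range]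
  simp only [m2D, mul_zero, add_zero]
  ring

end Hypergeometric

end OverpartitionMoments

end

noncomputable section
namespace OverpartitionMoments
open PowerSeries

/-! ### Partial fractions in the variable `w = z⁻¹` -/

section PartialFractions

theorem isUnit_one_sub_X_pow_mul {R : Type*} [CommRing R] {c : ℕ} (hc : 0 < c) (k : ℕ) :
    IsUnit (1 - X ^ (c * (k + 1)) : R⟦X⟧) :=
  isUnit_one_sub_of_X_dvd (dvd_pow_self _ (by positivity))

theorem isUnit_one_add_X_pow_mul {R : Type*} [CommRing R] {c : ℕ} (hc : 0 < c) (k : ℕ) :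
    IsUnit (1 + X ^ (c * (k + 1)) : R⟦X⟧) :=
  isUnit_one_add_of_X_dvd (dvd_pow_self _ (by positivity))

/-- `(-1)^k (-b;b)_k / (b;b)_k` for `b = q ^ c`. -/
def sg (c : ℕ) : ℕ → ℂ⟦X⟧ :=
  hyp (fun i => -(1 + X ^ (c * (i + 1)))) (fun i => 1 - X ^ (c * (i + 1)))

/-- `(-1;b)_i / (b;b)_i` for `b = q ^ c`. -/
def ta (c : ℕ) : ℕ → ℂ⟦X⟧ :=
  hyp (fun i => 1 + X ^ (c * i)) (fun i => 1 - X ^ (c * (i + 1)))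

theorem hyp_succ_mul {R : Type*} [CommRing R] {n d : ℕ → R⟦X⟧} (hd : ∀ i, IsUnit (d i)) (s : ℕ) :
    hyp n d (s + 1) * d s = hyp n d s * n s := by
  rw [hyp_succ, mul_right_comm, ratio_mul hd]

theorem sg_succ {c : ℕ} (hc : 0 < c) (k : ℕ) :
    sg c (k + 1) * (1 - X ^ (c * (k + 1))) = sg c k * -(1 + X ^ (c * (k + 1))) :=
  hyp_succ_mul (isUnit_one_sub_X_pow_mul hc) k

theorem ta_succ {c : ℕ} (hc : 0 < c) (k : ℕ) :
    ta c (k + 1) * (1 - X ^ (c * (k + 1))) = ta c k * (1 + X ^ (c * k)) :=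
  hyp_succ_mul (isUnit_one_sub_X_pow_mul hc) k

-- In an auxiliary variable `T`, the generating functions satisfy `(1 - T) F(T) = (1 + T) F(bT)` and
-- `(1 + T) S(T) = (1 - bT) S(bT)`. Thus `(1 - T) S F` is invariant under `T ↦ bT`, hence constant,
-- and `S F = 1/(1 - T)`.
open Finset.HasAntidiagonal in
theorem sum_sg_mul_ta {c : ℕ} (hc : 0 < c) (s : ℕ) :
    ∑ x ∈ antidiagonal s, sg c x.1 * ta c x.2 = 1 := by
  let b : ℂ⟦X⟧ := X ^ c
  let S : (ℂ⟦X⟧)⟦X⟧ := mk (sg c)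
  let F : (ℂ⟦X⟧)⟦X⟧ := mk (ta c)
  have hb : ∀ k, b ^ k = X ^ (c * k) := fun k => (pow_mul _ _ _).symm
  have hF : (1 - X) * F = (1 + X) * rescale b F := by
    ext1 n
    rw [sub_mul, add_mul, one_mul, one_mul, map_sub, map_add]
    cases n with
    | zero => simp [F]
    | succ n =>
      rw [coeff_succ_X_mul, coeff_succ_X_mul, coeff_rescale, coeff_rescale, coeff_mk, coeff_mk,
        hb, hb]
      linear_combination ta_succ hc n
  have hS : (1 + X) * S = (1 - C b * X) * rescale b S := by
    ext1 n
    rw [sub_mul, add_mul, one_mul, one_mul, map_sub, map_add]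
    cases n with
    | zero => simp [S]
    | succ n =>
      rw [mul_assoc, coeff_C_mul, coeff_succ_X_mul, coeff_succ_X_mul, coeff_rescale, coeff_rescale,
        coeff_mk, coeff_mk, ← mul_assoc b, ← pow_succ', hb]
      linear_combination sg_succ hc n
  have hW : (1 - X) * (S * F) = (1 - C b * X) * rescale b (S * F) := by
    have hu : IsUnit (1 + X : (ℂ⟦X⟧)⟦X⟧) := isUnit_one_add_of_X_dvd dvd_rfl
    refine (IsUnit.mul_right_inj hu).mp ?_
    rw [map_mul]
    linear_combination ((1 + X) * S) * hF + ((1 + X) * rescale b F) * hS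
  have hco : ∀ n, coeff (n + 1) (S * F) = coeff n (S * F) := by
    intro n
    have h := congrArg (coeff (n + 1)) hW
    rw [sub_mul, sub_mul, one_mul, one_mul, map_sub, map_sub, mul_assoc, coeff_C_mul,
      coeff_succ_X_mul, coeff_succ_X_mul, coeff_rescale, coeff_rescale, ← mul_assoc b,
      ← pow_succ', hb] at h
    refine (IsUnit.mul_left_inj (isUnit_one_sub_X_pow_mul hc n)).mp ?_
    linear_combination h
  have h0 : ∀ n, coeff n (S * F) = 1 := by
    intro n
    induction n with
    | zero => simp [S, F, sg, ta, hyp_zero]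
    | succ n ih => rw [hco, ih]
  have := h0 s
  rw [coeff_mul] at this
  simpa [S, F] using this

open Finset.HasAntidiagonal in
/-- The coefficients of the partial fraction decomposition of `(-wb;b)_s / (wb;b)_{s+1}`. -/
def pfC (c s N : ℕ) : ℂ⟦X⟧ :=
  ∑ x ∈ antidiagonal s, sg c x.1 * ta c x.2 * (X ^ (c * (x.1 + 1))) ^ N

theorem pfC_zero_right {c : ℕ} (hc : 0 < c) (s : ℕ) : pfC c s 0 = 1 := by
  simp [pfC, sum_sg_mul_ta hc]

theorem pfC_zero_left (c N : ℕ) : pfC c 0 N = X ^ (c * N) := by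
  simp [pfC, sg, ta, hyp_zero, pow_mul]

/-- The recursion for the coefficients of `w^N` in `(-wb;b)_s / (wb;b)_{s+1}` that results from
multiplication by `1 - w b^(s+2)`. Term by term it is the recursion of `ta`. -/
theorem pfC_succ {c : ℕ} (hc : 0 < c) (s N : ℕ) :
    pfC c (s + 1) (N + 1) = X ^ (c * (s + 2)) * pfC c (s + 1) N + pfC c s (N + 1) +
      X ^ (c * (s + 1)) * pfC c s N := by
  simp only [pfC, Finset.Nat.sum_antidiagonal_succ']
  rw [mul_add (X ^ (c * (s + 2))), Finset.mul_sum, Finset.mul_sum,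
    add_assoc (_ + _), ← Finset.sum_add_distrib, add_assoc (_ * (_ * _)), ← Finset.sum_add_distrib]
  congr 1
  · ring
  · refine Finset.sum_congr rfl fun x hx => ?_
    have hs := Finset.HasAntidiagonal.mem_antidiagonal.mp hx
    subst hs
    linear_combination (sg c x.1 * (X ^ (c * (x.1 + 1))) ^ (N + 1)) * ta_succ hc x.2

/-- Numerators `1 + w q ^ (c (i + 1))`. -/
def lN (c i : ℕ) : LP⟦X⟧ := 1 + zT (-1) * X ^ (c * (i + 1))

/-- Denominators `1 - w q ^ (c (i + 1))`. -/
def lD (c i : ℕ) : LP⟦X⟧ := 1 - zT (-1) * X ^ (c * (i + 1))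

theorem isUnit_lD {c : ℕ} (hc : 0 < c) (i : ℕ) : IsUnit (lD c i) :=
  isUnit_one_sub_of_X_dvd (dvd_mul_of_dvd_right (dvd_pow_self _ (by positivity)) _)

theorem co_wX_mul (m : ℤ) (k : ℕ) (F : LP⟦X⟧) :
    co m (zT (-1) * X ^ k * F) = X ^ k * co (m + 1) F := by
  rw [mul_assoc, co_zT_mul, co_X_pow_mul, sub_neg_eq_add]

/-- For `m > 0` the coefficient at `m` is `X ^ k` times the one at `m + 1`, hence divisible by every
power of `X`. So `F` contains no positive powers of `z`. -/
theorem co_eq_zero_of_recursion {k : ℕ} (hk : 0 < k) {F G : LP⟦X⟧}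
    (h : F * (1 - zT (-1) * X ^ k) = G) (hG : ∀ m : ℤ, 0 < m → co m G = 0) (m : ℤ) (hm : 0 < m) :
    co m F = 0 := by
  have h1 : ∀ m : ℤ, 0 < m → co m F = X ^ k * co (m + 1) F := by
    intro m hm
    have := hG m hm
    rw [← h, mul_sub, mul_one, mul_comm, map_sub, co_wX_mul, sub_eq_zero] at this
    exact this
  have h2 : ∀ N : ℕ, ∀ m : ℤ, 0 < m → X ^ N ∣ co m F := by
    intro N
    induction N with
    | zero => simp
    | succ N ih =>
      intro m hm
      rw [h1 m hm, pow_succ']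
      exact mul_dvd_mul (dvd_pow_self _ hk.ne') (ih _ (by omega))
  exact eq_of_forall_X_pow_dvd_sub fun N => by simpa using h2 N m hm

/-- Both sides satisfy the same recursion in `s` and `N`; the boundary value `1` at `N = 0` is
`sum_sg_mul_ta`. -/
theorem co_ratio {c : ℕ} (hc : 0 < c) (s : ℕ) :
    (∀ m : ℤ, 0 < m → co m (ratio (lN c) (lD c) s) = 0) ∧
    ∀ N : ℕ, co (-N) (ratio (lN c) (lD c) s) = pfC c s N := by
  induction s with
  | zero =>
    have h1 : ratio (lN c) (lD c) 0 * (1 - zT (-1) * X ^ (c * (0 + 1))) = 1 := by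
      have := ratio_mul (n := lN c) (isUnit_lD hc) 0
      rwa [hyp_zero] at this
    have h2 := co_eq_zero_of_recursion (by positivity) h1
      (fun m hm => by rw [co_one, if_neg hm.ne'])
    refine ⟨h2, fun N => ?_⟩
    have h3 : ∀ m : ℤ, co m (ratio (lN c) (lD c) 0) =
        X ^ (c * (0 + 1)) * co (m + 1) (ratio (lN c) (lD c) 0) + co m 1 := by
      intro m
      rw [← h1, mul_sub, mul_one, mul_comm _ (zT (-1) * _), map_sub, co_wX_mul]
      ring
    rw [pfC_zero_left]
    induction N with
    | zero => rw [h3, h2 _ (by simp), co_one]; simp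
    | succ N ih =>
      rw [h3, co_one, if_neg (by omega), show (-((N + 1 : ℕ) : ℤ) + 1) = -N by push_cast; ring, ih]
      ring
  | succ s ih =>
    obtain ⟨ih1, ih2⟩ := ih
    set F := ratio (lN c) (lD c) (s + 1)
    set G := ratio (lN c) (lD c) s
    have h1 : F * (1 - zT (-1) * X ^ (c * (s + 1 + 1))) = G * lN c s := by
      have := ratio_mul (n := lN c) (isUnit_lD hc) (s + 1)
      rwa [hyp_succ] at this
    have h4 : ∀ m : ℤ, co m (G * lN c s) = co m G + X ^ (c * (s + 1)) * co (m + 1) G := by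
      intro m
      rw [lN, mul_add, mul_one, mul_comm G (_ * _), map_add, co_wX_mul]
    have h2 := co_eq_zero_of_recursion (by positivity) h1
      (fun m hm => by rw [h4, ih1 m hm, ih1 _ (by omega)]; simp)
    refine ⟨h2, fun N => ?_⟩
    have h3 : ∀ m : ℤ, co m F = X ^ (c * (s + 1 + 1)) * co (m + 1) F + co m (G * lN c s) := by
      intro m
      rw [← h1, mul_sub, mul_one, mul_comm _ (zT (-1) * _), map_sub, co_wX_mul]
      ring
    induction N with
    | zero =>
      have h5 := ih2 0
      rw [pfC_zero_right hc] at h5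
      rw [h3, h4, pfC_zero_right hc, h2 _ (by simp), h5, ih1 _ (by simp)]
      simp
    | succ N ihN =>
      rw [h3, h4, ih2, pfC_succ hc, show (-((N + 1 : ℕ) : ℤ) + 1) = -N by push_cast; ring, ihN,
        ih2]
      ring

/-- On a geometric sequence `y^N`, multiplication by `1 + w q^e` acts as multiplication by `1 + q^e
/ y`. The offset `s` in the index keeps all exponents of `y` non-negative. -/
theorem co_prod_mul {ι : Type*} (I : Finset ι) (ρ y : ι → ℂ⟦X⟧) {h : LP⟦X⟧}
    (hh : ∀ N : ℕ, co (-N) h = ∑ x ∈ I, ρ x * y x ^ N) (e : ℕ → ℕ) (s N : ℕ) :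
    co (-(N + s : ℕ)) ((∏ j ∈ Finset.range s, (1 + zT (-1) * X ^ e j)) * h) =
      ∑ x ∈ I, ρ x * y x ^ N * ∏ j ∈ Finset.range s, (y x + X ^ e j) := by
  induction s generalizing N with
  | zero => simpa using hh N
  | succ s ih =>
    rw [Finset.prod_range_succ, mul_right_comm, mul_add, mul_one, mul_comm _ (_ * _), map_add,
      co_wX_mul, show N + (s + 1) = (N + 1) + s by ring, ih,
      show (-((N + 1 + s : ℕ) : ℤ) + 1) = -((N + s : ℕ) : ℤ) by push_cast; ring, ih,
      Finset.mul_sum, ← Finset.sum_add_distrib]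
    refine Finset.sum_congr rfl fun x _ => ?_
    rw [Finset.prod_range_succ]
    ring

end PartialFractions

/-! ### The product for overpartitions -/

section Pbar

theorem Pbar_eq_ovGF : Pbar = ovGF (ovMulWeight (fun _ => (1 : ℂ)) fun _ => 1) := by
  ext n; simp [Pbar, ovGF, ovMulWeight]

theorem Pbar_mul_iprod :
    Pbar * iprod (fun i => 1 - X ^ (i + 1)) = iprod fun i => (1 + X ^ (i + 1) : ℂ⟦X⟧) := by
  have := ovGF_mulWeight (fun _ => (1 : ℂ)) (fun _ => 1)
  simpa [← Pbar_eq_ovGF] using this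

/-- `(q;q)_k / (-q;q)_k`. -/
def pb : ℕ → ℂ⟦X⟧ := hyp (fun i => 1 - X ^ (i + 1)) (fun i => 1 + X ^ (i + 1))

theorem pb_succ (k : ℕ) : pb (k + 1) * (1 + X ^ (k + 1)) = pb k * (1 - X ^ (k + 1)) :=
  hyp_succ_mul isUnit_one_add_X_pow k

theorem X_pow_dvd_Pbar_mul_pb_sub_one (k : ℕ) : X ^ (k + 1) ∣ Pbar * pb k - 1 := by
  have hu : IsUnit (∏ i ∈ Finset.range k, (1 + X ^ (i + 1) : ℂ⟦X⟧)) := by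
    rw [IsUnit.prod_iff]; exact fun i _ => isUnit_one_add_X_pow i
  refine (IsUnit.dvd_mul_right hu).mp ?_
  rw [sub_mul, mul_assoc, pb, hyp_mul_prod isUnit_one_add_X_pow, one_mul]
  have h1 := X_pow_dvd_iprod_sub (u := fun i => (1 - X ^ (i + 1) : ℂ⟦X⟧)) (fun i => by simp) k
  have h2 := X_pow_dvd_iprod_sub (u := fun i => (1 + X ^ (i + 1) : ℂ⟦X⟧)) (fun i => by simp) k
  rw [← Pbar_mul_iprod] at h2
  have := dvd_sub h2 (dvd_mul_of_dvd_right h1 Pbar)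
  convert! this using 1
  ring

theorem isUnit_Pbar : IsUnit Pbar := by
  have := X_pow_dvd_Pbar_mul_pb_sub_one 0
  rw [pb, hyp_zero, mul_one, zero_add, pow_one] at this
  exact isUnit_of_X_dvd_sub_one this

end Pbar

/-! ### Coefficients of the rank generating functions in `z` -/

section Coefficients

/-- The coefficients of `R` in the rank variable have the shape shared by the rank (`c = 1`) and
the `M2`-rank (`c = 2`). -/
def RankForm (c : ℕ) (F : LP⟦X⟧) : Prop :=
  (∀ m, co m F = co (-m) F) ∧ ∀ M : ℕ, co (-M) F = (if M = 0 then 1 else 0) +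
    2 * Pbar * qsum fun k => (-1) ^ k * X ^ ((k + 1) ^ 2 + c * (k + 1) * M) *
      ((1 - X ^ (c * (k + 1))) * Ring.inverse (1 + X ^ (c * (k + 1))))

/-- A case of the q-binomial theorem: both sides equal `(-q^(k+2))_∞ / (q^(k+2))_∞`. They satisfy
the same recursion in `k` and tend to `1`. -/
theorem qsum_ta (k : ℕ) : qsum (fun i => ta 1 i * (X ^ (k + 2)) ^ i) = Pbar * pb (k + 1) := by
  have hadm : ∀ k, Adm fun i => ta 1 i * (X ^ (k + 2)) ^ i := fun k i =>
    dvd_mul_of_dvd_right (by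
      rw [← pow_mul]; exact pow_dvd_pow _ (Nat.le_mul_of_pos_left i (by omega))) _
  refine eq_of_recursion (d := fun k => 1 - X ^ (k + 2)) (n := fun k => 1 + X ^ (k + 2))
    (f := fun k => qsum fun i => ta 1 i * (X ^ (k + 2)) ^ i) (g := fun k => Pbar * pb (k + 1))
    (fun k => isUnit_one_sub_X_pow (k + 1)) (fun k => ?_) (fun k => ?_) (fun k => ?_) k
  · have e1 : qsum (fun i => ta 1 i * (X ^ (k + 2)) ^ i * (1 - X ^ i)) =
        X ^ (k + 2) * qsum fun i => ta 1 i * (X ^ (k + 2)) ^ i * (1 + X ^ i) := by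
      rw [qsum_succ ((hadm k).mul_right _), qsum_mul_left ((hadm k).mul_right _)]
      simp only [pow_zero, sub_self, mul_zero, zero_add]
      refine qsum_congr fun i => ?_
      have := ta_succ one_pos i
      simp only [one_mul] at this
      linear_combination (X ^ (k + 2)) ^ (i + 1) * this
    have e2 : qsum (fun i => ta 1 i * (X ^ (k + 2)) ^ i * (1 - X ^ i)) =
        qsum (fun i => ta 1 i * (X ^ (k + 2)) ^ i) -
          qsum fun i => ta 1 i * (X ^ (k + 1 + 2)) ^ i := by
      rw [← qsum_sub]
      exact qsum_congr fun i => by ring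
    have e3 : qsum (fun i => ta 1 i * (X ^ (k + 2)) ^ i * (1 + X ^ i)) =
        qsum (fun i => ta 1 i * (X ^ (k + 2)) ^ i) +
          qsum fun i => ta 1 i * (X ^ (k + 1 + 2)) ^ i := by
      rw [← qsum_add]
      exact qsum_congr fun i => by ring
    rw [e2, e3] at e1
    linear_combination e1
  · linear_combination -Pbar * pb_succ (k + 1)
  · have h1 : X ^ k ∣ qsum (fun i => ta 1 i * (X ^ (k + 2)) ^ i) - 1 := by
      rw [qsum_succ (hadm k)]
      simp only [ta, hyp_zero, pow_zero, mul_one, add_sub_cancel_left]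
      refine X_pow_dvd_qsum fun i => dvd_mul_of_dvd_right ?_ _
      rw [← pow_mul]
      exact pow_dvd_pow _ (by nlinarith)
    have h2 := (pow_dvd_pow X (by omega : k ≤ k + 1 + 1)).trans (X_pow_dvd_Pbar_mul_pb_sub_one (k + 1))
    simpa using dvd_sub h1 h2

theorem sg_mul_prod {c : ℕ} (hc : 0 < c) (k : ℕ) :
    sg c k * ∏ i ∈ Finset.range k, (1 - X ^ (c * (i + 1))) =
      (-1) ^ k * ∏ i ∈ Finset.range k, (1 + X ^ (c * (i + 1))) := by
  rw [sg, hyp_mul_prod (isUnit_one_sub_X_pow_mul hc), Finset.prod_neg, Finset.card_range]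

theorem sg_mul_pb (k : ℕ) :
    sg 1 k * pb (k + 1) = (-1) ^ k * ((1 - X ^ (1 * (k + 1))) *
      Ring.inverse (1 + X ^ (1 * (k + 1)))) := by
  have hu : ∀ k, IsUnit (∏ i ∈ Finset.range k, (1 - X ^ (i + 1) : ℂ⟦X⟧)) := fun k => by
    rw [IsUnit.prod_iff]; exact fun i _ => isUnit_one_sub_X_pow i
  have hv : ∀ k, IsUnit (∏ i ∈ Finset.range k, (1 + X ^ (i + 1) : ℂ⟦X⟧)) := fun k => by
    rw [IsUnit.prod_iff]; exact fun i _ => isUnit_one_add_X_pow i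
  have h1 := sg_mul_prod one_pos k
  have h2 : pb (k + 1) * _ = _ := hyp_mul_prod (isUnit_one_add_X_pow) (k + 1)
  simp only [one_mul, Finset.prod_range_succ] at *
  have h3 := Ring.inverse_mul_cancel _ (isUnit_one_add_X_pow (R := ℂ) k)
  refine (IsUnit.mul_left_inj ((hu k).mul ((hv k).mul (isUnit_one_add_X_pow k)))).mp ?_
  linear_combination (pb (k + 1) * ((∏ i ∈ Finset.range k, (1 + X ^ (i + 1))) * (1 + X ^ (k + 1)))) * h1
    + ((-1) ^ k * ∏ i ∈ Finset.range k, (1 + X ^ (i + 1))) * h2 -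
    ((-1) ^ k * (1 - X ^ (k + 1)) * (∏ i ∈ Finset.range k, (1 + X ^ (i + 1))) *
      (∏ i ∈ Finset.range k, (1 - X ^ (i + 1)))) * h3

theorem co_one_neg (M : ℕ) : co (-M) 1 = if M = 0 then 1 else 0 := by
  rw [co_one]; simp

theorem co_nat_mul (m : ℤ) (k : ℕ) (F : LP⟦X⟧) : co m ((k : LP⟦X⟧) * F) = k * co m F := by
  rw [← co_emb_mul, map_natCast]

theorem co_zX_pow_mul (M s e : ℕ) (F : LP⟦X⟧) :
    co (-M) ((zT 1 * X ^ e) ^ s * F) = (X ^ e) ^ s * co (-(M + s : ℕ)) F := by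
  rw [mul_pow, mul_assoc, zT_pow, co_zT_mul, ← pow_mul, co_X_pow_mul,
    show -(M : ℤ) - s * 1 = -((M + s : ℕ) : ℤ) by push_cast; ring, pow_mul]

-- After partial fractions the sum over `s` is a double sum over the index `k` of the pole and a
-- second index `i`. The inner sum is `qsum_ta`, and `sg_mul_pb` collapses the remaining products.
open Finset.HasAntidiagonal in
theorem co_rank (M : ℕ) :
    co (-M) (1 + 2 * X * rkSeries (LaurentPolynomial.T 1 : LP) (LaurentPolynomial.T (-1))) =
    (if M = 0 then 1 else 0) +
    2 * Pbar * qsum fun k => (-1) ^ k * X ^ ((k + 1) ^ 2 + 1 * (k + 1) * M) *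
      ((1 - X ^ (1 * (k + 1))) * Ring.inverse (1 + X ^ (1 * (k + 1)))) := by
  have hN : rkN (LaurentPolynomial.T (-1) : LP) = lN 1 := by
    ext1 i; rw [rkN, lN, one_mul]; rfl
  have hD : rkD (LaurentPolynomial.T (-1) : LP) = lD 1 := by
    ext1 i; rw [rkD, lD, one_mul]; rfl
  have h1 : co (-M) (rkSeries (LaurentPolynomial.T 1 : LP) (LaurentPolynomial.T (-1))) =
      qsum fun k => qsum fun i => X ^ (k + (k + 1) * (M + k)) * sg 1 k *
        (ta 1 i * (X ^ (k + 2)) ^ i) := by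
    rw [rkSeries, co_qsum, ← qsum_antidiagonal]
    · refine qsum_congr fun s => ?_
      have := co_zX_pow_mul M s 1 (ratio (lN 1) (lD 1) s)
      rw [zT] at this
      rw [hN, hD, this, (co_ratio one_pos s).2, pfC, Finset.mul_sum]
      refine Finset.sum_congr rfl fun x hx => ?_
      have hs := Finset.HasAntidiagonal.mem_antidiagonal.mp hx
      subst hs
      ring
    · intro k i
      refine (pow_dvd_pow X (?_ : k + i ≤ (k + (k + 1) * (M + k)) + (k + 2) * i)).trans ?_
      · nlinarith
      · rw [pow_add, pow_mul]
        exact mul_dvd_mul (dvd_mul_right _ _) (dvd_mul_left _ _)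
  have h2 : (2 * X : LP⟦X⟧) = ((2 : ℕ) : LP⟦X⟧) * X ^ 1 := by simp
  rw [map_add, co_one_neg, h2, mul_assoc, co_nat_mul, co_X_pow_mul, h1]
  congr 1
  rw [mul_assoc, Nat.cast_ofNat, pow_one]
  congr 1
  rw [qsum_mul_left, qsum_mul_left]
  · refine qsum_congr fun k => ?_
    rw [← qsum_mul_left, qsum_ta]
    · linear_combination (X ^ (k + (k + 1) * (M + k) + 1) * Pbar) * sg_mul_pb k
    · intro i
      refine dvd_mul_of_dvd_right ?_ _
      rw [← pow_mul]; exact pow_dvd_pow _ (Nat.le_mul_of_pos_left i (by omega))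
  · intro k
    refine dvd_mul_of_dvd_left (dvd_mul_of_dvd_right (pow_dvd_pow _ (by nlinarith)) _) _
  · intro k
    refine X_pow_dvd_qsum fun i => ?_
    rw [mul_assoc]
    exact dvd_mul_of_dvd_left (pow_dvd_pow _ (by nlinarith)) _

/-- The terms of the `q`-Gauss sum for the `M2`-rank. -/
def gaussTerm (k : ℕ) : ℕ → ℂ⟦X⟧ :=
  hyp (fun j => (1 + X ^ (2 * j)) * (X + X ^ (2 * j)) * X ^ (2 * k + 3))
    (fun j => (1 - X ^ (2 * (j + 1))) * (1 - X ^ (2 * k + 3 + 2 * j)))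

theorem isUnit_gaussTerm_den (k j : ℕ) :
    IsUnit ((1 - X ^ (2 * (j + 1))) * (1 - X ^ (2 * k + 3 + 2 * j)) : ℂ⟦X⟧) :=
  (isUnit_one_sub_X_pow_mul two_pos j).mul
    (isUnit_one_sub_of_X_dvd (dvd_pow_self _ (by omega)))

theorem X_pow_dvd_gaussTerm (k i : ℕ) : X ^ ((2 * k + 3) * i) ∣ gaussTerm k i := by
  refine dvd_mul_of_dvd_left ?_ _
  rw [Finset.prod_mul_distrib, Finset.prod_const, Finset.card_range, pow_mul]
  exact dvd_mul_left _ _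

theorem adm_gaussTerm (k : ℕ) : Adm (gaussTerm k) := fun i =>
  (pow_dvd_pow _ (Nat.le_mul_of_pos_left i (by omega))).trans (X_pow_dvd_gaussTerm k i)

/-- The contiguous relation in the parameter `k` that drives the evaluation of the q-Gauss sum. -/
theorem gaussTerm_succ_left (k i : ℕ) :
    gaussTerm (k + 1) i * (1 - X ^ (2 * k + 3 + 2 * i)) =
      gaussTerm k i * (X ^ (2 * i) * (1 - X ^ (2 * k + 3))) := by
  induction i with
  | zero => simp [gaussTerm, hyp_zero]
  | succ i ih =>
    have h1 : gaussTerm k (i + 1) * _ = gaussTerm k i * _ :=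
      hyp_succ_mul (isUnit_gaussTerm_den k) i
    have h2 : gaussTerm (k + 1) (i + 1) * _ = gaussTerm (k + 1) i * _ :=
      hyp_succ_mul (isUnit_gaussTerm_den (k + 1)) i
    refine (IsUnit.mul_left_inj (isUnit_gaussTerm_den k i)).mp ?_
    have e1 : (X : ℂ⟦X⟧) ^ (2 * (k + 1) + 3 + 2 * i) = X ^ (2 * k + 3 + 2 * (i + 1)) := by ring
    rw [e1] at h2
    linear_combination (1 - X ^ (2 * k + 3 + 2 * i)) * h2 -
      X ^ (2 * (i + 1)) * (1 - X ^ (2 * k + 3)) * h1 +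
      (1 + X ^ (2 * i)) * (X + X ^ (2 * i)) * X ^ (2 * (k + 1) + 3) * ih

/-- The q-Gauss sum, evaluated through a recursion in `k`: the difference of the two sides of the
recursion telescopes with certificate `Z`, and `Z 0 = 0`. Both series tend to `1` as `k` grows. -/
theorem qsum_gaussTerm (k : ℕ) : qsum (gaussTerm k) = Pbar * pb (2 * k + 2) := by
  refine eq_of_recursion (d := fun k => (1 - X ^ (2 * k + 3)) * (1 - X ^ (2 * k + 4)))
    (n := fun k => (1 + X ^ (2 * k + 3)) * (1 + X ^ (2 * k + 4)))
    (f := fun k => qsum (gaussTerm k)) (g := fun k => Pbar * pb (2 * k + 2))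
    (fun k => (isUnit_one_sub_X_pow (2 * k + 2)).mul (isUnit_one_sub_X_pow (2 * k + 3)))
    (fun k => ?_) (fun k => ?_) (fun k => ?_) k
  · let Z : ℕ → ℂ⟦X⟧ := fun i => gaussTerm k i * ((1 - X ^ (2 * i)) * (1 - X ^ (2 * k + 3)))
    have hZ : Adm Z := (adm_gaussTerm k).mul_right _
    have hZ0 : Z 0 = 0 := by simp [Z]
    have h0 := (qsum_telescope hZ).trans hZ0
    rw [← sub_eq_zero, qsum_mul_left (adm_gaussTerm k), qsum_mul_left (adm_gaussTerm (k + 1)),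
      ← qsum_sub, ← h0]
    refine qsum_congr fun i => ?_
    have h1 : gaussTerm k (i + 1) * _ = gaussTerm k i * _ :=
      hyp_succ_mul (isUnit_gaussTerm_den k) i
    have h2 := gaussTerm_succ_left k i
    refine (IsUnit.mul_left_inj (isUnit_one_sub_of_X_dvd
      (dvd_pow_self X (by omega : 2 * k + 3 + 2 * i ≠ 0)))).mp ?_
    simp only [Z]
    linear_combination (-((1 + X ^ (2 * k + 3)) * (1 + X ^ (2 * k + 4)))) * h2 +
      (1 - X ^ (2 * k + 3)) * h1
  · have h1 := pb_succ (2 * k + 2)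
    have h2 := pb_succ (2 * k + 3)
    rw [show 2 * (k + 1) + 2 = 2 * k + 3 + 1 by ring]
    linear_combination (-Pbar * (1 - X ^ (2 * k + 4))) * h1 -
      Pbar * (1 + X ^ (2 * k + 3)) * h2
  · have h1 : X ^ k ∣ qsum (gaussTerm k) - 1 := by
      rw [qsum_succ (adm_gaussTerm k)]
      simp only [gaussTerm, hyp_zero, add_sub_cancel_left]
      refine X_pow_dvd_qsum fun i => (pow_dvd_pow _ ?_).trans (X_pow_dvd_gaussTerm k (i + 1))
      nlinarith
    have h2 := (pow_dvd_pow X (by omega : k ≤ 2 * k + 2 + 1)).trans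
      (X_pow_dvd_Pbar_mul_pb_sub_one (2 * k + 2))
    simpa using dvd_sub h1 h2

/-- `1 / (q;q²)_{s+1}`. -/
def oddInv (s : ℕ) : ℂ⟦X⟧ := Ring.inverse (∏ j ∈ Finset.range (s + 1), (1 - X ^ (2 * j + 1)))

theorem isUnit_prod_odd {R : Type*} [CommRing R] (s : ℕ) :
    IsUnit (∏ j ∈ Finset.range s, (1 - X ^ (2 * j + 1)) : R⟦X⟧) := by
  rw [IsUnit.prod_iff]; exact fun i _ => isUnit_one_sub_X_pow (2 * i)

theorem oddInv_succ (s : ℕ) : oddInv (s + 1) * (1 - X ^ (2 * (s + 1) + 1)) = oddInv s := by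
  rw [oddInv, oddInv, Finset.prod_range_succ, Ring.mul_inverse_rev, mul_right_comm,
    Ring.inverse_mul_cancel _ (isUnit_one_sub_X_pow _), one_mul]

theorem prod_X_pow_odd (k : ℕ) : ∏ j ∈ Finset.range k, (X ^ (2 * j + 1) : ℂ⟦X⟧) = X ^ (k ^ 2) := by
  induction k with
  | zero => simp
  | succ k ih => rw [Finset.prod_range_succ, ih]; ring

theorem prod_add_odd (k : ℕ) :
    ∏ j ∈ Finset.range k, (X ^ (2 * k + 2) + X ^ (2 * j + 1) : ℂ⟦X⟧) =
      X ^ (k ^ 2) * ∏ j ∈ Finset.range k, (1 + X ^ (2 * j + 3)) := by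
  rw [← Finset.prod_range_reflect (fun j => (1 + X ^ (2 * j + 3) : ℂ⟦X⟧)), ← prod_X_pow_odd,
    ← Finset.prod_mul_distrib]
  refine Finset.prod_congr rfl fun j hj => ?_
  obtain ⟨d, rfl⟩ := Nat.exists_eq_add_of_lt (Finset.mem_range.mp hj)
  rw [show j + d + 1 - 1 - j = d by omega]
  ring

/-- At the `k`-th pole `q^(2(k+1))` the odd numerators `y + q^(2j+1)` combine with `ta` and `oddInv`
into a factor free of `i` times the summand of the q-Gauss sum. -/
theorem m2_term (k i : ℕ) :
    (X ^ 2) ^ (k + i) * oddInv (k + i) * (ta 2 i *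
      ∏ j ∈ Finset.range (k + i), (X ^ (2 * (k + 1)) + X ^ (2 * j + 1))) =
    X ^ (2 * k + k ^ 2) * oddInv k * (∏ j ∈ Finset.range k, (1 + X ^ (2 * j + 3))) *
      gaussTerm k i := by
  induction i with
  | zero =>
    rw [add_zero, show 2 * (k + 1) = 2 * k + 2 by ring, prod_add_odd]
    simp only [ta, gaussTerm, hyp_zero]
    ring
  | succ i ih =>
    have h1 : gaussTerm k (i + 1) * _ = gaussTerm k i * _ :=
      hyp_succ_mul (isUnit_gaussTerm_den k) i
    have h2 := ta_succ two_pos i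
    have h3 := oddInv_succ (k + i)
    refine (IsUnit.mul_left_inj (isUnit_gaussTerm_den k i)).mp ?_
    rw [mul_assoc _ (gaussTerm k (i + 1)), h1, ← add_assoc, Finset.prod_range_succ]
    have e1 : (X : ℂ⟦X⟧) ^ (2 * (k + i + 1) + 1) = X ^ (2 * k + 3 + 2 * i) := by ring
    rw [e1] at h3
    linear_combination ((X ^ 2) ^ (k + i + 1) * (∏ j ∈ Finset.range (k + i), (X ^ (2 * (k + 1)) +
        X ^ (2 * j + 1))) * (X ^ (2 * (k + 1)) + X ^ (2 * (k + i) + 1)) * ta 2 (i + 1) *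
        (1 - X ^ (2 * (i + 1)))) * h3 +
      ((X ^ 2) ^ (k + i + 1) * oddInv (k + i) * (∏ j ∈ Finset.range (k + i), (X ^ (2 * (k + 1)) +
        X ^ (2 * j + 1))) * (X ^ (2 * (k + 1)) + X ^ (2 * (k + i) + 1))) * h2 +
      (1 + X ^ (2 * i)) * (X + X ^ (2 * i)) * X ^ (2 * k + 3) * ih

theorem sg_mul_m2 (k : ℕ) :
    (1 + X) * sg 2 k * oddInv k * (∏ j ∈ Finset.range k, (1 + X ^ (2 * j + 3))) * pb (2 * k + 2) =
      (-1) ^ k * ((1 - X ^ (2 * (k + 1))) * Ring.inverse (1 + X ^ (2 * (k + 1)))) := by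
  have hu : IsUnit (∏ i ∈ Finset.range k, (1 - X ^ (2 * (i + 1)) : ℂ⟦X⟧)) := by
    rw [IsUnit.prod_iff]; exact fun i _ => isUnit_one_sub_X_pow_mul two_pos i
  have hv : IsUnit (∏ i ∈ Finset.range k, (1 + X ^ (2 * (i + 1)) : ℂ⟦X⟧)) := by
    rw [IsUnit.prod_iff]; exact fun i _ => isUnit_one_add_X_pow_mul two_pos i
  have hw : IsUnit (∏ i ∈ Finset.range (k + 1), (1 + X ^ (2 * i + 1) : ℂ⟦X⟧)) := by
    rw [IsUnit.prod_iff]; exact fun i _ => isUnit_one_add_X_pow (2 * i)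
  have h1 := sg_mul_prod two_pos k
  have h2 : pb (2 * (k + 1)) * _ = _ := hyp_mul_prod (isUnit_one_add_X_pow) (2 * (k + 1))
  rw [prod_range_two_mul, prod_range_two_mul, Finset.prod_mul_distrib,
    Finset.prod_mul_distrib, show 2 * (k + 1) = 2 * k + 2 by ring] at h2
  have h3 := Ring.inverse_mul_cancel _ (isUnit_one_add_X_pow_mul (R := ℂ) two_pos k)
  have h4 : oddInv k * _ = _ := Ring.inverse_mul_cancel _ (isUnit_prod_odd (R := ℂ) (k + 1))
  have h5 : (1 + X) * (∏ j ∈ Finset.range k, (1 + X ^ (2 * j + 3))) =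
      ∏ i ∈ Finset.range (k + 1), (1 + X ^ (2 * i + 1) : ℂ⟦X⟧) := by
    rw [Finset.prod_range_succ', mul_comm]; simp [mul_add, add_assoc]
  have e1 : ∏ i ∈ Finset.range (k + 1), (1 - X ^ (2 * i + 1 + 1) : ℂ⟦X⟧) =
      (∏ i ∈ Finset.range k, (1 - X ^ (2 * (i + 1)))) * (1 - X ^ (2 * (k + 1))) := by
    rw [Finset.prod_range_succ]; rfl
  have e2 : ∏ i ∈ Finset.range (k + 1), (1 + X ^ (2 * i + 1 + 1) : ℂ⟦X⟧) =
      (∏ i ∈ Finset.range k, (1 + X ^ (2 * (i + 1)))) * (1 + X ^ (2 * (k + 1))) := by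
    rw [Finset.prod_range_succ]; rfl
  rw [e1, e2] at h2
  set A := ∏ i ∈ Finset.range k, (1 - X ^ (2 * (i + 1)) : ℂ⟦X⟧)
  set B := ∏ i ∈ Finset.range k, (1 + X ^ (2 * (i + 1)) : ℂ⟦X⟧)
  set O := ∏ i ∈ Finset.range (k + 1), (1 + X ^ (2 * i + 1) : ℂ⟦X⟧)
  set O' := ∏ i ∈ Finset.range (k + 1), (1 - X ^ (2 * i + 1) : ℂ⟦X⟧)
  set V := ∏ j ∈ Finset.range k, (1 + X ^ (2 * j + 3) : ℂ⟦X⟧)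
  refine (IsUnit.mul_left_inj ((hu.mul hv).mul (isUnit_one_add_X_pow_mul two_pos k))).mp ?_
  linear_combination (sg 2 k * oddInv k * pb (2 * k + 2) * A * B * (1 + X ^ (2 * (k + 1)))) * h5 +
    (sg 2 k * oddInv k * A) * h2 + (sg 2 k * A * A * (1 - X ^ (2 * (k + 1)))) * h4 +
    (A * (1 - X ^ (2 * (k + 1)))) * h1 -
    ((-1) ^ k * (1 - X ^ (2 * (k + 1))) * A * B) * h3

/-- The even factors form the ratio already decomposed for base `q²`; the odd ones are a polynomial
in `w`, handled by `co_prod_mul`, and a denominator free of `w`. -/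
theorem prod_mul_ratio_eq (s : ℕ) :
    ratio (m2N (LaurentPolynomial.T (-1) : LP)) (m2D (LaurentPolynomial.T (-1)) 0) s =
      emb (oddInv s) * ((∏ j ∈ Finset.range s, (1 + zT (-1) * X ^ (2 * j + 1))) *
        ratio (lN 2) (lD 2) s) := by
  have hu : IsUnit (∏ i ∈ Finset.range (s + 1), m2D (LaurentPolynomial.T (-1) : LP) 0 i) := by
    rw [IsUnit.prod_iff]; exact fun i _ => isUnit_m2D _ 0 i
  refine (IsUnit.mul_left_inj hu).mp ?_
  have h1 : ∀ (n d : ℕ → LP⟦X⟧) (_ : ∀ i, IsUnit (d i)),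
      ratio n d s * ∏ i ∈ Finset.range (s + 1), d i = ∏ i ∈ Finset.range s, n i := by
    intro n d hd
    rw [Finset.prod_range_succ, mul_comm (Finset.prod _ _), ← mul_assoc, ratio_mul hd,
      hyp_mul_prod hd]
  rw [h1 _ _ (isUnit_m2D _ 0)]
  have h2 : ∏ i ∈ Finset.range (s + 1), m2D (LaurentPolynomial.T (-1) : LP) 0 i =
      (∏ i ∈ Finset.range (s + 1), lD 2 i) *
        emb (∏ j ∈ Finset.range (s + 1), (1 - X ^ (2 * j + 1))) := by
    rw [map_prod, ← Finset.prod_mul_distrib]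
    refine Finset.prod_congr rfl fun i _ => ?_
    rw [m2D, lD, map_sub, map_one, map_pow, emb_X]
    rfl
  have h3 : ∏ i ∈ Finset.range s, m2N (LaurentPolynomial.T (-1) : LP) i =
      (∏ j ∈ Finset.range s, (1 + zT (-1) * X ^ (2 * j + 1))) * ∏ j ∈ Finset.range s, lN 2 j := by
    rw [← Finset.prod_mul_distrib]
    exact Finset.prod_congr rfl fun i _ => rfl
  have h4 : emb (oddInv s) * emb (∏ j ∈ Finset.range (s + 1), (1 - X ^ (2 * j + 1))) = 1 := by
    rw [← map_mul, oddInv, Ring.inverse_mul_cancel _ (isUnit_prod_odd _), map_one]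
  have h5 := h1 (lN 2) (lD 2) (isUnit_lD two_pos)
  rw [h2, h3, ← h5]
  linear_combination (-((∏ j ∈ Finset.range s, (1 + zT (-1) * X ^ (2 * j + 1))) *
    (ratio (lN 2) (lD 2) s * ∏ i ∈ Finset.range (s + 1), lD 2 i))) * h4

-- The scheme of `co_rank` in base `q²`, with the q-Gauss sum replacing the q-binomial theorem. The
-- factor `(z q²)^s` shifts the index to `-(M + s)`, just what `co_prod_mul` requires.
open Finset.HasAntidiagonal in
theorem co_m2 (M : ℕ) :
    co (-M) (1 + 2 * (1 + X) * X *
      m2Series (LaurentPolynomial.T 1 : LP) (LaurentPolynomial.T (-1))) =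
    (if M = 0 then 1 else 0) +
    2 * Pbar * qsum fun k => (-1) ^ k * X ^ ((k + 1) ^ 2 + 2 * (k + 1) * M) *
      ((1 - X ^ (2 * (k + 1))) * Ring.inverse (1 + X ^ (2 * (k + 1)))) := by
  let A : ℕ → ℂ⟦X⟧ := fun k => sg 2 k * (X ^ (2 * (k + 1))) ^ M * (X ^ (2 * k + k ^ 2) * oddInv k *
    ∏ j ∈ Finset.range k, (1 + X ^ (2 * j + 3)))
  have hA : ∀ k, X ^ k ∣ A k := fun k => by
    refine dvd_mul_of_dvd_right ?_ _
    rw [mul_assoc]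
    exact dvd_mul_of_dvd_left (pow_dvd_pow _ (by nlinarith)) _
  have h1 : co (-M) (m2Series (LaurentPolynomial.T 1 : LP) (LaurentPolynomial.T (-1))) =
      qsum fun k => qsum fun i => A k * gaussTerm k i := by
    rw [m2Series, co_qsum, ← qsum_antidiagonal]
    · refine qsum_congr fun s => ?_
      have := co_zX_pow_mul M s 2 (ratio (m2N (LaurentPolynomial.T (-1) : LP))
        (m2D (LaurentPolynomial.T (-1)) 0) s)
      rw [zT] at this
      rw [this, prod_mul_ratio_eq, co_emb_mul, co_prod_mul (antidiagonal s)
        (fun x => sg 2 x.1 * ta 2 x.2) (fun x => X ^ (2 * (x.1 + 1))) (co_ratio two_pos s).2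
        (fun j => 2 * j + 1), Finset.mul_sum, Finset.mul_sum]
      refine Finset.sum_congr rfl fun x hx => ?_
      have hs := Finset.HasAntidiagonal.mem_antidiagonal.mp hx
      subst hs
      linear_combination sg 2 x.1 * (X ^ (2 * (x.1 + 1))) ^ M * m2_term x.1 x.2
    · intro k i
      rw [pow_add]
      exact mul_dvd_mul (hA k) (adm_gaussTerm k i)
  have h2 : (2 * (1 + X) * X : LP⟦X⟧) = emb (2 * (1 + X) * X) := by
    simp only [map_mul, map_add, map_one, emb_X, map_ofNat]
  rw [map_add, co_one_neg, h2, co_emb_mul, h1]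
  congr 1
  rw [mul_assoc (2 : ℂ⟦X⟧), mul_assoc (2 : ℂ⟦X⟧), mul_assoc (2 : ℂ⟦X⟧)]
  congr 1
  rw [qsum_mul_left, qsum_mul_left]
  · refine qsum_congr fun k => ?_
    rw [← qsum_mul_left (adm_gaussTerm k), qsum_gaussTerm]
    simp only [A]
    linear_combination ((X ^ (2 * (k + 1))) ^ M * X ^ (2 * k + k ^ 2 + 1) * Pbar) * sg_mul_m2 k
  · intro k
    refine dvd_mul_of_dvd_left (dvd_mul_of_dvd_right (pow_dvd_pow _ (by nlinarith)) _) _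
  · intro k
    exact X_pow_dvd_qsum fun i => dvd_mul_of_dvd_left (hA k) _

end Coefficients

end OverpartitionMoments

end

noncomputable section
namespace OverpartitionMoments
open PowerSeries

/-! ### Combinatorial statistics and their generating functions -/

section Moments

theorem momentSeries_eq {A : ℤ → ℕ → ℤ} {F : LP⟦X⟧}
    (h : ∀ m n, (coeff n F).coeff m = (A m n : ℂ)) (k : ℕ) :
    momentSeries A k = ev1 (deltaZ^[k] F) := by
  have h1 : ∀ k n m, (coeff n (deltaZ^[k] F)).coeff m = (m : ℂ) ^ k * A m n := by
    intro k n m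
    induction k with
    | zero => simpa using h m n
    | succ k ih => rw [Function.iterate_succ_apply', coeff_deltaZ, coeff_lpDelta, ih]; ring
  ext n
  rw [momentSeries, coeff_mk, ev1, evz, coeff_map, eval_eq_sum, Finsupp.sum,
    finsum_eq_sum_of_support_subset (s := (coeff n F).coeff.support)]
  · push_cast
    symm
    refine Finset.sum_subset_zero_on_sdiff (fun m hm => ?_) (fun m hm => ?_) fun m _ => ?_
    · rw [Finsupp.mem_support_iff, h1] at hm
      rw [Finsupp.mem_support_iff, h]
      exact fun h0 => hm (by rw [h0, mul_zero])
    · rw [Finset.mem_sdiff, Finsupp.mem_support_iff, Finsupp.mem_support_iff, not_not, h1] at hm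
      exact hm.2
    · rw [h1]; simp
  · intro m hm
    rw [Function.mem_support] at hm
    rw [Finset.mem_coe, Finsupp.mem_support_iff, h]
    intro h0
    rw [Int.cast_eq_zero] at h0
    exact hm (by rw [h0, mul_zero])

theorem map_ovGF {R S : Type*} [CommRing R] [CommRing S] (φ : R →+* S)
    (W : ∀ n, Overpartition n → R) :
    PowerSeries.map φ (ovGF W) = ovGF fun n l => φ (W n l) := by
  ext n; simp [ovGF]

/-- The generating function of an integer-valued statistic on overpartitions. -/
def statGF (r : ∀ n, Overpartition n → ℤ) : LP⟦X⟧ :=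
  ovGF fun n l => LaurentPolynomial.T (r n l)

theorem statGF_coeff (r : ∀ n, Overpartition n → ℤ) (m : ℤ) (n : ℕ) :
    (coeff n (statGF r)).coeff m =
      (((Finset.univ.filter (fun l : Overpartition n => r n l = m)).card : ℤ) : ℂ) := by
  rw [statGF, ovGF, coeff_mk, AddMonoidAlgebra.coeff_sum, Finsupp.finsetSum_apply]
  simp

theorem ev1_statGF (r : ∀ n, Overpartition n → ℤ) : ev1 (statGF r) = Pbar := by
  ext n
  simp [ev1, evz, statGF, ovGF, Pbar]

/-- The generating function of the rank. -/
def rankGF : LP⟦X⟧ := statGF fun _ l => l.rank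

/-- The generating function of the `M2`-rank. -/
def m2GF : LP⟦X⟧ := statGF fun _ l => l.m2Rank

theorem Rbar_eq (k : ℕ) : Rbar k = ev1 (deltaZ^[k] rankGF) :=
  momentSeries_eq (fun m n => statGF_coeff _ m n) k

theorem R2bar_eq (k : ℕ) : R2bar k = ev1 (deltaZ^[k] m2GF) :=
  momentSeries_eq (fun m n => statGF_coeff _ m n) k

theorem overlined_add_nonOverlined {n : ℕ} (l : Overpartition n) :
    l.overlined.val + l.nonOverlined = l.parts := by
  refine add_tsub_cancel_of_le ?_
  exact (Multiset.le_iff_subset l.overlined.nodup).mpr fun i hi =>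
    mem_parts_of_mem_overlined l hi

theorem mem_parts_iff {n : ℕ} (l : Overpartition n) (i : ℕ) :
    i ∈ l.parts ↔ i ∈ l.overlined ∨ i ∈ l.nonOverlined := by
  rw [← overlined_add_nonOverlined, Multiset.mem_add]; rfl

theorem card_parts {n : ℕ} (l : Overpartition n) :
    l.parts.card = l.overlined.card + l.nonOverlined.card := by
  rw [← overlined_add_nonOverlined, Multiset.card_add]; rfl

theorem maxValue_id {n : ℕ} (l : Overpartition n) : maxValue id id l = l.largestPart := by
  refine eq_of_forall_ge_iff fun s => ?_
  rw [maxValue_le_iff, Overpartition.largestPart, Multiset.sup_le]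
  simp only [mem_parts_iff, id]
  exact ⟨fun h i hi => hi.elim (h.1 i) (h.2 i), fun h => ⟨fun i hi => h i (.inl hi),
    fun i hi => h i (.inr hi)⟩⟩

theorem largestPart_mem {n : ℕ} (l : Overpartition n) (h : l.parts ≠ 0) :
    l.largestPart ∈ l.parts := by
  have : ∀ s : Multiset ℕ, s ≠ 0 → s.sup ∈ s := by
    intro s
    induction s using Multiset.induction_on with
    | empty => simp
    | cons a s ih =>
      intro _
      rw [Multiset.sup_cons]
      by_cases hs : s = 0
      · simp [hs]
      · rcases le_total a s.sup with h | h
        · rw [sup_eq_right.mpr h]; exact Multiset.mem_cons_of_mem (ih hs)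
        · rw [sup_eq_left.mpr h]; exact Multiset.mem_cons_self _ _
  exact this _ h

theorem le_largestPart {n : ℕ} (l : Overpartition n) {i : ℕ} (h : i ∈ l.parts) :
    i ≤ l.largestPart := Multiset.le_sup h

/-- This absorbs the correction `χ` into a maximum of values attached to single parts. If the
largest part `L` is not overlined, then all overlined parts are smaller, so their values `⌈i/2⌉` do
not exceed `⌊L/2⌋`. -/
theorem maxValue_m2 {n : ℕ} (l : Overpartition n) :
    (maxValue (fun i => (i + 1) / 2) (fun i => i / 2) l : ℤ) =
      ⌈(l.largestPart : ℚ) / 2⌉ - l.chi := by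
  have hceil : ∀ L : ℕ, ⌈(L : ℚ) / 2⌉ = (((L + 1) / 2 : ℕ) : ℤ) := by
    intro L
    rw [Int.ceil_eq_iff]
    rcases Nat.even_or_odd' L with ⟨r, rfl | rfl⟩
    · rw [show (2 * r + 1) / 2 = r by omega]; push_cast; constructor <;> linarith
    · rw [show (2 * r + 1 + 1) / 2 = r + 1 by omega]; push_cast; constructor <;> linarith
  rw [hceil]
  have key : maxValue (fun i => (i + 1) / 2) (fun i => i / 2) l =
      (l.largestPart + 1) / 2 - if Odd l.largestPart ∧ l.largestPart ∉ l.overlined then 1 else 0 := by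
    by_cases h0 : l.parts = 0
    · have hL : l.largestPart = 0 := by simp [Overpartition.largestPart, h0]
      rw [hL]
      simp only [Nat.odd_iff]
      rw [if_neg (by omega)]
      refine Nat.le_zero.mp ((maxValue_le_iff l 0).mpr ⟨fun i hi => ?_, fun i hi => ?_⟩)
      · have := (mem_parts_iff l i).mpr (.inl hi); simp [h0] at this
      · have := (mem_parts_iff l i).mpr (.inr hi); simp [h0] at this
    have hmem := largestPart_mem l h0
    set L := l.largestPart with hL
    by_cases hLo : L ∈ l.overlined
    · rw [if_neg (fun h => h.2 hLo), Nat.sub_zero]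
      refine eq_of_forall_ge_iff fun s => ?_
      rw [maxValue_le_iff]
      refine ⟨fun h => h.1 L hLo, fun h => ⟨fun i hi => ?_, fun i hi => ?_⟩⟩
      · have := le_largestPart l ((mem_parts_iff l i).mpr (.inl hi)); omega
      · have := le_largestPart l ((mem_parts_iff l i).mpr (.inr hi)); omega
    · have hLn : L ∈ l.nonOverlined := ((mem_parts_iff l L).mp hmem).resolve_left hLo
      have hval : (L + 1) / 2 - (if Odd L ∧ L ∉ l.overlined then 1 else 0) = L / 2 := by
        by_cases hodd : Odd L
        · rw [if_pos ⟨hodd, hLo⟩]; obtain ⟨r, hr⟩ := hodd; omega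
        · rw [if_neg (fun h => hodd h.1)]
          obtain ⟨r, hr⟩ := Nat.not_odd_iff_even.mp hodd; omega
      rw [hval]
      refine eq_of_forall_ge_iff fun s => ?_
      rw [maxValue_le_iff]
      refine ⟨fun h => h.2 L hLn, fun h => ⟨fun i hi => ?_, fun i hi => ?_⟩⟩
      · have h1 := le_largestPart l ((mem_parts_iff l i).mpr (.inl hi))
        have h2 : i ≠ L := fun h => hLo (h ▸ hi)
        omega
      · have := le_largestPart l ((mem_parts_iff l i).mpr (.inr hi)); omega
  rw [key, Overpartition.chi]
  split_ifs with h
  · have : 1 ≤ (l.largestPart + 1) / 2 := by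
      obtain ⟨r, hr⟩ := h.1; omega
    push_cast [this]; ring
  · simp

theorem T_one_pow_mul (a b : ℕ) :
    (LaurentPolynomial.T 1 : LP) ^ a * LaurentPolynomial.T (-1) ^ b =
      LaurentPolynomial.T ((a : ℤ) - b) := by
  rw [LaurentPolynomial.T_pow, LaurentPolynomial.T_pow, ← LaurentPolynomial.T_add]
  congr 1; ring

theorem ovMulWeight_const (w : LP) (n : ℕ) (l : Overpartition n) :
    ovMulWeight (fun _ => w) (fun _ => w) n l = w ^ l.parts.card := by
  rw [ovMulWeight, card_parts, pow_add, Finset.prod_const, Multiset.map_const', Multiset.prod_replicate]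

theorem ovMulWeight_m2 {R : Type*} [CommRing R] (w : R) (n : ℕ) (l : Overpartition n) :
    ovMulWeight (fun _ => w) (m2W w) n l *
      w ^ (l.nonOverlined.filter (fun x => Odd x)).card = w ^ l.parts.card := by
  have h : ∀ s : Multiset ℕ, (s.map (m2W w)).prod * w ^ (s.filter (fun x => Odd x)).card =
      w ^ s.card := by
    intro s
    induction s using Multiset.induction_on with
    | empty => simp
    | cons a s ih =>
      rw [Multiset.map_cons, Multiset.prod_cons, Multiset.card_cons, pow_succ', ← ih]
      by_cases ha : Even a
      · rw [m2W, if_pos ha, Multiset.filter_cons_of_neg _ (Nat.not_odd_iff_even.mpr ha)]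
        ring
      · rw [m2W, if_neg ha, Multiset.filter_cons_of_pos _ (Nat.not_even_iff_odd.mp ha),
          Multiset.card_cons]
        ring
  rw [ovMulWeight, mul_assoc, h, card_parts, pow_add, Finset.prod_const]

theorem rankGF_eq : rankGF =
    1 + 2 * X * rkSeries (LaurentPolynomial.T 1 : LP) (LaurentPolynomial.T (-1)) := by
  rw [← ovGF_rank (by rw [← LaurentPolynomial.T_add]; simp)]
  rw [rankGF, statGF]
  congr 1
  ext1 n; ext1 l
  rw [ovMulWeight_const, T_one_pow_mul, maxValue_id, Overpartition.rank]

theorem T_mul_T_neg (m : ℤ) :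
    (LaurentPolynomial.T m : LP) * LaurentPolynomial.T (-m) = 1 := by
  rw [← LaurentPolynomial.T_add, add_neg_cancel, LaurentPolynomial.T_zero]

theorem m2GF_eq : m2GF =
    1 + 2 * (1 + X) * X * m2Series (LaurentPolynomial.T 1 : LP) (LaurentPolynomial.T (-1)) := by
  rw [← ovGF_m2 (T_mul_T_neg 1)]
  rw [m2GF, statGF]
  congr 1
  ext1 n; ext1 l
  have h1 := ovMulWeight_m2 (LaurentPolynomial.T (-1) : LP) n l
  have h2 := T_mul_T_neg (l.nonOverlined.filter (fun x => Odd x)).card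
  rw [LaurentPolynomial.T_pow, LaurentPolynomial.T_pow, mul_neg_one, mul_neg_one] at h1
  have h3 : ovMulWeight (fun _ => (LaurentPolynomial.T (-1) : LP)) (m2W (LaurentPolynomial.T (-1))) n l
      = LaurentPolynomial.T ((l.nonOverlined.filter (fun x => Odd x)).card - l.parts.card : ℤ) := by
    rw [sub_eq_add_neg, LaurentPolynomial.T_add, ← h1, mul_left_comm, h2, mul_one]
  rw [h3, LaurentPolynomial.T_pow, ← LaurentPolynomial.T_add, mul_one, maxValue_m2,
    Overpartition.m2Rank]
  congr 1
  ring

/-- Inverting `z` exchanges `T 1` and `T (-1)` in the weight, so that the hypergeometric symmetry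
becomes a symmetry of coefficients. -/
theorem statGF_symm_of {W : LP → LP → ∀ n, Overpartition n → LP} {F : LP⟦X⟧}
    (hF : F = ovGF (W (LaurentPolynomial.T 1) (LaurentPolynomial.T (-1))))
    (hW : ∀ (φ : LP →+* LP) z w n l, φ (W z w n l) = W (φ z) (φ w) n l)
    (hs : ovGF (W (LaurentPolynomial.T 1) (LaurentPolynomial.T (-1))) =
      ovGF (W (LaurentPolynomial.T (-1)) (LaurentPolynomial.T 1))) (m : ℤ) :
    co m F = co (-m) F := by
  rw [← co_zInv, hF, zInv, map_ovGF]
  simp only [hW]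
  have h1 : ∀ n, (LaurentPolynomial.invert (R := ℂ) : LP ≃ₐ[ℂ] LP).toRingEquiv.toRingHom
    (LaurentPolynomial.T n) = LaurentPolynomial.T (-n) := fun n => LaurentPolynomial.invert_T n
  rw [h1, h1, neg_neg]
  change _ = co m (ovGF (W _ _))
  rw [← hs]

theorem map_ovMulWeight {R S : Type*} [CommRing R] [CommRing S] (φ : R →+* S) (a b : ℕ → R) (n : ℕ)
    (l : Overpartition n) :
    φ (ovMulWeight a b n l) = ovMulWeight (fun i => φ (a i)) (fun i => φ (b i)) n l := by
  rw [ovMulWeight, ovMulWeight, map_mul, map_prod, map_multiset_prod, Multiset.map_map]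
  rfl

theorem rankForm_rankGF : RankForm 1 rankGF := by
  refine ⟨fun m => statGF_symm_of (W := fun z w n l => z ^ maxValue id id l *
    ovMulWeight (fun _ => w) (fun _ => w) n l) ?_ ?_ ?_ m, fun M => ?_⟩
  · rw [ovGF_rank (T_mul_T_neg 1), rankGF_eq]
  · intro φ z w n l
    rw [map_mul, map_pow, map_ovMulWeight]
  · have h := T_mul_T_neg (-1)
    rw [neg_neg] at h
    rw [ovGF_rank (T_mul_T_neg 1), ovGF_rank h, rkSeries_symm (T_mul_T_neg 1)]
  · rw [rankGF_eq, co_rank]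

theorem rankForm_m2GF : RankForm 2 m2GF := by
  refine ⟨fun m => statGF_symm_of (W := fun z w n l =>
    z ^ maxValue (fun i => (i + 1) / 2) (fun i => i / 2) l *
      ovMulWeight (fun _ => w) (m2W w) n l) ?_ ?_ ?_ m, fun M => ?_⟩
  · rw [ovGF_m2 (T_mul_T_neg 1), m2GF_eq]
  · intro φ z w n l
    rw [map_mul, map_pow, map_ovMulWeight]
    congr 2
    ext1 i
    rw [m2W, m2W]; split_ifs <;> simp
  · have h := T_mul_T_neg (-1)
    rw [neg_neg] at h
    rw [ovGF_m2 (T_mul_T_neg 1), ovGF_m2 h, m2Series_symm (T_mul_T_neg 1)]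
  · rw [m2GF_eq, co_m2]

end Moments

/-! ### Gauss's identity and the Appell-type form of the rank functions -/

section Gauss

/-- `∑_{k ≥ 0} (-1)^k q^{(k+1)² + c (k+1) M}`. -/
def vser (c M : ℕ) : ℂ⟦X⟧ := qsum fun k => (-1) ^ k * X ^ ((k + 1) ^ 2 + c * (k + 1) * M)

theorem adm_vser (c M : ℕ) :
    Adm fun k => (-1) ^ k * (X : ℂ⟦X⟧) ^ ((k + 1) ^ 2 + c * (k + 1) * M) := fun k =>
  dvd_mul_of_dvd_right (pow_dvd_pow _ (by nlinarith [Nat.zero_le (c * (k + 1) * M)])) _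

theorem X_pow_dvd_vser {c : ℕ} (hc : 0 < c) (M : ℕ) : X ^ M ∣ vser c M :=
  X_pow_dvd_qsum fun k => dvd_mul_of_dvd_right (pow_dvd_pow _ (by
    have : M ≤ c * (k + 1) * M := Nat.le_mul_of_pos_left M (by positivity)
    omega)) _

/-- Adding the coefficients for `M` and `M + 1` produces the factor `1 + q^(c(k+1))`, which cancels
the denominator. -/
theorem RankForm.co_one_add_mul {c : ℕ} (hc : 0 < c) {F : LP⟦X⟧} (h : RankForm c F) (M : ℕ) :
    co (-M) ((1 + zT 1) * F) =
      (if M = 0 then 1 else 0) + 2 * Pbar * (vser c M - vser c (M + 1)) := by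
  rw [add_mul, one_mul, map_add, co_zT_mul,
    show (-(M : ℤ) - 1) = -((M + 1 : ℕ) : ℤ) by push_cast; ring, h.2, h.2,
    if_neg (Nat.succ_ne_zero M), zero_add, add_assoc, ← mul_add, vser, vser, ← qsum_sub,
    ← qsum_add]
  congr 2
  refine qsum_congr fun k => ?_
  have h3 := Ring.inverse_mul_cancel _ (isUnit_one_add_X_pow_mul (R := ℂ) hc k)
  linear_combination ((-1) ^ k * X ^ ((k + 1) ^ 2 + c * (k + 1) * M) * (1 - X ^ (c * (k + 1)))) * h3

theorem RankForm.co_one_add_mul_symm {c : ℕ} {F : LP⟦X⟧} (h : RankForm c F) (m : ℤ) :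
    co m ((1 + zT 1) * F) = co (1 - m) ((1 + zT 1) * F) := by
  rw [add_mul, one_mul, map_add, map_add, co_zT_mul, co_zT_mul, h.1 m, h.1 (m - 1),
    show 1 - m - 1 = -m by ring, show -(m - 1) = 1 - m by ring, add_comm]

theorem sum_Icc_symm (f : ℤ → ℂ) (K : ℕ) :
    ∑ m ∈ Finset.Icc (1 - (K : ℤ)) K, f m = ∑ M ∈ Finset.range K, (f (-M) + f (M + 1)) := by
  induction K with
  | zero => simp
  | succ K ih =>
    have : Finset.Icc (1 - ((K + 1 : ℕ) : ℤ)) (K + 1 : ℕ) =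
        insert (-(K : ℤ)) (insert ((K : ℤ) + 1) (Finset.Icc (1 - (K : ℤ)) K)) := by
      ext m; simp only [Finset.mem_Icc, Finset.mem_insert]; push_cast; omega
    rw [this, Finset.sum_insert, Finset.sum_insert, ih, Finset.sum_range_succ]
    · ring
    · simp
    · simp only [Finset.mem_insert, Finset.mem_Icc]; omega

/-- The pairing of `-M` with `M + 1` is adapted to series symmetric under `m ↦ 1 - m`. -/
theorem coeff_ev1_eq_sum (F : LP⟦X⟧) (n N : ℕ) : ∃ K : ℕ, N ≤ K ∧
    coeff n (ev1 F) = ∑ M ∈ Finset.range K, (coeff n (co (-M) F) + coeff n (co (M + 1) F)) := by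
  set S := (coeff n F).coeff.support
  obtain ⟨K, hK⟩ : ∃ K : ℕ, ∀ m ∈ S, m.natAbs < K := by
    refine ⟨S.sup Int.natAbs + 1, fun m hm => Nat.lt_succ_of_le (Finset.le_sup hm)⟩
  refine ⟨max K N, le_max_right _ _, ?_⟩
  have := sum_Icc_symm (fun m => (coeff n F).coeff m) (max K N)
  simp only [← coeff_co] at this
  rw [← this, ev1, evz, coeff_map, eval_eq_sum, Finsupp.sum]
  simp only [one_zpow, Units.val_one, mul_one, coeff_co]
  refine Finset.sum_subset (fun m hm => ?_) fun m _ hm => ?_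
  · have := hK m hm
    have h2 : K ≤ max K N := le_max_left _ _
    rw [Finset.mem_Icc]; omega
  · simpa using hm

/-- Gauss's identity `P̄ ∑_{n ∈ ℤ} (-1)^n q^(n²) = 1`. At `z = 1` the series `(1 + z) F` is `2 P̄`,
while the sum of its coefficients, taken in symmetric pairs, telescopes to `2 (1 + 2 P̄ · vser c
0)`. -/
theorem RankForm.gauss {c : ℕ} (hc : 0 < c) {F : LP⟦X⟧} (h : RankForm c F) (h1 : ev1 F = Pbar) :
    Pbar * (1 - 2 * vser c 0) = 1 := by
  have key : (2 : ℂ⟦X⟧) * Pbar = 2 * (1 + 2 * Pbar * vser c 0) := by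
    ext n
    obtain ⟨K, hK, hs⟩ := coeff_ev1_eq_sum ((1 + zT 1) * F) n (n + 1)
    have e1 : ev1 ((1 + zT 1) * F) = 2 * Pbar := by
      rw [map_mul, map_add, map_one, ev1_zT, h1]; ring
    have e2 : ∀ M : ℕ, co (M + 1) ((1 + zT 1) * F) = co (-M) ((1 + zT 1) * F) := by
      intro M
      rw [h.co_one_add_mul_symm]; congr 2; ring
    rw [e1] at hs
    simp only [e2, ← map_add, ← map_sum, h.co_one_add_mul hc] at hs
    rw [hs]
    have e3 : ∀ K, 0 < K → ∑ M ∈ Finset.range K, (((if M = 0 then 1 else 0) +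
        2 * Pbar * (vser c M - vser c (M + 1))) + ((if M = 0 then 1 else 0) +
        2 * Pbar * (vser c M - vser c (M + 1)))) =
        2 * (1 + 2 * Pbar * (vser c 0 - vser c K)) := by
      intro K hK
      induction K with
      | zero => omega
      | succ K ih =>
        rw [Finset.sum_range_succ]
        rcases Nat.eq_zero_or_pos K with rfl | hK'
        · simp; ring
        · rw [ih hK', if_neg hK'.ne']; ring
    rw [e3 K (by omega)]
    refine coeff_eq_of_X_pow_dvd_sub (N := K) ?_ (by omega)
    have : (2 * (1 + 2 * Pbar * (vser c 0 - vser c K)) - 2 * (1 + 2 * Pbar * vser c 0)) =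
        (-4 * Pbar) * vser c K := by ring
    rw [this]
    exact dvd_mul_of_dvd_right (X_pow_dvd_vser hc K) _
  have h2 : (2 : ℂ⟦X⟧) ≠ 0 := by
    have : (2 : ℂ⟦X⟧) = C 2 := (map_ofNat C 2).symm
    rw [this]; simp
  have := mul_left_cancel₀ h2 key
  linear_combination this

/-- `∑_{m ≥ 1} q^{a m} (z^m - z^{-m})`. -/
def zdiff (a : ℕ) : LP⟦X⟧ := qsum fun j => X ^ (a * (j + 1)) * (zT (j + 1) - zT (-(j + 1)))

theorem adm_zdiff {a : ℕ} (ha : 0 < a) (g : ℕ → LP⟦X⟧) : Adm fun j => X ^ (a * (j + 1)) * g j :=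
  fun j => dvd_mul_of_dvd_left (pow_dvd_pow _ (by nlinarith)) _

theorem qsum_single {R : Type*} [CommRing R] {f : ℕ → R⟦X⟧} (hf : Adm f) (j : ℕ)
    (h : ∀ i, i ≠ j → f i = 0) : qsum f = f j := by
  symm
  refine eq_qsum hf fun N => ?_
  by_cases hj : j < N
  · rw [Finset.sum_eq_single j (fun i _ hi => h i hi) (fun h => absurd (Finset.mem_range.mpr hj) h)]
    simp
  · rw [Finset.sum_eq_zero, sub_zero]
    · exact (pow_dvd_pow _ (by omega)).trans (hf j)
    · intro i hi; exact h i (by simp at hi; omega)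

theorem co_zdiff {a : ℕ} (ha : 0 < a) (m : ℤ) :
    co m (zdiff a) = if m = 0 then 0 else C (m.sign : ℂ) * X ^ (a * m.natAbs) := by
  have hadm : Adm fun j : ℕ => co m (X ^ (a * (j + 1)) * (zT (j + 1) - zT (-(j + 1)))) :=
    fun j => X_pow_dvd_co (adm_zdiff ha (fun j => zT (j + 1) - zT (-(j + 1))) j) m
  have hterm : ∀ j : ℕ, co m (X ^ (a * (j + 1)) * (zT (j + 1) - zT (-(j + 1)))) =
      X ^ (a * (j + 1)) * ((if m = j + 1 then 1 else 0) - if m = -(j + 1) then 1 else 0) := by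
    intro j
    rw [co_X_pow_mul, map_sub, co_zT, co_zT]
  rw [zdiff, co_qsum]
  by_cases h0 : m = 0
  · rw [if_pos h0]
    rw [← qsum_zero]
    refine qsum_congr fun j => ?_
    rw [hterm, if_neg (by omega), if_neg (by omega)]; simp
  · rw [if_neg h0, qsum_single hadm (m.natAbs - 1)]
    · have h1 : m.natAbs - 1 + 1 = m.natAbs := by omega
      rw [hterm, h1]
      rcases lt_or_gt_of_ne h0 with h | h
      · rw [if_neg (by omega), if_pos (by omega), Int.sign_eq_neg_one_of_neg h]
        simp
      · rw [if_pos (by omega), if_neg (by omega), Int.sign_eq_one_of_pos h]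
        simp
    · intro i hi
      rw [hterm, if_neg (by omega), if_neg (by omega)]; simp

/-- `∑_{n, m ≥ 1} (-1)^n q^{n² + c n m} (z^m - z^{-m})`. -/
def psi0 (c : ℕ) : LP⟦X⟧ :=
  qsum fun k => (-1) ^ (k + 1) * X ^ ((k + 1) ^ 2) * zdiff (c * (k + 1))

theorem co_emb_pow_mul (m : ℤ) (k e : ℕ) (F : LP⟦X⟧) :
    co m ((-1) ^ k * X ^ e * F) = (-1) ^ k * X ^ e * co m F := by
  rw [← co_emb_mul]; simp [emb_X]

theorem co_psi0 {c : ℕ} (hc : 0 < c) (m : ℤ) :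
    co m (psi0 c) = if m = 0 then 0 else -C (m.sign : ℂ) * vser c m.natAbs := by
  rw [psi0, co_qsum]
  split_ifs with h0
  · rw [← qsum_zero]
    refine qsum_congr fun k => ?_
    rw [co_emb_pow_mul, co_zdiff (by positivity), if_pos h0, mul_zero]
  · rw [vser, qsum_mul_left (adm_vser c _)]
    refine qsum_congr fun k => ?_
    rw [co_emb_pow_mul, co_zdiff (by positivity), if_neg h0]
    ring

theorem co_psi0_neg {c : ℕ} (hc : 0 < c) (m : ℤ) : co (-m) (psi0 c) = -co m (psi0 c) := by
  rw [co_psi0 hc, co_psi0 hc]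
  by_cases h : m = 0
  · simp [h]
  · simp [h]

/-- The Appell-type series `(1 + z) R / P̄`. -/
def bser (c : ℕ) : LP⟦X⟧ := (1 + zT 1) + 2 * (1 - zT 1) * psi0 c

theorem co_bser {c : ℕ} (m : ℤ) :
    co m (bser c) = (if m = 0 then 1 else 0) + (if m = 1 then 1 else 0) +
      2 * (co m (psi0 c) - co (m - 1) (psi0 c)) := by
  have h : (2 : LP⟦X⟧) * (1 - zT 1) * psi0 c = ((2 : ℕ) : LP⟦X⟧) * (psi0 c - zT 1 * psi0 c) := by
    push_cast; ring
  rw [bser, map_add, map_add, co_one, co_zT, h, co_nat_mul, map_sub, co_zT_mul]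
  simp

/-- Coefficients are compared for `m ≤ 0`, where `m = 0` is Gauss's identity; the others follow
because both sides are symmetric under `m ↦ 1 - m`. -/
theorem RankForm.one_add_mul {c : ℕ} (hc : 0 < c) {F : LP⟦X⟧} (h : RankForm c F)
    (h1 : ev1 F = Pbar) : (1 + zT 1) * F = emb Pbar * bser c := by
  have hneg : ∀ M : ℕ, co (-M) ((1 + zT 1) * F) = co (-M) (emb Pbar * bser c) := by
    intro M
    rw [h.co_one_add_mul hc, co_emb_mul, co_bser,
      show (-(M : ℤ) - 1) = -((M + 1 : ℕ) : ℤ) by push_cast; ring, co_psi0_neg hc,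
      co_psi0_neg hc, co_psi0 hc, co_psi0 hc, if_neg (show -(M : ℤ) ≠ 1 by omega),
      if_neg (show ((M + 1 : ℕ) : ℤ) ≠ 0 by omega)]
    have hg := h.gauss hc h1
    have hs : ∀ M : ℕ, ((((M + 1 : ℕ) : ℤ).sign : ℤ) : ℂ) = 1 := fun M => by
      rw [Int.sign_eq_one_of_pos (by omega)]; simp
    rw [hs, Int.natAbs_natCast, Int.natAbs_natCast, map_one]
    rcases M with _ | M
    · simp
      linear_combination -hg
    · rw [if_neg (by omega), if_neg (by omega), if_neg (by omega), hs, map_one]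
      ring
  refine ext_co fun m => ?_
  rcases le_or_gt m 0 with hm | hm
  · obtain ⟨M, hM⟩ := Int.eq_ofNat_of_zero_le (show 0 ≤ -m by omega)
    rw [show m = -(M : ℤ) by omega]; exact hneg M
  · obtain ⟨M, hM⟩ := Int.eq_ofNat_of_zero_le (show 0 ≤ m - 1 by omega)
    rw [h.co_one_add_mul_symm, show 1 - m = -(M : ℤ) by omega, hneg, co_emb_mul, co_emb_mul,
      co_bser, co_bser, show -(M : ℤ) - 1 = -m by omega, show -(M : ℤ) = -(m - 1) by omega,
      co_psi0_neg hc, co_psi0_neg hc, if_neg (show ¬ (-(m - 1) = 1) by omega),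
      if_neg (show ¬ (m = 0) by omega), if_congr (show -(m - 1) = 0 ↔ m = 1 by omega) rfl rfl]
    ring

end Gauss

end OverpartitionMoments

end

noncomputable section
namespace OverpartitionMoments
open PowerSeries

/-! ### Generating functions of residual partitions -/

section ResidualPartition

variable {R : Type*} [CommRing R]

/-- The non-overlined parts divisible by `c`, divided by `c`. -/
def resid (c : ℕ) {n : ℕ} (l : Overpartition n) : Multiset ℕ :=
  (l.nonOverlined.filter (fun x => c ∣ x)).map (fun x => x / c)

theorem resid_one {n : ℕ} (l : Overpartition n) : resid 1 l = l.nonOverlined := by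
  simp [resid]

theorem resid_two {n : ℕ} (l : Overpartition n) : resid 2 l = l.halfEvenNonOverlined := by
  simp only [resid, Overpartition.halfEvenNonOverlined, even_iff_two_dvd]

theorem mem_resid {c : ℕ} (hc : 0 < c) {n : ℕ} (l : Overpartition n) {j : ℕ} (h : j ∈ resid c l) :
    0 < j ∧ j ≤ n := by
  rw [resid, Multiset.mem_map] at h
  obtain ⟨i, hi, rfl⟩ := h
  rw [Multiset.mem_filter] at hi
  have hp := mem_parts_of_mem_nonOverlined l hi.1
  have h1 : 0 < i := l.toPartition.parts_pos hp
  exact ⟨Nat.div_pos (Nat.le_of_dvd h1 hi.2) hc, (Nat.div_le_self _ _).trans (le_of_mem_parts l hp)⟩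

theorem card_resid_le {c : ℕ} {n : ℕ} (l : Overpartition n) : (resid c l).card ≤ n := by
  rw [resid, Multiset.card_map]
  refine (Multiset.card_le_card (Multiset.filter_le _ _)).trans
    ((Multiset.card_le_card (Multiset.sub_le_self _ _)).trans ?_)
  have h : ∀ s : Multiset ℕ, (∀ i ∈ s, 0 < i) → s.card ≤ s.sum := by
    intro s
    induction s using Multiset.induction_on with
    | empty => simp
    | cons a s ih =>
      intro h
      rw [Multiset.card_cons, Multiset.sum_cons]
      have h1 := h a (Multiset.mem_cons_self _ _)
      have h2 := ih fun i hi => h i (Multiset.mem_cons_of_mem hi)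
      omega
  have := h l.toPartition.parts fun i hi => l.toPartition.parts_pos hi
  rwa [l.toPartition.parts_sum] at this

/-- A multiplicative weight of a multiset: `g j e` for `e` copies of `j`. -/
def msWeight (γ : ℕ → ℕ → R) (s : Multiset ℕ) : R := ∏ j ∈ s.toFinset, γ j (s.count j)

theorem msWeight_resid {c : ℕ} (hc : 0 < c) {γ : ℕ → ℕ → R} (hγ : ∀ j, γ j 0 = 1) {n : ℕ}
    (l : Overpartition n) : msWeight γ (resid c l) =
      ovWeight (fun _ => 1) (fun i e => if c ∣ i then γ (i / c) e else 1) n l := by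
  rw [ovWeight, Finset.prod_const_one, one_mul, msWeight, resid, Multiset.toFinset_map]
  have hinj : Set.InjOn (fun x => x / c) {x | x ∈ l.nonOverlined.filter (fun x => c ∣ x)} := by
    intro x hx y hy hxy
    rw [Set.mem_ofPred_eq, Multiset.mem_filter] at hx hy
    obtain ⟨a, rfl⟩ := hx.2
    obtain ⟨b, rfl⟩ := hy.2
    simp only [Nat.mul_div_cancel_left _ hc] at hxy
    rw [hxy]
  rw [Finset.prod_image (fun x hx y hy => hinj (by simpa using hx) (by simpa using hy))]
  refine Finset.prod_subset_one_on_sdiff (fun i hi => ?_) (fun i hi => ?_) fun i hi => ?_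
  · rw [Multiset.mem_toFinset, Multiset.mem_filter] at hi
    rw [Multiset.mem_toFinset]
    exact mem_parts_of_mem_nonOverlined l hi.1
  · rw [Finset.mem_sdiff, Multiset.mem_toFinset, Multiset.mem_toFinset, Multiset.mem_filter,
      not_and'] at hi
    split_ifs with h
    · rw [Multiset.count_eq_zero.mpr (hi.2 h), hγ]
    · rfl
  · rw [Multiset.mem_toFinset] at hi
    rw [Multiset.count_map_eq_count _ _ hinj i hi]
    rw [Multiset.mem_filter] at hi
    rw [if_pos hi.2, Multiset.count_filter_of_pos hi.2]

theorem iprod_dvd_reindex {c : ℕ} (hc : 0 < c) {v : ℕ → R⟦X⟧} (hv : ∀ i, X ^ (c * i) ∣ v i - 1) :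
    iprod (fun i => if c ∣ i + 1 then v ((i + 1) / c) else 1) = iprod fun j => v (j + 1) := by
  obtain ⟨d, rfl⟩ : ∃ d, c = d + 1 := ⟨c - 1, by omega⟩
  have h1 : ∀ i, X ^ (i + 1) ∣ (if d + 1 ∣ i + 1 then v ((i + 1) / (d + 1)) else 1) - 1 := by
    intro i
    split_ifs with h
    · have := hv ((i + 1) / (d + 1))
      rwa [Nat.mul_div_cancel' h] at this
    · simp
  have h2 : ∀ i, X ^ (i + 1) ∣ v (i + 1) - 1 := fun i =>
    (pow_dvd_pow _ (Nat.le_mul_of_pos_left _ hc)).trans (hv (i + 1))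
  have h3 : ∀ N, ∏ i ∈ Finset.range ((d + 1) * N),
      (if d + 1 ∣ i + 1 then v ((i + 1) / (d + 1)) else 1) = ∏ j ∈ Finset.range N, v (j + 1) := by
    intro N
    induction N with
    | zero => simp
    | succ N ih =>
      rw [Nat.mul_succ, Finset.prod_range_add, ih, Finset.prod_range_succ, Finset.prod_range_succ,
        show (d + 1) * N + d + 1 = (d + 1) * (N + 1) by ring, if_pos (dvd_mul_right _ _),
        Nat.mul_div_cancel_left _ hc]
      congr 1
      refine Eq.trans (congrArg (· * v (N + 1)) (Finset.prod_eq_one fun i hi => ?_)) (one_mul _)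
      refine if_neg fun h => ?_
      have h' : d + 1 ∣ i + 1 := by
        rw [add_assoc] at h
        exact (Nat.dvd_add_right (dvd_mul_right _ _)).mp h
      have := Nat.le_of_dvd (Nat.succ_pos i) h'
      simp at hi; omega
  refine eq_iprod h2 fun N => ?_
  rw [← h3]
  have h4 : N ≤ (d + 1) * N := Nat.le_mul_of_pos_left _ hc
  exact (pow_dvd_pow _ (by omega)).trans (X_pow_dvd_iprod_sub h1 ((d + 1) * N))

/-- The factor of the parts that do not enter the residual partition. -/
def baseGF (R : Type*) [CommRing R] (c : ℕ) : R⟦X⟧ :=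
  iprod (fun i => 1 + X ^ (i + 1)) *
    iprod fun i => if c ∣ i + 1 then 1 else partSeries (i + 1) (fun _ => (1 : R))

theorem X_pow_dvd_partSeries {i : ℕ} {g : ℕ → R} (hg : g 0 = 1) :
    X ^ (i + 1) ∣ partSeries (i + 1) g - 1 := by
  have := X_pow_dvd_partSeries_sub_one (i := i) 0 hg
  simpa using this

theorem X_pow_dvd_partSeries_mul {c : ℕ} (hc : 0 < c) (i : ℕ) {g : ℕ → R} (hg : g 0 = 1) :
    X ^ (i + 1) ∣ partSeries (c * (i + 1)) g - 1 := by
  obtain ⟨e, he⟩ : ∃ e, c * (i + 1) = e + 1 := ⟨c * (i + 1) - 1, by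
    have : 0 < c * (i + 1) := by positivity
    omega⟩
  rw [he]
  refine (pow_dvd_pow _ ?_).trans (X_pow_dvd_partSeries hg)
  rw [← he]; exact Nat.le_mul_of_pos_left _ hc

theorem ovGF_msWeight {c : ℕ} (hc : 0 < c) {γ : ℕ → ℕ → R} (hγ : ∀ j, γ j 0 = 1) :
    ovGF (fun _ l => msWeight γ (resid c l)) =
      baseGF R c * iprod fun j => partSeries (c * (j + 1)) (γ (j + 1)) := by
  simp only [msWeight_resid hc hγ]
  change ovGF (ovWeight _ _) = _
  have hg : ∀ i, (if c ∣ i then γ (i / c) 0 else 1) = 1 := fun i => by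
    split_ifs
    · exact hγ _
    · rfl
  rw [ovGF_eq_iprod _ hg, iprod_mul (fun i => by simp)
    (fun i => X_pow_dvd_partSeries (hg (i + 1))), baseGF, mul_assoc]
  congr 1
  · simp
  have hv : ∀ j, X ^ (c * j) ∣ (if j = 0 then 1 else partSeries (c * j) (γ j)) - 1 := by
    intro j
    split_ifs with h
    · simp
    · obtain ⟨e, he⟩ : ∃ e, c * j = e + 1 := ⟨c * j - 1, by
        have : 0 < c * j := Nat.mul_pos hc (Nat.pos_of_ne_zero h)
        omega⟩
      rw [he]; exact X_pow_dvd_partSeries (hγ j)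
  have h1 := iprod_dvd_reindex hc hv
  simp only [Nat.succ_ne_zero, if_false] at h1
  rw [← h1, ← iprod_mul]
  · congr 1
    ext1 i
    by_cases h : c ∣ i + 1
    · have h0 : (i + 1) / c ≠ 0 := (Nat.div_pos (Nat.le_of_dvd i.succ_pos h) hc).ne'
      simp only [h, if_true, h0, if_false, one_mul, Nat.mul_div_cancel' h]
    · simp only [h, if_false, mul_one]
  · intro i
    split_ifs
    · simp
    · exact X_pow_dvd_partSeries rfl
  · intro i
    by_cases h : c ∣ i + 1
    · have h0 : (i + 1) / c ≠ 0 := (Nat.div_pos (Nat.le_of_dvd i.succ_pos h) hc).ne'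
      simp only [h, if_true, h0, if_false, Nat.mul_div_cancel' h]
      exact X_pow_dvd_partSeries (hγ _)
    · simp [h]

/-- The indicator of multiplicity zero. -/
def absent (R : Type*) [CommRing R] (e : ℕ) : R := if e = 0 then 1 else 0

theorem partSeries_absent (i : ℕ) : partSeries i (absent R) = 1 := by
  ext n
  rw [partSeries, coeff_mk, coeff_one, absent]
  by_cases h : n = 0
  · simp [h]
  · rw [if_neg h]
    split_ifs with h1 h2
    · exact absurd (Nat.eq_zero_of_dvd_of_div_eq_zero h1 h2) h
    · rfl
    · rfl

theorem partSeries_absent_add {i j : ℕ} (hi : 0 < i) :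
    partSeries i (fun e => absent R e + if e = j then 1 else 0) = 1 + X ^ (i * j) := by
  have : partSeries i (fun e => absent R e + if e = j then 1 else 0) =
      partSeries i (absent R) + partSeries i (fun e => if e = j then 1 else 0) := by
    ext n; simp only [partSeries, coeff_mk, map_add]; split_ifs <;> simp
  rw [this, partSeries_absent i]
  congr 1
  ext n
  rw [partSeries, coeff_mk, coeff_X_pow]
  by_cases h : i ∣ n
  · obtain ⟨m, rfl⟩ := h
    simp only [dvd_mul_right, if_true, Nat.mul_div_cancel_left _ hi]
    exact if_congr (by rw [Nat.mul_right_inj hi.ne']) rfl rfl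
  · have : n ≠ i * j := fun h' => h ⟨j, h'⟩
    simp [h, this]

end ResidualPartition

/-! ### Euler's sum and the q-binomial theorem -/

section CrankProduct

variable {R : Type*} [CommRing R]

/-- A solution of a first order recursion tending to `1` is a quotient of infinite products. -/
theorem mul_iprod_of_recursion {d n f : ℕ → R⟦X⟧} (hd : ∀ i, X ^ (i + 1) ∣ d i - 1)
    (hn : ∀ i, X ^ (i + 1) ∣ n i - 1) (h : ∀ k, d k * f k = n k * f (k + 1))
    (hf : ∀ k, X ^ k ∣ f k - 1) : f 0 * iprod d = iprod n := by
  refine eq_of_forall_X_pow_dvd_sub fun N => ?_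
  have h1 : f 0 * ∏ i ∈ Finset.range N, d i = (∏ i ∈ Finset.range N, n i) * f N := by
    induction N with
    | zero => simp
    | succ N ih =>
      rw [Finset.prod_range_succ, Finset.prod_range_succ, ← mul_assoc, ih]
      linear_combination (∏ i ∈ Finset.range N, n i) * h N
  have h2 := (pow_dvd_pow X (Nat.le_succ N)).trans (X_pow_dvd_iprod_sub hd N)
  have h3 := (pow_dvd_pow X (Nat.le_succ N)).trans (X_pow_dvd_iprod_sub hn N)
  have h4 := dvd_sub (dvd_add (dvd_mul_of_dvd_right h2 (f 0))
    (dvd_mul_of_dvd_right (hf N) (∏ i ∈ Finset.range N, n i))) h3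
  convert! h4 using 1
  linear_combination h1

theorem adm_mul_pow (a : R⟦X⟧) {e : ℕ} (he : 0 < e) (f : ℕ → R⟦X⟧) :
    Adm fun s => (a * X ^ e) ^ s * f s := by
  obtain ⟨k, rfl⟩ : ∃ k, e = k + 1 := ⟨e - 1, by omega⟩
  exact adm_pow_mul a k f

theorem X_pow_dvd_qsum_pow_sub_one (a : R⟦X⟧) {e k : ℕ} (he : 0 < e) (hk : k ≤ e) {f : ℕ → R⟦X⟧}
    (hf : f 0 = 1) : X ^ k ∣ (qsum fun s => (a * X ^ e) ^ s * f s) - 1 := by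
  rw [qsum_succ (adm_mul_pow a he f)]
  simp only [pow_zero, hf, mul_one, add_sub_cancel_left]
  refine X_pow_dvd_qsum fun i => dvd_mul_of_dvd_left ?_ _
  rw [pow_succ, mul_pow]
  refine dvd_mul_of_dvd_right (dvd_mul_of_dvd_right (pow_dvd_pow _ hk) _) _

/-- Euler's identity `∑ (z b)^ℓ / (b;b)_ℓ = 1 / (z b;b)_∞`, where `b = q ^ c`. -/
theorem euler_sum {c : ℕ} (hc : 0 < c) (z : R⟦X⟧) :
    (qsum fun s => (z * X ^ c) ^ s * hyp (fun _ => 1) (fun i => 1 - X ^ (c * (i + 1))) s) *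
      iprod (fun i => 1 - z * X ^ (c * (i + 1))) = 1 := by
  set ε : ℕ → R⟦X⟧ := hyp (fun _ => 1) (fun i => 1 - X ^ (c * (i + 1))) with hε
  have hpos : ∀ k, 0 < c * (k + 1) := fun k => by positivity
  have hle : ∀ k, k + 1 ≤ c * (k + 1) := fun k => Nat.le_mul_of_pos_left _ hc
  have h := mul_iprod_of_recursion (d := fun k => 1 - z * X ^ (c * (k + 1))) (n := fun _ => 1)
    (f := fun k => qsum fun s => (z * X ^ (c * (k + 1))) ^ s * ε s)
    (fun i => by
      simp only [sub_sub_cancel_left, dvd_neg]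
      exact dvd_mul_of_dvd_right (pow_dvd_pow _ (hle i)) _)
    (fun i => by simp) (fun k => ?_)
    (fun k => X_pow_dvd_qsum_pow_sub_one z (hpos k) ((Nat.le_succ k).trans (hle k))
      (hyp_zero _ _))
  · have h1 : iprod (fun _ => (1 : R⟦X⟧)) = 1 := by ext n; simp [iprod]
    simpa [h1] using h
  · rw [sub_mul, one_mul, one_mul, qsum_mul_left (adm_mul_pow z (hpos k) ε), sub_eq_iff_eq_add]
    have e1 : (qsum fun s => (z * X ^ (c * (k + 1))) ^ s * ε s) -
        (qsum fun s => (z * X ^ (c * (k + 1 + 1))) ^ s * ε s) =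
        qsum fun s => (z * X ^ (c * (k + 1))) ^ s * (ε s * (1 - X ^ (c * s))) := by
      rw [← qsum_sub]
      exact qsum_congr fun s => by ring
    have e4 : (qsum fun s => (z * X ^ (c * (k + 1))) ^ s * (ε s * (1 - X ^ (c * s)))) =
        qsum fun s => z * X ^ (c * (k + 1)) * ((z * X ^ (c * (k + 1))) ^ s * ε s) := by
      rw [qsum_succ (adm_mul_pow z (hpos k) _)]
      simp only [mul_zero, pow_zero, sub_self, zero_add]
      refine qsum_congr fun s => ?_
      have := hyp_succ_mul (n := fun _ => (1 : R⟦X⟧)) (isUnit_one_sub_X_pow_mul (R := R) hc) s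
      rw [hε, this]
      ring
    linear_combination e1 + e4

/-- The `q`-binomial theorem in the case `∑ (zb)_j (wb)^j / (b)_j = (b²)_∞ / (wb)_∞`, `zw = 1`. -/
theorem qbinomial_sum {c : ℕ} (hc : 0 < c) {z w : R⟦X⟧} (hzw : z * w = 1) :
    (qsum fun s => (w * X ^ c) ^ s *
      hyp (fun i => 1 - z * X ^ (c * (i + 1))) (fun i => 1 - X ^ (c * (i + 1))) s) *
      iprod (fun i => 1 - w * X ^ (c * (i + 1))) = iprod fun i => 1 - X ^ (c * (i + 2)) := by
  set ε : ℕ → R⟦X⟧ := hyp (fun i => 1 - z * X ^ (c * (i + 1))) (fun i => 1 - X ^ (c * (i + 1)))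
    with hε
  have hpos : ∀ k, 0 < c * (k + 1) := fun k => by positivity
  have hle : ∀ k, k + 1 ≤ c * (k + 1) := fun k => Nat.le_mul_of_pos_left _ hc
  have h := mul_iprod_of_recursion (d := fun k => 1 - w * X ^ (c * (k + 1)))
    (n := fun k => 1 - X ^ (c * (k + 2)))
    (f := fun k => qsum fun s => (w * X ^ (c * (k + 1))) ^ s * ε s)
    (fun i => by
      simp only [sub_sub_cancel_left, dvd_neg]
      exact dvd_mul_of_dvd_right (pow_dvd_pow _ (hle i)) _)
    (fun i => by
      simp only [sub_sub_cancel_left, dvd_neg]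
      exact pow_dvd_pow _ ((Nat.le_succ _).trans (hle (i + 1)))) (fun k => ?_)
    (fun k => X_pow_dvd_qsum_pow_sub_one w (hpos k) ((Nat.le_succ k).trans (hle k))
      (hyp_zero _ _))
  · simpa using h
  · set y := w * X ^ (c * (k + 1)) with hy
    have e1 : (qsum fun s => y ^ s * ε s) - (qsum fun s => (w * X ^ (c * (k + 1 + 1))) ^ s * ε s) =
        y * (qsum fun s => y ^ s * ε s) -
          X ^ (c * (k + 2)) * qsum fun s => (w * X ^ (c * (k + 1 + 1))) ^ s * ε s := by
      rw [qsum_mul_left (adm_mul_pow w (hpos k) ε), qsum_mul_left (adm_mul_pow w (hpos (k + 1)) ε),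
        ← qsum_sub, ← qsum_sub]
      have e2 : (qsum fun s => y ^ s * ε s - (w * X ^ (c * (k + 1 + 1))) ^ s * ε s) =
          qsum fun s => y ^ s * (ε s * (1 - X ^ (c * s))) :=
        qsum_congr fun s => by rw [hy]; ring
      rw [e2, qsum_succ (adm_mul_pow w (hpos k) _)]
      simp only [mul_zero, pow_zero, sub_self, zero_add]
      refine qsum_congr fun s => ?_
      have := hyp_succ_mul (n := fun i => 1 - z * X ^ (c * (i + 1)))
        (isUnit_one_sub_X_pow_mul (R := R) hc) s
      rw [hε, this, hy]
      linear_combination (-((w * X ^ (c * (k + 1))) ^ s * X ^ (c * (s + 1) + c * (k + 1)) *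
        hyp (fun i => 1 - z * X ^ (c * (i + 1))) (fun i => 1 - X ^ (c * (i + 1))) s)) * hzw
    linear_combination e1

end CrankProduct

/-! ### The product formula for the residual cranks -/

section CrankSeries

/-- The contribution of a partition to the crank generating function. -/
def crankPoly (s : Multiset ℕ) : LP :=
  if s = {1} then LaurentPolynomial.T 1 + LaurentPolynomial.T (-1) - 1
  else LaurentPolynomial.T (crank s)

theorem coeff_crankPoly (s : Multiset ℕ) (m : ℤ) : (crankPoly s).coeff m = (crankCount m s : ℂ) := by
  rw [crankPoly, crankCount]
  split_ifs with h h1 h2 h3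
  · subst h1
    simp [← LaurentPolynomial.T_zero]
  · rcases h2 with rfl | rfl <;> simp [← LaurentPolynomial.T_zero]
  · rw [not_or] at h2
    have e1 : (1 : ℤ) ≠ m := fun h => h2.1 h.symm
    have e2 : (-1 : ℤ) ≠ m := fun h => h2.2 h.symm
    have e3 : (0 : ℤ) ≠ m := fun h => h1 h.symm
    simp [← LaurentPolynomial.T_zero, e1, e2, e3]
  · simp [h3]
  · simp [h3]

/-- The generating function of the residual crank. -/
def crankGF (c : ℕ) : LP⟦X⟧ := ovGF fun _ l => crankPoly (resid c l)

theorem crankGF_coeff (c : ℕ) (m : ℤ) (n : ℕ) : (coeff n (crankGF c)).coeff m =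
    ((∑ l : Overpartition n, crankCount m (resid c l) : ℤ) : ℂ) := by
  rw [crankGF, ovGF, coeff_mk, AddMonoidAlgebra.coeff_sum, Finsupp.finsetSum_apply]
  push_cast
  exact Finset.sum_congr rfl fun l _ => coeff_crankPoly _ _

theorem Cbar_eq (k : ℕ) : Cbar k = ev1 (deltaZ^[k] (crankGF 1)) :=
  momentSeries_eq (fun m n => by simp only [crankGF_coeff, resid_one, Mbar]) k

theorem C2bar_eq (k : ℕ) : C2bar k = ev1 (deltaZ^[k] (crankGF 2)) :=
  momentSeries_eq (fun m n => by simp only [crankGF_coeff, resid_two, M2bar]) k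

theorem ev1_crankGF (c : ℕ) : ev1 (crankGF c) = Pbar := by
  ext n
  rw [ev1, evz, crankGF, map_ovGF, ovGF, coeff_mk, Pbar, coeff_mk]
  rw [Finset.sum_congr rfl (g := fun _ => (1 : ℂ))]
  · simp
  · intro l _
    rw [crankPoly]
    split_ifs <;> simp

variable {R : Type*} [CommRing R]

theorem msWeight_eq (f : ℕ → R) (hf : f 0 = 1) (b : ℕ → R) (s : Multiset ℕ) :
    msWeight (fun x e => (if x = 1 then f e else 1) * b x ^ e) s =
      f (s.count 1) * (s.map b).prod := by
  rw [msWeight, Finset.prod_mul_distrib, Finset.prod_multiset_map_count, Finset.prod_ite_eq']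
  congr 1
  split_ifs with h
  · rfl
  · rw [Multiset.mem_toFinset, ← Multiset.count_eq_zero] at h
    rw [h, hf]

theorem ovGF_resid_mul {c : ℕ} (hc : 0 < c) {f : ℕ → R} (hf : f 0 = 1) {b : ℕ → R} (hb : b 1 = 1) :
    ovGF (fun _ l => f ((resid c l).count 1) * ((resid c l).map b).prod) *
      iprod (fun i => if i = 0 then 1 else 1 - C (b (i + 1)) * X ^ (c * (i + 1))) =
      baseGF R c * partSeries c f := by
  simp only [← msWeight_eq f hf b]
  rw [ovGF_msWeight hc (fun j => by simp [hf]), mul_assoc, ← iprod_mul]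
  · congr 1
    have hu : ∀ i : ℕ, (partSeries (c * (i + 1)) (fun e => (if i + 1 = 1 then f e else 1) *
        b (i + 1) ^ e) * if i = 0 then 1 else 1 - C (b (i + 1)) * X ^ (c * (i + 1))) =
        if i = 0 then partSeries c f else 1 := by
      intro i
      by_cases h : i = 0
      · subst h; simp [hb]
      · simp only [h, if_false, show ¬ (i + 1 = 1) by omega, one_mul]
        exact partSeries_pow_mul (by positivity) _
    simp only [hu]
    rw [iprod_eq_prod (N := 1)]
    · simp
    · intro i
      split_ifs with h
      · subst h
        have := X_pow_dvd_partSeries_mul (R := R) hc 0 hf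
        simpa using this
      · simp
    · intro i hi; rw [if_neg (by omega)]
  · intro i
    exact X_pow_dvd_partSeries_mul hc i (by simp [hf])
  · intro i
    split_ifs
    · simp
    · simp only [sub_sub_cancel_left, dvd_neg]
      exact dvd_mul_of_dvd_right (pow_dvd_pow _ (Nat.le_mul_of_pos_left _ hc)) _

/-- Overpartitions whose residual partition has `j` ones, the other parts being weighted by `b`. -/
def onesGF (c j : ℕ) (b : ℕ → R) : R⟦X⟧ :=
  ovGF fun _ l => (if (resid c l).count 1 = j then 1 else 0) * ((resid c l).map b).prod

/-- The product formula needs weights equal to `1` at multiplicity zero. For `j > 0` the condition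
of having exactly `j` ones is therefore obtained as the difference of two such weights. -/
theorem onesGF_mul {c : ℕ} (hc : 0 < c) (j : ℕ) {b : ℕ → R} (hb : b 1 = 1) :
    onesGF c j b * iprod (fun i => if i = 0 then 1 else 1 - C (b (i + 1)) * X ^ (c * (i + 1))) =
      baseGF R c * X ^ (c * j) := by
  have h0 := ovGF_resid_mul hc (f := absent R) rfl hb
  rw [partSeries_absent] at h0
  rcases Nat.eq_zero_or_pos j with rfl | hj
  · simpa [onesGF, absent] using h0
  · have h1 := ovGF_resid_mul hc (f := fun e => absent R e + if e = j then 1 else 0)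
      (by simp [absent, hj.ne]) hb
    rw [partSeries_absent_add hc] at h1
    have h2 : onesGF c j b = ovGF (fun _ l => (absent R ((resid c l).count 1) +
        if (resid c l).count 1 = j then 1 else 0) * ((resid c l).map b).prod) -
        ovGF (fun _ l => absent R ((resid c l).count 1) * ((resid c l).map b).prod) := by
      ext n
      simp only [onesGF, ovGF, coeff_mk, map_sub, ← Finset.sum_sub_distrib]
      exact Finset.sum_congr rfl fun l _ => by ring
    rw [h2, sub_mul, h1, h0]
    ring

/-- Weight `1` for the parts `1, …, s` and `0` for larger parts. -/
def bCut (s x : ℕ) : LP := if x = 1 then 1 else if x ≤ s then 1 else 0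

/-- Weight `z` for the parts larger than `j`. -/
def bLarge (j x : ℕ) : LP := if j < x then LaurentPolynomial.T 1 else 1

theorem prod_map_bCut {s : Multiset ℕ} (h1 : s.count 1 = 0) (t : ℕ) :
    (s.map (bCut t)).prod = if s.sup ≤ t then 1 else 0 := by
  have h2 : ∀ x ∈ s, x ≠ 1 := fun x hx h => (Multiset.count_eq_zero.mp h1) (h ▸ hx)
  split_ifs with h
  · refine Multiset.prod_eq_one fun y hy => ?_
    obtain ⟨x, hx, rfl⟩ := Multiset.mem_map.mp hy
    rw [bCut, if_neg (h2 x hx), if_pos ((Multiset.le_sup hx).trans h)]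
  · rw [Multiset.sup_le] at h
    push Not at h
    obtain ⟨x, hx, hxt⟩ := h
    refine Multiset.prod_eq_zero (Multiset.mem_map.mpr ⟨x, hx, ?_⟩)
    rw [bCut, if_neg (h2 x hx), if_neg (not_le.mpr hxt)]

theorem prod_map_bLarge (s : Multiset ℕ) (j : ℕ) :
    (s.map (bLarge j)).prod = LaurentPolynomial.T ((s.filter (fun x => j < x)).card : ℤ) := by
  induction s using Multiset.induction_on with
  | empty => simp
  | cons a s ih =>
    rw [Multiset.map_cons, Multiset.prod_cons, ih, bLarge]
    split_ifs with h
    · rw [Multiset.filter_cons_of_pos _ h, Multiset.card_cons, ← LaurentPolynomial.T_add]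
      congr 1; push_cast; ring
    · rw [Multiset.filter_cons_of_neg _ h, one_mul]

/-- Weight `1` for the part `1` only. -/
def bOne (x : ℕ) : LP := if x = 1 then 1 else 0

theorem prod_map_bOne {s : Multiset ℕ} (h1 : s.count 1 = 1) :
    (s.map bOne).prod = if s = {1} then 1 else 0 := by
  split_ifs with h
  · subst h; simp [bOne]
  · obtain ⟨t, rfl⟩ := Multiset.exists_cons_of_mem (Multiset.one_le_count_iff_mem.mp h1.ge)
    rw [Multiset.count_cons_self] at h1
    have ht : t ≠ 0 := fun h0 => h (by rw [h0]; rfl)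
    obtain ⟨x, hx⟩ := Multiset.exists_mem_of_ne_zero ht
    have hx1 : x ≠ 1 := fun h => by
      have := Multiset.count_pos.mpr (h ▸ hx); omega
    rw [Multiset.map_cons, Multiset.prod_cons]
    have : (t.map bOne).prod = 0 := Multiset.prod_eq_zero (Multiset.mem_map.mpr ⟨x, hx, by
      rw [bOne, if_neg hx1]⟩)
    rw [this, mul_zero]

/-- The number of ones is the case distinction. Without ones the crank is the largest part, and its
power of `z` is written through successive cuts; with `j + 1` ones it is the number of parts above
`j + 1`, minus `j + 1`. For the partition `{1}` this rule gives `z⁻¹`, and the last term adds the `z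
- 1` of the convention. -/
theorem crankPoly_eq {s : Multiset ℕ} {n : ℕ} (hsup : s.sup ≤ n) (hcard : s.card ≤ n) :
    crankPoly s = ((if s.count 1 = 0 then 1 else 0) * (s.map (bCut 0)).prod +
      ∑ t ∈ Finset.range (n + 1), LaurentPolynomial.T (t + 1) *
        ((if s.count 1 = 0 then 1 else 0) * (s.map (bCut (t + 1))).prod -
          (if s.count 1 = 0 then 1 else 0) * (s.map (bCut t)).prod)) +
      ∑ j ∈ Finset.range (n + 1), LaurentPolynomial.T (-(j + 1)) *
        ((if s.count 1 = j + 1 then 1 else 0) * (s.map (bLarge (j + 1))).prod) +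
      (LaurentPolynomial.T 1 - 1) * ((if s.count 1 = 1 then 1 else 0) * (s.map bOne).prod) := by
  by_cases h0 : s.count 1 = 0
  · have hs : s ≠ {1} := fun h => by rw [h] at h0; simp at h0
    rw [crankPoly, if_neg hs, crank, if_pos h0]
    simp only [h0, if_true, one_mul, prod_map_bCut h0]
    rw [Finset.sum_eq_zero (s := Finset.range (n + 1))
      (f := fun j => LaurentPolynomial.T (-((j : ℤ) + 1)) * _)]
    · simp only [add_zero, show ¬ (0 = 1) by omega, if_false, zero_mul, mul_zero]
      rcases Nat.eq_zero_or_pos s.sup with hz | hpos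
      · simp [hz]
      · obtain ⟨k, hk⟩ : ∃ k, s.sup = k + 1 := ⟨s.sup - 1, by omega⟩
        rw [Finset.sum_eq_single k, hk]
        · simp
        · intro t _ ht
          by_cases h : s.sup ≤ t
          · simp [h, h.trans (Nat.le_succ t)]
          · have h' : ¬ s.sup ≤ t + 1 := by omega
            simp [h, h']
        · intro h; simp at h; omega
    · intro j _
      rw [if_neg (by omega)]; simp
  · obtain ⟨j, hj⟩ : ∃ j, s.count 1 = j + 1 := ⟨s.count 1 - 1, by omega⟩
    have hjn : j < n + 1 := by
      have := Multiset.count_le_card 1 s; omega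
    simp only [h0, if_false, zero_mul, sub_self, mul_zero, Finset.sum_const_zero, add_zero,
      zero_add]
    rw [Finset.sum_eq_single j (fun i _ hi => by rw [if_neg (by omega)]; simp)
      (fun h => absurd (Finset.mem_range.mpr hjn) h), if_pos hj, one_mul, prod_map_bLarge,
      ← LaurentPolynomial.T_add, crankPoly]
    have hcr : crank s = -((j : ℤ) + 1) + ((s.filter (fun x => j + 1 < x)).card : ℤ) := by
      rw [crank, if_neg h0, hj]; push_cast; ring
    rw [hcr]
    split_ifs with h1 h2 h3
    · rw [prod_map_bOne h2, if_pos h1]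
      subst h1
      simp only [Multiset.count_singleton_self] at hj
      have : j = 0 := by omega
      subst this
      have hf : ((({1} : Multiset ℕ).filter (fun x => 0 + 1 < x)).card : ℤ) = 0 := by
        simp [Multiset.filter_singleton]
      rw [hf]
      simp
      ring
    · exact absurd (by rw [h1]; simp) h2
    · rw [prod_map_bOne h3, if_neg h1]; simp
    · simp

theorem crankGF_eq {c : ℕ} (hc : 0 < c) : crankGF c =
    (onesGF c 0 (bCut 0) + qsum fun s : ℕ => zT (s + 1) *
      (onesGF c 0 (bCut (s + 1)) - onesGF c 0 (bCut s))) +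
    (qsum fun j : ℕ => zT (-(j + 1)) * onesGF c (j + 1) (bLarge (j + 1))) +
    (zT 1 - 1) * onesGF c 1 bOne := by
  have h1 : zT 1 - 1 = C (LaurentPolynomial.T 1 - 1 : LP) := by rw [map_sub, map_one]; rfl
  ext1 n
  rw [map_add, h1, coeff_C_mul]
  simp only [crankGF, onesGF, ovGF, qsum, coeff_mk, map_add, coeff_C_mul, zT, map_sub (coeff n),
    ← Finset.sum_sub_distrib, Finset.mul_sum]
  rw [Finset.sum_comm (s := Finset.range (n + 1)), Finset.sum_comm (s := Finset.range (n + 1)),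
    ← Finset.sum_add_distrib, ← Finset.sum_add_distrib, ← Finset.sum_add_distrib]
  refine Finset.sum_congr rfl fun l _ => ?_
  exact crankPoly_eq (Multiset.sup_le.mpr fun j hj => (mem_resid hc l hj).2) (card_resid_le l)

theorem X_pow_dvd_one_sub_mul {c : ℕ} (hc : 0 < c) (a : R⟦X⟧) (i : ℕ) :
    X ^ (i + 1) ∣ (1 - a * X ^ (c * (i + 1))) - 1 := by
  simp only [sub_sub_cancel_left, dvd_neg]
  exact dvd_mul_of_dvd_right (pow_dvd_pow _ (Nat.le_mul_of_pos_left _ hc)) _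

theorem X_pow_dvd_ite_sub {c : ℕ} (hc : 0 < c) (a : ℕ → R⟦X⟧) (i : ℕ) :
    X ^ (i + 1) ∣ (if i = 0 then 1 else 1 - a i * X ^ (c * (i + 1))) - 1 := by
  split_ifs
  · simp
  · exact X_pow_dvd_one_sub_mul hc _ i

theorem onesGF_bOne {c : ℕ} (hc : 0 < c) : onesGF c 1 bOne = baseGF LP c * X ^ c := by
  have h := onesGF_mul hc 1 (b := bOne) (by simp [bOne])
  rw [iprod_eq_prod (N := 0) (X_pow_dvd_ite_sub hc fun i => C (bOne (i + 1)))] at h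
  · simpa using h
  · intro i _
    split_ifs with h0
    · rfl
    · simp [bOne, h0]

theorem onesGF_bCut_zero {c : ℕ} (hc : 0 < c) : onesGF c 0 (bCut 0) = baseGF LP c := by
  have h := onesGF_mul hc 0 (b := bCut 0) (by simp [bCut])
  rw [iprod_eq_prod (N := 0) (X_pow_dvd_ite_sub hc fun i => C (bCut 0 (i + 1)))] at h
  · simpa using h
  · intro i _
    split_ifs with h0
    · rfl
    · simp [bCut, h0]

/-- The factor `1 - X ^ c` cancels the part `1` in the denominator of `hyp`, since ones are
forbidden. -/
theorem onesGF_bCut_succ {c : ℕ} (hc : 0 < c) (s : ℕ) :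
    onesGF c 0 (bCut (s + 1)) =
      baseGF LP c * ((1 - X ^ c) * hyp (fun _ => 1) (fun i => 1 - X ^ (c * (i + 1))) (s + 1)) := by
  have h := onesGF_mul hc 0 (b := bCut (s + 1)) (by simp [bCut])
  rw [iprod_eq_prod (N := s + 1) (X_pow_dvd_ite_sub hc fun i => C (bCut (s + 1) (i + 1)))] at h
  · have h2 := hyp_mul_prod (n := fun _ => (1 : LP⟦X⟧)) (isUnit_one_sub_X_pow_mul hc) (s + 1)
    rw [Finset.prod_range_succ'] at h h2
    have e1 : ∏ k ∈ Finset.range s, (if k + 1 = 0 then 1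
        else 1 - C (bCut (s + 1) (k + 1 + 1)) * X ^ (c * (k + 1 + 1))) =
        ∏ k ∈ Finset.range s, (1 - X ^ (c * (k + 1 + 1)) : LP⟦X⟧) := by
      refine Finset.prod_congr rfl fun k hk => ?_
      have := Finset.mem_range.mp hk
      rw [if_neg (by omega), bCut, if_neg (by omega), if_pos (by omega), map_one, one_mul]
    rw [e1] at h
    have hu : IsUnit (∏ k ∈ Finset.range s, (1 - X ^ (c * (k + 1 + 1)) : LP⟦X⟧)) := by
      rw [IsUnit.prod_iff]; exact fun i _ => isUnit_one_sub_X_pow_mul hc (i + 1)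
    refine (IsUnit.mul_left_inj hu).mp ?_
    simp only [if_true, mul_one, mul_zero, pow_zero, Finset.prod_const_one, zero_add] at h h2
    rw [h]
    linear_combination -baseGF LP c * h2
  · intro i hi
    split_ifs with h0
    · rfl
    · rw [bCut, if_neg (by omega), if_neg (by omega)]; simp

set_option maxHeartbeats 600000 in
theorem onesGF_bLarge {c : ℕ} (hc : 0 < c) (j : ℕ) :
    onesGF c (j + 1) (bLarge (j + 1)) * iprod (fun i => 1 - zT 1 * X ^ (c * (i + 1))) =
      baseGF LP c * X ^ (c * (j + 1)) * ((1 - X ^ c) *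
        hyp (fun i => 1 - zT 1 * X ^ (c * (i + 1))) (fun i => 1 - X ^ (c * (i + 1))) (j + 1)) := by
  have h := onesGF_mul hc (j + 1) (b := bLarge (j + 1)) (by simp [bLarge])
  rw [iprod_eq_prod_mul (X_pow_dvd_ite_sub hc fun i => C (bLarge (j + 1) (i + 1))) (j + 1)] at h
  rw [iprod_eq_prod_mul (X_pow_dvd_one_sub_mul hc _) (j + 1)]
  have h2 := hyp_mul_prod (n := fun i => 1 - zT 1 * X ^ (c * (i + 1)))
    (isUnit_one_sub_X_pow_mul (R := LP) hc) (j + 1)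
  rw [Finset.prod_range_succ' (fun i => (1 - X ^ (c * (i + 1)) : LP⟦X⟧))] at h2
  rw [Finset.prod_range_succ'] at h
  have e1 : ∏ k ∈ Finset.range j, (if k + 1 = 0 then 1
      else 1 - C (bLarge (j + 1) (k + 1 + 1)) * X ^ (c * (k + 1 + 1))) =
      ∏ k ∈ Finset.range j, (1 - X ^ (c * (k + 1 + 1)) : LP⟦X⟧) := by
    refine Finset.prod_congr rfl fun k hk => ?_
    have := Finset.mem_range.mp hk
    rw [if_neg (by omega), bLarge, if_neg (by omega), map_one, one_mul]
  have e2 : iprod (fun i => if i + (j + 1) = 0 then 1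
      else 1 - C (bLarge (j + 1) (i + (j + 1) + 1)) * X ^ (c * (i + (j + 1) + 1))) =
      iprod (fun i => 1 - zT 1 * X ^ (c * (i + (j + 1) + 1))) := by
    refine congrArg iprod (funext fun i => ?_)
    rw [if_neg (by omega), bLarge, if_pos (by omega), zT]
  rw [e1, e2] at h
  have hu : IsUnit (∏ k ∈ Finset.range j, (1 - X ^ (c * (k + 1 + 1)) : LP⟦X⟧)) := by
    rw [IsUnit.prod_iff]; exact fun i _ => isUnit_one_sub_X_pow_mul hc (i + 1)
  refine (IsUnit.mul_left_inj hu).mp ?_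
  simp only [if_true, mul_one, zero_add] at h h2
  linear_combination (∏ i ∈ Finset.range (j + 1), (1 - zT 1 * X ^ (c * (i + 1)))) * h -
    baseGF LP c * X ^ (c * (j + 1)) * h2

theorem baseGF_eq {c : ℕ} (hc : 0 < c) :
    emb Pbar * iprod (fun i => 1 - X ^ (c * (i + 1))) = baseGF LP c := by
  have h1 : emb Pbar = ovGF (fun _ l => msWeight (fun _ _ => (1 : LP)) (resid c l)) := by
    rw [Pbar_eq_ovGF, emb, map_ovGF]
    ext1 n
    simp [ovGF, msWeight, ovMulWeight]
  rw [h1, ovGF_msWeight hc (fun _ => rfl), mul_assoc, ← iprod_mul]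
  · have : ∀ i : ℕ, partSeries (c * (i + 1)) (fun _ => (1 : LP)) * (1 - X ^ (c * (i + 1))) = 1 := by
      intro i
      have := partSeries_pow_mul (i := c * (i + 1)) (by positivity) (1 : LP)
      simpa using this
    simp only [this]
    rw [iprod_eq_prod (N := 0) (by simp) (by simp)]
    simp
  · exact fun i => X_pow_dvd_partSeries_mul hc i rfl
  · intro i; simpa using X_pow_dvd_one_sub_mul (R := LP) hc 1 i

theorem zT_one_mul_zT_neg_one : zT 1 * zT (-1) = 1 := by rw [← zT_add]; simp [zT_zero]

/-- Garvan's product. Partitions without ones, together with the correction at `{1}`, give Euler's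
sum; those with ones give the q-binomial sum without its term at index zero, and the value of
Euler's sum supplies that missing term. -/
theorem crankGF_mul {c : ℕ} (hc : 0 < c) :
    crankGF c * (iprod (fun i => 1 - zT 1 * X ^ (c * (i + 1))) *
      iprod fun i => 1 - zT (-1) * X ^ (c * (i + 1))) =
    emb Pbar * (iprod (fun i => 1 - X ^ (c * (i + 1))) * iprod (fun i => 1 - X ^ (c * (i + 1)))) := by
  set tI := iprod (fun i => 1 - zT 1 * X ^ (c * (i + 1)) : ℕ → LP⟦X⟧)
  set wI := iprod (fun i => 1 - zT (-1) * X ^ (c * (i + 1)) : ℕ → LP⟦X⟧)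
  set B := baseGF LP c
  set ε : ℕ → LP⟦X⟧ := hyp (fun _ => 1) (fun i => 1 - X ^ (c * (i + 1))) with hε
  set r : ℕ → LP⟦X⟧ := hyp (fun i => 1 - zT 1 * X ^ (c * (i + 1))) (fun i => 1 - X ^ (c * (i + 1)))
    with hr
  have hE : (qsum fun s => (zT 1 * X ^ c) ^ s * ε s) * tI = 1 := euler_sum hc _
  have hU : (qsum fun s => (zT (-1) * X ^ c) ^ s * r s) * wI = iprod fun i => 1 - X ^ (c * (i + 2)) :=
    qbinomial_sum hc zT_one_mul_zT_neg_one
  have hεs : ∀ s, ε (s + 1) * (1 - X ^ (c * (s + 1))) = ε s := fun s => by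
    rw [hε, hyp_succ_mul (isUnit_one_sub_X_pow_mul hc), mul_one]
  have hzp : ∀ s : ℕ, zT ((s : ℤ) + 1) = zT 1 ^ (s + 1) := fun s => by
    rw [zT_pow]; push_cast; ring_nf
  have hwp : ∀ s : ℕ, zT (-((s : ℤ) + 1)) = zT (-1) ^ (s + 1) := fun s => by
    rw [zT_pow]; push_cast; ring_nf
  -- The convention for `{1}` supplies exactly what is needed to complete the terms `s = 0` and `s =
  -- 1` of Euler's sum.
  have hA : onesGF c 0 (bCut 0) + (qsum fun s : ℕ => zT (s + 1) *
      (onesGF c 0 (bCut (s + 1)) - onesGF c 0 (bCut s))) + (zT 1 - 1) * onesGF c 1 bOne =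
      B * ((1 - X ^ c) * qsum fun s => (zT 1 * X ^ c) ^ s * ε s) := by
    have hadm := adm_mul_pow (zT 1) hc ε
    have hadm2 : Adm fun s : ℕ => zT (s + 1) *
      (onesGF c 0 (bCut (s + 1)) - onesGF c 0 (bCut s)) := by
      intro s
      refine dvd_mul_of_dvd_right ?_ _
      rcases s with _ | s
      · simp
      · rw [onesGF_bCut_succ hc, onesGF_bCut_succ hc]
        change X ^ (s + 1) ∣ baseGF LP c * ((1 - X ^ c) * ε (s + 1 + 1)) -
          baseGF LP c * ((1 - X ^ c) * ε (s + 1))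
        rw [← hεs (s + 1)]
        refine ⟨baseGF LP c * ((1 - X ^ c) * ε (s + 1 + 1)) * X ^ (c * (s + 1 + 1) - (s + 1)), ?_⟩
        have h1 : s + 1 + 1 ≤ c * (s + 1 + 1) := Nat.le_mul_of_pos_left _ hc
        obtain ⟨d, hd⟩ : ∃ d, c * (s + 1 + 1) = (s + 1) + d := ⟨c * (s + 1 + 1) - (s + 1), by omega⟩
        rw [hd, Nat.add_sub_cancel_left, pow_add]
        ring
    rw [qsum_succ hadm2, qsum_succ hadm, qsum_succ hadm.succ, onesGF_bOne hc, onesGF_bCut_zero hc,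
      onesGF_bCut_succ hc 0]
    have e1 : (qsum fun s : ℕ => zT (((s + 1 : ℕ) : ℤ) + 1) *
        (onesGF c 0 (bCut (s + 1 + 1)) - onesGF c 0 (bCut (s + 1)))) =
        B * ((1 - X ^ c) * qsum fun s => (zT 1 * X ^ c) ^ (s + 1 + 1) * ε (s + 1 + 1)) := by
      rw [qsum_mul_left hadm.succ.succ,
        qsum_mul_left (hadm.succ.succ.mul_left fun _ => (1 - X ^ c))]
      refine qsum_congr fun s => ?_
      rw [onesGF_bCut_succ hc, onesGF_bCut_succ hc, hzp]
      change _ * (B * (_ * ε (s + 1 + 1)) - B * (_ * ε (s + 1))) = _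
      rw [← hεs (s + 1)]
      ring
    have e2 : ε 1 * (1 - X ^ c) = 1 := by
      have := hεs 0
      rw [hε, hyp_zero] at this
      simpa using this
    have e3 : ε 0 = 1 := hyp_zero _ _
    rw [e1]
    change B + (_ * (B * (_ * ε (0 + 1)) - B) + _) + _ = _
    rw [e3, hzp]
    simp only [zero_add, pow_one, pow_zero, mul_one]
    linear_combination (B * zT 1 - B * zT 1 * X ^ c) * e2
  have hB : (qsum fun j : ℕ => zT (-(j + 1)) * onesGF c (j + 1) (bLarge (j + 1))) * tI =
      B * ((1 - X ^ c) * ((qsum fun s => (zT (-1) * X ^ c) ^ s * r s) - 1)) := by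
    have hadm := adm_mul_pow (zT (-1)) hc r
    have hadm2 : Adm fun j : ℕ => zT (-(j + 1)) * onesGF c (j + 1) (bLarge (j + 1)) := by
      intro j
      refine dvd_mul_of_dvd_right ?_ _
      have htI : IsUnit tI := isUnit_iprod (X_pow_dvd_one_sub_mul hc _)
      refine (IsUnit.dvd_mul_right htI).mp ?_
      rw [onesGF_bLarge hc j, mul_comm (baseGF LP c), mul_assoc]
      refine dvd_mul_of_dvd_left (pow_dvd_pow _ ?_) _
      exact (Nat.le_succ j).trans (Nat.le_mul_of_pos_left _ hc)
    have e0 : (zT (-1) * X ^ c) ^ 0 * r 0 = 1 := by rw [hr, hyp_zero]; simp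
    rw [qsum_mul_right hadm2, qsum_succ hadm, e0, add_sub_cancel_left,
      qsum_mul_left hadm.succ, qsum_mul_left (hadm.succ.mul_left fun _ => (1 - X ^ c))]
    refine qsum_congr fun j => ?_
    rw [mul_assoc, onesGF_bLarge hc, hwp]
    ring
  have hI : iprod (fun i => 1 - X ^ (c * (i + 1)) : ℕ → LP⟦X⟧) =
      (1 - X ^ c) * iprod fun i => 1 - X ^ (c * (i + 2)) := by
    rw [iprod_succ (fun i => by simpa using X_pow_dvd_one_sub_mul (R := LP) hc 1 i)]
    simp [add_assoc]
  have hfin : crankGF c * tI = B * ((1 - X ^ c) * qsum fun s => (zT (-1) * X ^ c) ^ s * r s) := by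
    rw [crankGF_eq hc]
    linear_combination tI * hA + hB + (B * (1 - X ^ c)) * hE
  rw [← mul_assoc (emb Pbar), baseGF_eq hc, ← mul_assoc, hfin, hI]
  linear_combination (B * (1 - X ^ c)) * hU

end CrankSeries

/-! ### Logarithmic derivatives of theta products -/

section Theta

/-- The product `∏_{i ≥ 1} (1 - z q^{ci}) (1 - z⁻¹ q^{ci})`. -/
def thetaP (c : ℕ) : LP⟦X⟧ :=
  iprod (fun i => 1 - zT 1 * X ^ (c * (i + 1))) * iprod fun i => 1 - zT (-1) * X ^ (c * (i + 1))

theorem X_pow_dvd_deltaZ {F : LP⟦X⟧} {N : ℕ} (h : X ^ N ∣ F) : X ^ N ∣ deltaZ F := by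
  obtain ⟨G, rfl⟩ := h
  have : deltaZ (X ^ N * G) = X ^ N * deltaZ G := by
    rw [← emb_X, ← map_pow, deltaZ_emb_mul]
  rw [this]; exact dvd_mul_right _ _

theorem deltaZ_iprod {u κ : ℕ → LP⟦X⟧} (hu : ∀ i, X ^ (i + 1) ∣ u i - 1)
    (hκ : ∀ i, X ^ i ∣ κ i) (h : ∀ i, deltaZ (u i) = κ i * u i) :
    deltaZ (iprod u) = qsum κ * iprod u := by
  refine eq_of_forall_X_pow_dvd_sub fun N => ?_
  have h1 : deltaZ (∏ i ∈ Finset.range N, u i) =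
      (∑ i ∈ Finset.range N, κ i) * ∏ i ∈ Finset.range N, u i := by
    induction N with
    | zero =>
      have : deltaZ 1 = 0 := by rw [← map_one emb, deltaZ_emb]
      simpa using this
    | succ N ih =>
      rw [Finset.prod_range_succ, deltaZ_mul, ih, h, Finset.sum_range_succ]
      ring
  have h2 := (pow_dvd_pow X (Nat.le_succ N)).trans (X_pow_dvd_iprod_sub hu N)
  have h3 := X_pow_dvd_deltaZ h2
  rw [map_sub, h1] at h3
  have h4 := dvd_mul_sub_mul (X_pow_dvd_qsum_sub hκ N) h2
  have := dvd_sub h3 h4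
  simpa using this

/-- Geometric series show that `-zdiff a` is the logarithmic `δ_z`-derivative of `(1 - z q^a)(1 -
z⁻¹ q^a)`. -/
theorem zdiff_mul {a : ℕ} (ha : 0 < a) :
    zdiff a * ((1 - zT 1 * X ^ a) * (1 - zT (-1) * X ^ a)) = (zT 1 - zT (-1)) * X ^ a := by
  have hgeo : ∀ y : LP⟦X⟧, (qsum fun j => (y * X ^ a) ^ (j + 1)) * (1 - y * X ^ a) = y * X ^ a := by
    intro y
    have hadm : Adm fun j => (y * X ^ a) ^ (j + 1) := fun j => by
      change X ^ j ∣ (y * X ^ a) ^ (j + 1)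
      rw [mul_pow, ← pow_mul]
      exact dvd_mul_of_dvd_right (pow_dvd_pow _ (by nlinarith)) _
    rw [qsum_mul_right hadm]
    have := qsum_telescope hadm
    rw [zero_add, pow_one] at this
    refine Eq.trans ?_ this
    exact qsum_congr fun j => by ring
  have hz : zdiff a = (qsum fun j => (zT 1 * X ^ a) ^ (j + 1)) -
      qsum fun j => (zT (-1) * X ^ a) ^ (j + 1) := by
    rw [← qsum_sub, zdiff]
    refine qsum_congr fun j => ?_
    rw [mul_pow, mul_pow, zT_pow, zT_pow, ← pow_mul]
    push_cast
    rw [mul_one, mul_neg_one]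
    ring
  rw [hz]
  linear_combination (1 - zT (-1) * X ^ a) * hgeo (zT 1) - (1 - zT 1 * X ^ a) * hgeo (zT (-1))

/-- `∑_{n ≥ 1} ∑_{m ≥ 1} q^{c n m} (z^m - z^{-m})`. -/
def kap (c : ℕ) : LP⟦X⟧ := qsum fun i => zdiff (c * (i + 1))

theorem X_pow_dvd_zdiff {a : ℕ} : X ^ a ∣ zdiff a :=
  X_pow_dvd_qsum fun j => dvd_mul_of_dvd_left (pow_dvd_pow _ (by nlinarith)) _

theorem adm_kap {c : ℕ} (hc : 0 < c) : Adm fun i => zdiff (c * (i + 1)) := fun i =>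
  (pow_dvd_pow _ ((Nat.le_succ i).trans (Nat.le_mul_of_pos_left _ hc))).trans X_pow_dvd_zdiff

theorem deltaZ_thetaP {c : ℕ} (hc : 0 < c) : deltaZ (thetaP c) = -kap c * thetaP c := by
  have hu := fun i => X_pow_dvd_mul_sub_one (X_pow_dvd_one_sub_mul hc (zT 1) i)
    (X_pow_dvd_one_sub_mul hc (zT (-1)) i)
  rw [thetaP, ← iprod_mul (X_pow_dvd_one_sub_mul hc _) (X_pow_dvd_one_sub_mul hc _),
    deltaZ_iprod (κ := fun i => -zdiff (c * (i + 1))) hu]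
  · congr 1
    rw [kap, ← zero_sub, ← qsum_zero, ← qsum_sub]
    exact qsum_congr fun i => by ring
  · exact fun i => (dvd_neg).mpr (adm_kap hc i)
  · intro i
    have h1 := zdiff_mul (a := c * (i + 1)) (by positivity)
    have h2 : deltaZ 1 = 0 := by rw [← map_one emb, deltaZ_emb]
    have h3 : ∀ m : ℤ, deltaZ (1 - zT m * X ^ (c * (i + 1))) =
        -emb (C (m : ℂ)) * zT m * X ^ (c * (i + 1)) := by
      intro m
      rw [map_sub, h2, ← emb_X, ← map_pow, mul_comm (zT m), deltaZ_emb_mul, deltaZ_zT]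
      ring
    rw [neg_mul, h1, deltaZ_mul, h3, h3]
    simp only [Int.cast_one, Int.cast_neg, map_one, map_neg]
    ring

theorem isUnit_thetaP {c : ℕ} (hc : 0 < c) : IsUnit (thetaP c) :=
  (isUnit_iprod (X_pow_dvd_one_sub_mul hc _)).mul (isUnit_iprod (X_pow_dvd_one_sub_mul hc _))

/-- The product formula has a right side free of `z`, so the logarithmic derivative of the crank
function is minus that of the theta product. -/
theorem deltaZ_crankGF {c : ℕ} (hc : 0 < c) : deltaZ (crankGF c) = kap c * crankGF c := by
  have h := congrArg deltaZ (crankGF_mul hc)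
  have e : ∃ a, emb Pbar * (iprod (fun i => 1 - X ^ (c * (i + 1))) *
      iprod (fun i => 1 - X ^ (c * (i + 1)))) = emb a := by
    refine ⟨Pbar * (iprod (fun i => 1 - X ^ (c * (i + 1))) *
      iprod (fun i => 1 - X ^ (c * (i + 1)))), ?_⟩
    simp [emb, map_iprod]
  obtain ⟨a, ha⟩ := e
  rw [ha, deltaZ_emb] at h
  change deltaZ (crankGF c * thetaP c) = 0 at h
  rw [deltaZ_mul, deltaZ_thetaP hc] at h
  refine (IsUnit.mul_left_inj (isUnit_thetaP hc)).mp ?_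
  linear_combination h

end Theta

end OverpartitionMoments

end

noncomputable section
namespace OverpartitionMoments
open PowerSeries

/-! ### Half-period shifts and uniqueness of theta-like series -/

section HalfShift

/-- The substitution `q ↦ q ^ d`. -/
def dil (d : ℕ) [NeZero d] : ℂ⟦X⟧ →+* ℂ⟦X⟧ := (expand d (NeZero.ne d) : ℂ⟦X⟧ →ₐ[ℂ] ℂ⟦X⟧)

variable {d : ℕ} [NeZero d]

theorem dil_X : dil d X = X ^ d := expand_X d (NeZero.ne d)

theorem dil_injective : Function.Injective (dil d) := fun a b h => by
  ext n
  have h1 : coeff (d * n) (dil d a) = coeff (d * n) (dil d b) := by rw [h]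
  simpa [dil, coeff_expand_mul] using h1

theorem X_pow_dvd_dil {a : ℂ⟦X⟧} {N : ℕ} (h : X ^ N ∣ a) : X ^ N ∣ dil d a := by
  obtain ⟨b, rfl⟩ := h
  rw [map_mul, map_pow, dil_X, ← pow_mul]
  exact dvd_mul_of_dvd_left (pow_dvd_pow _ (Nat.le_mul_of_pos_left _ (NeZero.pos d))) _

/-- `g` is the coefficient sequence in `z` of the result of replacing `q` by `q ^ d` and `z` by
`z q` in the series with coefficient sequence `f`. -/
def HalfShift (d : ℕ) [NeZero d] (f g : ℤ → ℂ⟦X⟧) : Prop :=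
  ∀ m : ℤ, X ^ (-m).toNat * g m = X ^ m.toNat * dil d (f m)

theorem HalfShift.add {f g f' g' : ℤ → ℂ⟦X⟧} (h : HalfShift d f g) (h' : HalfShift d f' g') :
    HalfShift d (fun m => f m + f' m) (fun m => g m + g' m) := fun m => by
  rw [map_add]; linear_combination h m + h' m

theorem HalfShift.mul_left {f g : ℤ → ℂ⟦X⟧} (h : HalfShift d f g) (a : ℂ⟦X⟧) :
    HalfShift d (fun m => a * f m) (fun m => dil d a * g m) := fun m => by
  rw [map_mul]; linear_combination dil d a * h m

/-- The monomial `z^k q^n` becomes `z^k q^(dn + k)`; the hypothesis states that this exponent is a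
natural number. -/
theorem HalfShift.translate {f g : ℤ → ℂ⟦X⟧} (h : HalfShift d f g) (k : ℤ) {n N : ℕ}
    (hN : (N : ℤ) = d * n + k) :
    HalfShift d (fun m => X ^ n * f (m - k)) (fun m => X ^ N * g (m - k)) := fun m => by
  have h1 := h (m - k)
  refine mul_left_cancel₀ (pow_ne_zero (-(m - k)).toNat (X_ne_zero (R := ℂ))) ?_
  have h2 : (m - k).toNat + (-m).toNat + N = m.toNat + d * n + (-(m - k)).toNat := by
    zify
    generalize (d : ℤ) * n = e at *
    omega
  have h3 : (X : ℂ⟦X⟧) ^ (m - k).toNat * X ^ (-m).toNat * X ^ N =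
      X ^ m.toNat * X ^ (d * n) * X ^ (-(m - k)).toNat := by
    rw [← pow_add, ← pow_add, ← pow_add, ← pow_add, h2]
  rw [map_mul, map_pow, dil_X, ← pow_mul]
  linear_combination X ^ (-m).toNat * X ^ N * h1 + dil d (f (m - k)) * h3

/-- `B` is obtained from `A` by replacing `q` by `q ^ d` and `z` by `z q`. -/
def ShiftsTo (d : ℕ) [NeZero d] (A B : LP⟦X⟧) : Prop :=
  HalfShift d (fun m => co m A) (fun m => co m B)

theorem ShiftsTo.add {A B A' B' : LP⟦X⟧} (h : ShiftsTo d A B) (h' : ShiftsTo d A' B') :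
    ShiftsTo d (A + A') (B + B') := fun m => by
  simpa only [map_add] using HalfShift.add h h' m

theorem ShiftsTo.monomial {A B : LP⟦X⟧} (h : ShiftsTo d A B) (k : ℤ) {n N : ℕ}
    (hN : (N : ℤ) = d * n + k) :
    ShiftsTo d (zT k * X ^ n * A) (zT k * X ^ N * B) := fun m => by
  simpa only [mul_assoc, co_zT_mul, co_X_pow_mul] using HalfShift.translate h k hN m

theorem ShiftsTo.one : ShiftsTo d 1 1 := fun m => by
  simp only [co_one]
  split_ifs with h
  · simp [h]
  · simp

theorem ShiftsTo.neg {A B : LP⟦X⟧} (h : ShiftsTo d A B) : ShiftsTo d (-A) (-B) := fun m => by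
  have := h m
  simp only [map_neg, mul_neg] at *
  rw [this]

theorem ShiftsTo.one_add {A B : LP⟦X⟧} (h : ShiftsTo d A B) (k : ℤ) {n N : ℕ}
    (hN : (N : ℤ) = d * n + k) :
    ShiftsTo d ((1 + zT k * X ^ n) * A) ((1 + zT k * X ^ N) * B) := by
  rw [add_mul, add_mul, one_mul, one_mul]
  exact h.add (h.monomial k hN)

theorem ShiftsTo.one_sub {A B : LP⟦X⟧} (h : ShiftsTo d A B) (k : ℤ) {n N : ℕ}
    (hN : (N : ℤ) = d * n + k) :
    ShiftsTo d ((1 - zT k * X ^ n) * A) ((1 - zT k * X ^ N) * B) := by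
  rw [sub_mul, sub_mul, one_mul, one_mul, sub_eq_add_neg, sub_eq_add_neg]
  exact h.add (h.monomial k hN).neg

theorem ShiftsTo.of_limit {A B : LP⟦X⟧} {A' B' : ℕ → LP⟦X⟧} (hA : ∀ N, X ^ N ∣ A - A' N)
    (hB : ∀ N, X ^ N ∣ B - B' N) (h : ∀ N, ShiftsTo d (A' N) (B' N)) : ShiftsTo d A B := fun m =>
  eq_of_forall_X_pow_dvd_sub fun N => by
    have h1 := dvd_mul_of_dvd_right (X_pow_dvd_co (hB N) m) (X ^ (-m).toNat)
    have h2 := dvd_mul_of_dvd_right (X_pow_dvd_dil (d := d) (X_pow_dvd_co (hA N) m)) (X ^ m.toNat)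
    have h3 := dvd_sub h1 h2
    rw [map_sub, map_sub, map_sub] at h3
    convert! h3 using 1
    have := h N m
    simp only at this
    linear_combination this

theorem ShiftsTo.iprod {A B : LP⟦X⟧} (h : ShiftsTo d A B) {u v : ℕ → LP⟦X⟧}
    (hu : ∀ i, X ^ (i + 1) ∣ u i - 1) (hv : ∀ i, X ^ (i + 1) ∣ v i - 1)
    (huv : ∀ i A B, ShiftsTo d A B → ShiftsTo d (u i * A) (v i * B)) :
    ShiftsTo d (iprod u * A) (iprod v * B) := by
  refine ShiftsTo.of_limit (A' := fun N => (∏ i ∈ Finset.range N, u i) * A)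
    (B' := fun N => (∏ i ∈ Finset.range N, v i) * B) (fun N => ?_) (fun N => ?_) fun N => ?_
  · rw [← sub_mul]
    exact dvd_mul_of_dvd_left ((pow_dvd_pow X (Nat.le_succ N)).trans (X_pow_dvd_iprod_sub hu N)) _
  · rw [← sub_mul]
    exact dvd_mul_of_dvd_left ((pow_dvd_pow X (Nat.le_succ N)).trans (X_pow_dvd_iprod_sub hv N)) _
  · induction N with
    | zero => simpa using h
    | succ N ih =>
      rw [Finset.prod_range_succ_comm, Finset.prod_range_succ_comm, mul_assoc, mul_assoc]
      exact huv N _ _ ih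

/-- Series in `z` with the transformation behaviour of a theta function of degree `3` under
`z ↦ z⁻¹` and `z ↦ z q ^ c`, where `c d = 2`. -/
def ThetaLike (d : ℕ) [NeZero d] (F : LP⟦X⟧) : Prop :=
  (∀ m, co (-m) F = co (m + 3) F) ∧
    ∃ H : LP⟦X⟧, (∀ m, co (d - m) H = co m H) ∧ ShiftsTo d F H

/-- The shifted coefficient is `q^m f_m(q^d)`, so the reflection symmetry of the shifted series ties
`f_{d-m}` to `f_m` by a power of `q` common to `F` and `G`. Cancelling it, and undoing `q ↦ q^d`,
transports a proportionality from `m` to `d - m`. -/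
theorem ThetaLike.proportional_step {F G : LP⟦X⟧} (hF : ThetaLike d F) (hG : ThetaLike d G)
    {a b : ℂ⟦X⟧} {m : ℤ} (h : a * co m F = b * co m G) : a * co (d - m) F = b * co (d - m) G := by
  obtain ⟨-, H, hH, hF⟩ := hF
  obtain ⟨-, K, hK, hG⟩ := hG
  have f1 := hF m
  have f2 := hF (d - m)
  have g1 := hG m
  have g2 := hG (d - m)
  simp only [hH, hK] at f1 f2 g1 g2
  have h' : dil d a * dil d (co m F) = dil d b * dil d (co m G) := by
    rw [← map_mul, h, map_mul]
  apply dil_injective (d := d)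
  rw [map_mul, map_mul]
  refine mul_left_cancel₀ (mul_ne_zero (pow_ne_zero (-m).toNat (X_ne_zero (R := ℂ)))
    (pow_ne_zero (d - m).toNat (X_ne_zero (R := ℂ)))) ?_
  linear_combination (-dil d a * X ^ (-m).toNat) * f2 + (dil d b * X ^ (-m).toNat) * g2 +
    X ^ (-(d - m)).toNat * (dil d a * f1 - dil d b * g1 + X ^ m.toNat * h')

/-- The reflections `m ↦ d - m` and `m ↦ 3 - m` compose to translation by `3 - d`. For `d = 2` this
is translation by one; for `d = 1` it is by two, and the reflection of `1` to `0` covers the other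
class. In both cases the coefficient at `1` determines all others. -/
theorem ThetaLike.proportional (hd : d = 1 ∨ d = 2) {F G : LP⟦X⟧} (hF : ThetaLike d F)
    (hG : ThetaLike d G) : emb (co 1 G) * F = emb (co 1 F) * G := by
  refine ext_co fun m => ?_
  rw [co_emb_mul, co_emb_mul]
  have s1 : ∀ m, co 1 G * co m F = co 1 F * co m G →
      co 1 G * co (d - m) F = co 1 F * co (d - m) G :=
    fun m h => hF.proportional_step hG h
  have s2 : ∀ m, co 1 G * co m F = co 1 F * co m G →
      co 1 G * co (3 - m) F = co 1 F * co (3 - m) G := fun m h => by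
    have e1 := hF.1 (-m)
    have e2 := hG.1 (-m)
    rw [neg_neg, show -m + 3 = 3 - m by ring] at e1 e2
    rw [← e1, ← e2, h]
  have hup : ∀ m, co 1 G * co m F = co 1 F * co m G →
      co 1 G * co (m + (3 - d)) F = co 1 F * co (m + (3 - d)) G := fun m h => by
    have := s2 _ (s1 m h)
    rwa [show 3 - ((d : ℤ) - m) = m + (3 - d) by ring] at this
  have hdown : ∀ m, co 1 G * co m F = co 1 F * co m G →
      co 1 G * co (m - (3 - d)) F = co 1 F * co (m - (3 - d)) G := fun m h => by
    have := s1 _ (s2 m h)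
    rwa [show (d : ℤ) - (3 - m) = m - (3 - d) by ring] at this
  have h1 : co 1 G * co 1 F = co 1 F * co 1 G := mul_comm _ _
  rcases hd with rfl | rfl
  · have h0 := s1 1 h1
    norm_num at h0 hup hdown
    have key : ∀ k : ℤ, (co 1 G * co (2 * k) F = co 1 F * co (2 * k) G) ∧
        (co 1 G * co (2 * k + 1) F = co 1 F * co (2 * k + 1) G) := by
      intro k
      induction k using Int.induction_on with
      | zero => exact ⟨by simpa using h0, by simpa using h1⟩
      | succ k ih =>
        rw [show 2 * ((k : ℤ) + 1) = 2 * k + 2 by ring, show 2 * (k : ℤ) + 2 + 1 = 2 * k + 1 + 2 by ring]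
        exact ⟨hup _ ih.1, hup _ ih.2⟩
      | pred k ih =>
        rw [show 2 * (-(k : ℤ) - 1) = 2 * (-k) - 2 by ring,
          show 2 * (-(k : ℤ)) - 2 + 1 = 2 * (-k) + 1 - 2 by ring]
        exact ⟨hdown _ ih.1, hdown _ ih.2⟩
    rcases Int.even_or_odd' m with ⟨k, rfl | rfl⟩
    exacts [(key k).1, (key k).2]
  · norm_num at hup hdown
    have key : ∀ k : ℤ, co 1 G * co (k + 1) F = co 1 F * co (k + 1) G := by
      intro k
      induction k using Int.induction_on with
      | zero => simpa using h1
      | succ k ih => exact hup _ ih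
      | pred k ih =>
        have := hdown _ ih
        rwa [show -(k : ℤ) + 1 - 1 = -k - 1 + 1 by ring] at this
    have := key (m - 1)
    rwa [sub_add_cancel] at this

end HalfShift

end OverpartitionMoments

end

noncomputable section
namespace OverpartitionMoments
open PowerSeries

/-! ### The logarithmic derivative of `P̄` and partial theta series -/

section LogDerivative

/-- The logarithmic derivative `δ_q P̄ / P̄`. -/
def phi : ℂ⟦X⟧ := deltaQ Pbar * Ring.inverse Pbar

theorem phi_mul_Pbar : phi * Pbar = deltaQ Pbar := by
  rw [phi, mul_assoc, Ring.inverse_mul_cancel _ isUnit_Pbar, mul_one]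

theorem deltaQ_C (a : ℂ) : deltaQ (C a) = 0 := by simp [deltaQ]

theorem deltaQ_one : deltaQ 1 = 0 := by simp [deltaQ]

theorem deltaQ_natCast (n : ℕ) : deltaQ (n : ℂ⟦X⟧) = 0 := by simp [deltaQ]

theorem deltaQ_neg (F : ℂ⟦X⟧) : deltaQ (-F) = -deltaQ F := by simp [deltaQ]

theorem deltaQ_sub (F G : ℂ⟦X⟧) : deltaQ (F - G) = deltaQ F - deltaQ G := by
  simp [deltaQ, mul_sub]

theorem deltaQ_X_pow (n : ℕ) : deltaQ (X ^ n) = (n : ℂ⟦X⟧) * X ^ n := by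
  ext k
  rw [coeff_deltaQ, ← map_natCast (C (R := ℂ)), coeff_C_mul, coeff_X_pow]
  split_ifs with h <;> simp [h]

theorem vser_zero (c : ℕ) : vser c 0 = vser 1 0 := by simp [vser]

theorem Pbar_mul_one_sub_vser (c : ℕ) : Pbar * (1 - 2 * vser c 0) = 1 := by
  rw [vser_zero]
  exact rankForm_rankGF.gauss one_pos (ev1_statGF _)

/-- Gauss's identity, differentiated. -/
theorem two_mul_deltaQ_vser_zero (c : ℕ) : 2 * (deltaQ (vser c 0) + phi * vser c 0) = phi := by
  have h := congrArg deltaQ (Pbar_mul_one_sub_vser c)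
  rw [deltaQ_mul, deltaQ_sub, deltaQ_one, show (2 : ℂ⟦X⟧) = ((2 : ℕ) : ℂ⟦X⟧) by norm_num,
    deltaQ_mul, deltaQ_natCast, ← phi_mul_Pbar] at h
  push_cast at h
  refine (IsUnit.mul_left_inj isUnit_Pbar).mp ?_
  linear_combination -h

/-- Shifting the summation index of the partial theta series by one completes the square, because `d
c = 2`. -/
theorem vser_step {c d : ℕ} (hcd : d * c = 2) (M : ℕ) :
    X ^ (1 + c * M) * vser c (M + d) = X ^ (1 + c * M) - vser c M := by
  rw [eq_sub_iff_add_eq]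
  conv_lhs => rw [vser, vser, qsum_succ (adm_vser c M), qsum_mul_left (adm_vser c (M + d))]
  rw [add_left_comm, ← qsum_add]
  have : (fun s => X ^ (1 + c * M) * ((-1) ^ s * X ^ ((s + 1) ^ 2 + c * (s + 1) * (M + d))) +
      (-1) ^ (s + 1) * X ^ ((s + 1 + 1) ^ 2 + c * (s + 1 + 1) * M)) = fun _ => (0 : ℂ⟦X⟧) := by
    funext s
    have : (s + 1 + 1) ^ 2 + c * (s + 1 + 1) * M =
        1 + c * M + ((s + 1) ^ 2 + c * (s + 1) * (M + d)) := by
      linear_combination (s + 1) * hcd.symm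
    rw [this, pow_add _ (1 + c * M)]
    ring
  rw [this, qsum_zero]
  simp

end LogDerivative

/-! ### The heat operator applied to the Appell-type series -/

section Omega

variable (c d : ℕ)

/-- The operator `m² + d² δ_q + d² φ` applied to the `m`-th coefficient of the series `psi0`. -/
def vop (M : ℕ) : ℂ⟦X⟧ :=
  (M : ℂ⟦X⟧) ^ 2 * vser c M + (d : ℂ⟦X⟧) ^ 2 * (deltaQ (vser c M) + phi * vser c M)

/-- The complement of `vop` in the value of the operator at `1`. -/
def wop (M : ℕ) : ℂ⟦X⟧ := (M : ℂ⟦X⟧) ^ 2 + (d : ℂ⟦X⟧) ^ 2 * phi - vop c d M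

theorem two_mul_vop_zero : 2 * vop c d 0 = (d : ℂ⟦X⟧) ^ 2 * phi := by
  rw [vop]
  linear_combination (d : ℂ⟦X⟧) ^ 2 * two_mul_deltaQ_vser_zero c

theorem wop_zero : wop c d 0 = vop c d 0 := by
  rw [wop, ← two_mul_vop_zero]; push_cast; ring

/-- The heat operator respects `vser_step`: on `z^M q^(1 + cM)` its eigenvalue is `M² + d²(1 + cM) =
(M + d)²`, by `d c = 2`. -/
theorem vop_eq (hcd : d * c = 2) (M : ℕ) : vop c d M = X ^ (1 + c * M) * wop c d (M + d) := by
  have h := vser_step hcd M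
  have hδ := congrArg deltaQ h
  rw [deltaQ_mul, deltaQ_sub, deltaQ_X_pow] at hδ
  have hcd' : (d : ℂ⟦X⟧) * c = 2 := by
    rw [← Nat.cast_mul, hcd, Nat.cast_ofNat]
  rw [wop, vop, vop]
  push_cast at hδ ⊢
  linear_combination ((M : ℂ⟦X⟧) ^ 2 + (d : ℂ⟦X⟧) ^ 2 * phi) * h + (d : ℂ⟦X⟧) ^ 2 * hδ
    + (X ^ (1 + c * M) * (1 - vser c (M + d)) * d * M) * hcd'

/-- The series `(δ_z² + d² δ_q + d² φ) Ψ`. -/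
def omegaS : LP⟦X⟧ :=
  deltaZ (deltaZ (psi0 c)) + emb ((d : ℂ⟦X⟧) ^ 2) * (deltaQL (psi0 c) + emb phi * psi0 c)

theorem co_omegaS (hc : 0 < c) (m : ℤ) :
    co m (omegaS c d) = if m = 0 then 0 else -C (m.sign : ℂ) * vop c d m.natAbs := by
  rw [omegaS, map_add, co_deltaZ, co_deltaZ, co_emb_mul, map_add, co_deltaQL, co_emb_mul,
    co_psi0 hc]
  split_ifs with h
  · simp [deltaQ_zero]
  · have : (C (m : ℂ)) ^ 2 = (m.natAbs : ℂ⟦X⟧) ^ 2 := by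
      have h0 := congrArg (Int.cast : ℤ → ℂ⟦X⟧) (Int.natAbs_sq m)
      rw [Int.cast_pow, Int.cast_natCast, Int.cast_pow] at h0
      rw [h0, ← map_intCast (C (R := ℂ))]
    rw [vop, ← this, deltaQ_mul, deltaQ_neg, deltaQ_C]
    ring

theorem co_omegaS_neg (hc : 0 < c) (m : ℤ) : co (-m) (omegaS c d) = -co m (omegaS c d) := by
  rw [co_omegaS c d hc, co_omegaS c d hc]
  by_cases h : m = 0
  · simp [h]
  · simp [h]

/-- The image of the rank generating function under the heat-type operator, divided by `P̄ / 2`. -/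
def yser : LP⟦X⟧ :=
  2 * (zT 1 * (1 + zT 1)) + emb ((d : ℂ⟦X⟧) ^ 2 * phi) * ((1 + zT 1) * (1 - zT 1) ^ 2) +
    2 * (1 - zT 1) ^ 3 * omegaS c d

theorem zT_one_pow (n : ℕ) : zT 1 ^ n = zT n := by rw [zT_pow, mul_one]

theorem co_yser (m : ℤ) : co m (yser c d) =
    (2 * ((if m = 1 then 1 else 0) + (if m = 2 then 1 else 0)) + ((d : ℂ⟦X⟧) ^ 2 * phi) *
      ((if m = 0 then 1 else 0) - (if m = 1 then 1 else 0) - (if m = 2 then 1 else 0) +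
        (if m = 3 then 1 else 0))) +
    2 * (co m (omegaS c d) - 3 * co (m - 1) (omegaS c d) + 3 * co (m - 2) (omegaS c d) -
      co (m - 3) (omegaS c d)) := by
  have h : yser c d = emb 2 * (zT 1 + zT 2) +
      emb ((d : ℂ⟦X⟧) ^ 2 * phi) * (1 - zT 1 - zT 2 + zT 3) + emb 2 * (omegaS c d -
        emb 3 * (zT 1 * omegaS c d) + emb 3 * (zT 2 * omegaS c d) - zT 3 * omegaS c d) := by
    rw [yser, map_ofNat, map_ofNat, show zT 2 = zT 1 ^ 2 from (zT_one_pow 2).symm,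
      show zT 3 = zT 1 ^ 3 from (zT_one_pow 3).symm]
    ring
  rw [h]
  simp only [map_add, map_sub, co_emb_mul, co_zT_mul, co_zT, co_one]

theorem co_neg_yser (hc : 0 < c) (m : ℤ) : co (-m) (yser c d) = co (m + 3) (yser c d) := by
  rw [co_yser, co_yser, co_omegaS_neg c d hc, show -m - 1 = -(m + 1) by ring,
    show -m - 2 = -(m + 2) by ring, show -m - 3 = -(m + 3) by ring, co_omegaS_neg c d hc,
    co_omegaS_neg c d hc, co_omegaS_neg c d hc, show m + 3 - 1 = m + 2 by ring,
    show m + 3 - 2 = m + 1 by ring, show m + 3 - 3 = m by ring]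
  have e : ∀ a : ℤ, (if m + 3 = a then (1 : ℂ⟦X⟧) else 0) = if -m = 3 - a then 1 else 0 :=
    fun a => if_congr (by omega) rfl rfl
  rw [e, e, e, e]
  norm_num
  ring

/-- The regularization of the coefficients of `omegaS` which vanishes as `z → 0`. -/
def omegaPlus (m : ℤ) : ℂ⟦X⟧ := if 0 ≤ m then wop c d m.natAbs else vop c d m.natAbs

theorem two_mul_omegaPlus (hc : 0 < c) (m : ℤ) : 2 * omegaPlus c d m = 2 * co m (omegaS c d) +
    (if 0 < m then 2 * ((m : ℂ⟦X⟧) ^ 2 + (d : ℂ⟦X⟧) ^ 2 * phi) else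
      if m = 0 then (d : ℂ⟦X⟧) ^ 2 * phi else 0) := by
  rw [omegaPlus, co_omegaS c d hc]
  rcases lt_trichotomy m 0 with h | h | h
  · rw [if_neg (by omega), if_neg (by omega), if_neg (by omega), if_neg (by omega),
      Int.sign_eq_neg_one_of_neg h]
    simp
  · subst h
    simp [wop_zero, two_mul_vop_zero]
  · rw [if_pos (by omega), if_pos h, if_neg (by omega), Int.sign_eq_one_of_pos h, wop]
    lift m to ℕ using h.le
    simp
    ring

/-- Formally `yser = 2 (1 - z)³ Ω⁺`, where `Ω⁺` adds to `omegaS` the expansions in powers of `z` of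
`z(1 + z)/(1 - z)³` and `d² φ (1 + z) / (2 (1 - z))`. Such expansions are infinite in `z` at a fixed
power of `q`, so the identity is stated for coefficients. -/
theorem co_yser_eq (hc : 0 < c) (m : ℤ) : co m (yser c d) =
    2 * omegaPlus c d m - 3 * (2 * omegaPlus c d (m - 1)) + 3 * (2 * omegaPlus c d (m - 2)) -
      2 * omegaPlus c d (m - 3) := by
  rw [co_yser]
  simp only [two_mul_omegaPlus c d hc]
  rcases lt_or_ge m 0 with h | h
  · simp [show ¬ 0 < m by omega, show m ≠ 0 by omega, show m ≠ 1 by omega, show m ≠ 2 by omega,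
      show m ≠ 3 by omega, show ¬ 1 < m by omega, show ¬ 2 < m by omega, show ¬ 3 < m by omega,
      show m - 1 ≠ 0 by omega, show m - 2 ≠ 0 by omega, show m - 3 ≠ 0 by omega]
    ring
  rcases lt_or_ge m 4 with h' | h'
  · interval_cases m <;> norm_num <;> ring
  · simp [show 0 < m by omega, show m ≠ 0 by omega, show m ≠ 1 by omega, show m ≠ 2 by omega,
      show m ≠ 3 by omega, show 1 < m by omega, show 2 < m by omega, show 3 < m by omega]
    ring

/-- The coefficients of the half shift of the series with coefficients `omegaPlus`. -/
def halfCoeff [NeZero d] (m : ℤ) : ℂ⟦X⟧ :=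
  X ^ (max m (d - m)).toNat * dil d (wop c d (max m (d - m)).toNat)

theorem halfCoeff_symm [NeZero d] (m : ℤ) : halfCoeff c d (d - m) = halfCoeff c d m := by
  simp only [halfCoeff, sub_sub_cancel, max_comm]

/-- By `vop_eq` the coefficient at `-n` after the shift is the one at `n + d`, namely `q^(n+d)`
times `wop (n + d)` in `q^d`. This is the symmetry under `m ↦ d - m` built into `halfCoeff`. -/
theorem halfShift_omegaPlus [NeZero d] (hcd : d * c = 2) :
    HalfShift d (omegaPlus c d) (halfCoeff c d) := by
  have hd : d = 1 ∨ d = 2 := (Nat.dvd_prime Nat.prime_two).mp ⟨c, hcd.symm⟩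
  have hneg : ∀ n : ℕ, X ^ n * halfCoeff c d (-n) = dil d (vop c d n) := fun n => by
    have h1 : (max (-(n : ℤ)) (d - -n)).toNat = n + d := by omega
    rw [halfCoeff, h1, vop_eq c d hcd, map_mul, map_pow, dil_X, ← mul_assoc, ← pow_add, ← pow_mul]
    congr 2
    linear_combination n * hcd.symm
  intro m
  rcases lt_trichotomy m 0 with h | h | h
  · obtain ⟨n, rfl⟩ : ∃ n : ℕ, m = -n := ⟨m.natAbs, by omega⟩
    rw [neg_neg, Int.toNat_natCast, hneg, omegaPlus, if_neg (by omega)]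
    simp
  · subst h
    have := hneg 0
    simp only [Nat.cast_zero, neg_zero] at this
    simp [omegaPlus, wop_zero, ← this]
  · have h1 : (max m (d - m)).toNat = m.natAbs := by omega
    have h2 : m.toNat = m.natAbs := by omega
    have h3 : (-m).toNat = 0 := by omega
    rw [halfCoeff, h1, h2, h3, omegaPlus, if_pos h.le, pow_zero, one_mul]

/-- The series with prescribed coefficients in `z`. -/
def ofCo (f : ℤ → ℂ⟦X⟧) : LP⟦X⟧ := mk fun n =>
  ∑ m ∈ Finset.Icc (-(n : ℤ)) n, LaurentPolynomial.C (coeff n (f m)) * LaurentPolynomial.T m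

theorem co_ofCo {f : ℤ → ℂ⟦X⟧} (hf : ∀ m, X ^ m.natAbs ∣ f m) (m : ℤ) : co m (ofCo f) = f m := by
  ext n
  rw [coeff_co, ofCo, coeff_mk, AddMonoidAlgebra.coeff_sum, Finsupp.finsetSum_apply]
  simp only [LP.coeff_C_mul, LaurentPolynomial.T_apply, mul_ite, mul_one, mul_zero]
  rw [Finset.sum_ite_eq']
  split_ifs with h
  · rfl
  · rw [Finset.mem_Icc, not_and_or] at h
    exact (X_pow_dvd_iff.mp (hf m) n (by omega)).symm

theorem shiftsTo_yser [NeZero d] (hcd : d * c = 2) : ShiftsTo d (yser c d)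
    (2 * (1 - zT 1 * X) ^ 3 * ofCo (halfCoeff c d)) := by
  have hc : 0 < c := Nat.pos_of_ne_zero fun h => by simp [h] at hcd
  -- Unlike those of `omegaPlus`, the shifted coefficients are divisible by `X ^ |m|`, so they come
  -- from an actual series.
  have hA : ∀ m, co m (ofCo (halfCoeff c d)) = halfCoeff c d m := co_ofCo fun m =>
    dvd_mul_of_dvd_left (pow_dvd_pow _ (by omega)) _
  have h := (halfShift_omegaPlus c d hcd).mul_left 2
  have key := ((h.add ((h.translate 1 (n := 0) (N := 1) (by simp)).mul_left (-3))).add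
    ((h.translate 2 (n := 0) (N := 2) (by simp)).mul_left 3)).add
    ((h.translate 3 (n := 0) (N := 3) (by simp)).mul_left (-1))
  have e : 2 * (1 - zT 1 * X) ^ 3 * ofCo (halfCoeff c d) =
      emb 2 * (ofCo (halfCoeff c d) - emb 3 * (zT 1 * (X ^ 1 * ofCo (halfCoeff c d))) +
        emb 3 * (zT 2 * (X ^ 2 * ofCo (halfCoeff c d))) -
        zT 3 * (X ^ 3 * ofCo (halfCoeff c d))) := by
    rw [map_ofNat, map_ofNat, show zT 2 = zT 1 ^ 2 from (zT_one_pow 2).symm,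
      show zT 3 = zT 1 ^ 3 from (zT_one_pow 3).symm]
    ring
  intro m
  have := key m
  simp only [map_ofNat, map_neg, map_one] at this
  simp only [co_yser_eq c d hc, e, co_emb_mul, map_sub, map_add, co_zT_mul, co_X_pow_mul, hA]
  simp only [map_mul, map_add, map_neg, map_one, map_ofNat, pow_zero, one_mul] at this ⊢
  linear_combination this

end Omega

end OverpartitionMoments

end

noncomputable section
namespace OverpartitionMoments
open PowerSeries

/-! ### Theta products and the rank-crank equation up to a constant -/

section ThetaProducts

theorem zInv_zT (k : ℤ) : zInv (zT k) = zT (-k) := by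
  refine ext_co fun m => ?_
  rw [co_zInv, co_zT, co_zT]
  exact if_congr (by omega) rfl rfl

theorem zInv_X : zInv X = X := by simp [zInv]

theorem zInv_iprod (u : ℕ → LP⟦X⟧) : zInv (iprod u) = iprod fun i => zInv (u i) := map_iprod _ _

theorem zInv_one_sub (k : ℤ) (n : ℕ) : zInv (1 - zT k * X ^ n) = 1 - zT (-k) * X ^ n := by
  rw [map_sub, map_mul, map_pow, map_one, zInv_X, zInv_zT]

theorem zInv_one_add (k : ℤ) (n : ℕ) : zInv (1 + zT k * X ^ n) = 1 + zT (-k) * X ^ n := by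
  rw [map_add, map_mul, map_pow, map_one, zInv_X, zInv_zT]

theorem co_symm_iff (a : ℤ) (F : LP⟦X⟧) :
    (∀ m, co (a - m) F = co m F) ↔ zT a * zInv F = F := by
  refine ⟨fun h => ext_co fun m => ?_, fun h m => ?_⟩
  · rw [co_zT_mul, co_zInv, ← h m]; congr 1; ring_nf
  · conv_rhs => rw [← h]
    rw [co_zT_mul, co_zInv]; congr 1; ring_nf

theorem X_pow_dvd_one_sub_zT {k : ℤ} {i n : ℕ} (h : i + 1 ≤ n) :
    X ^ (i + 1) ∣ (1 - zT k * X ^ n) - 1 := by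
  rw [sub_sub_cancel_left, dvd_neg]
  exact dvd_mul_of_dvd_right (pow_dvd_pow _ h) _

theorem X_pow_dvd_one_add_zT {k : ℤ} {i n : ℕ} (h : i + 1 ≤ n) :
    X ^ (i + 1) ∣ (1 + zT k * X ^ n) - 1 := by
  rw [add_sub_cancel_left]
  exact dvd_mul_of_dvd_right (pow_dvd_pow _ h) _

theorem zInv_thetaP (c : ℕ) : zInv (thetaP c) = thetaP c := by
  rw [thetaP, map_mul, zInv_iprod, zInv_iprod, mul_comm]
  simp only [zInv_one_sub, neg_neg]

/-- `∏_{i ≥ 0} (1 - z q^{2 i + 1}) (1 - z⁻¹ q^{2 i + 1})`. -/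
def oddTheta : LP⟦X⟧ :=
  iprod (fun i => 1 - zT 1 * X ^ (2 * i + 1)) * iprod fun i => 1 - zT (-1) * X ^ (2 * i + 1)

theorem zInv_oddTheta : zInv oddTheta = oddTheta := by
  rw [oddTheta, map_mul, zInv_iprod, zInv_iprod, mul_comm]
  simp only [zInv_one_sub, neg_neg]

/-- The half shift of `thetaP`. -/
def shiftedTheta : LP⟦X⟧ :=
  iprod (fun i => 1 - zT 1 * X ^ (2 * (i + 1) + 1)) * iprod fun i => 1 - zT (-1) * X ^ (2 * i + 1)

theorem mul_shiftedTheta : (1 - zT 1 * X) * shiftedTheta = oddTheta := by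
  rw [oddTheta, iprod_succ (u := fun i => 1 - zT 1 * X ^ (2 * i + 1))
    (fun i => X_pow_dvd_one_sub_zT (by omega)), shiftedTheta, mul_zero, zero_add, pow_one, mul_assoc]

variable {c d : ℕ} [NeZero d]

theorem ShiftsTo.thetaP_mul (hcd : d * c = 2) {A B : LP⟦X⟧} (h : ShiftsTo d A B) :
    ShiftsTo d (thetaP c * A) (shiftedTheta * B) := by
  have hc : 0 < c := Nat.pos_of_ne_zero fun h => by simp [h] at hcd
  have hcd' : (d : ℤ) * c = 2 := by exact_mod_cast hcd
  have h2 : ∀ i : ℕ, i + 1 ≤ c * (i + 1) := fun i => Nat.le_mul_of_pos_left _ hc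
  rw [thetaP, shiftedTheta, mul_assoc, mul_assoc]
  refine ShiftsTo.iprod (ShiftsTo.iprod h ?_ ?_ fun i A B h => ?_) ?_ ?_ fun i A B h => ?_
  · exact fun i => X_pow_dvd_one_sub_zT (h2 i)
  · exact fun i => X_pow_dvd_one_sub_zT (by omega)
  · refine h.one_sub _ ?_
    push_cast
    linear_combination -((i : ℤ) + 1) * hcd'
  · exact fun i => X_pow_dvd_one_sub_zT (h2 i)
  · exact fun i => X_pow_dvd_one_sub_zT (by omega)
  · refine h.one_sub _ ?_
    push_cast
    linear_combination -((i : ℤ) + 1) * hcd'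

/-- Under the half shift `(1 - z)³` becomes `(1 - z q)³`. One factor completes each of the three
copies of `shiftedTheta` to `oddTheta`, which is invariant under `z ↦ z⁻¹`. -/
theorem thetaLike_yser (hcd : d * c = 2) : ThetaLike d (thetaP c ^ 3 * yser c d) := by
  have hc : 0 < c := Nat.pos_of_ne_zero fun h => by simp [h] at hcd
  constructor
  · have h1 : zT 3 * zInv (yser c d) = yser c d := (co_symm_iff 3 _).mp fun m => by
      have := co_neg_yser c d hc (-m)
      rw [neg_neg] at this
      rw [this]; congr 1; ring_nf
    have h2 : zT 3 * zInv (thetaP c ^ 3 * yser c d) = thetaP c ^ 3 * yser c d := by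
      rw [map_mul, map_pow, zInv_thetaP]
      linear_combination thetaP c ^ 3 * h1
    intro m
    have := (co_symm_iff 3 _).mpr h2 (-m)
    rw [← this]; congr 1; ring_nf
  · refine ⟨2 * oddTheta ^ 3 * ofCo (halfCoeff c d), ?_, ?_⟩
    · rw [co_symm_iff]
      have hA : ∀ m, co m (ofCo (halfCoeff c d)) = halfCoeff c d m := co_ofCo fun m =>
        dvd_mul_of_dvd_left (pow_dvd_pow _ (by omega)) _
      have h1 : zT d * zInv (ofCo (halfCoeff c d)) = ofCo (halfCoeff c d) :=
        (co_symm_iff d _).mp fun m => by rw [hA, hA, halfCoeff_symm]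
      rw [map_mul, map_mul, map_pow, zInv_oddTheta, map_ofNat]
      linear_combination 2 * oddTheta ^ 3 * h1
    · have h := (((shiftsTo_yser c d hcd).thetaP_mul hcd).thetaP_mul hcd).thetaP_mul hcd
      have e1 : thetaP c ^ 3 * yser c d = thetaP c * (thetaP c * (thetaP c * yser c d)) := by
        rw [pow_succ, pow_two, mul_assoc, mul_assoc]
      have e2 : ∀ s a : LP⟦X⟧, 2 * ((1 - zT 1 * X) * s) ^ 3 * a =
          s * (s * (s * (2 * (1 - zT 1 * X) ^ 3 * a))) := fun s a => by ring
      rw [← mul_shiftedTheta, e1, e2]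
      exact h

/-- `∏_{i ≥ 1} (1 + z q^i) (1 + z⁻¹ q^i)`. -/
def nProd : LP⟦X⟧ :=
  iprod (fun i => 1 + zT 1 * X ^ (i + 1)) * iprod fun i => 1 + zT (-1) * X ^ (i + 1)

theorem zInv_nProd : zInv nProd = nProd := by
  rw [nProd, map_mul, zInv_iprod, zInv_iprod, mul_comm]
  simp only [zInv_one_add, neg_neg]

theorem shiftsTo_nProd : ShiftsTo d (zT 1 * (1 + zT 1) * nProd)
    (zT 1 * X * ((1 + zT 1 * X) * (iprod (fun i => 1 + zT 1 * X ^ (d * (i + 1) + 1)) *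
      ((1 + zT (-1) * X ^ (d - 1)) * iprod fun i => 1 + zT (-1) * X ^ (d * (i + 1) + (d - 1)))))) := by
  have hd : 0 < d := NeZero.pos d
  have h2 : ∀ i : ℕ, i + 1 ≤ d * (i + 1) := fun i => Nat.le_mul_of_pos_left _ hd
  -- The factor `1 + z⁻¹ q` is split off because its shift `1 + z⁻¹ q^(d-1)` is not `1` modulo `q`
  -- when `d = 1`, and so does not fit into an infinite product of the required form.
  have e : zT 1 * (1 + zT 1) * nProd = zT 1 * X ^ 0 * ((1 + zT 1 * X ^ 0) *
      (iprod (fun i => 1 + zT 1 * X ^ (i + 1)) *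
      ((1 + zT (-1) * X ^ 1) * (iprod (fun i => 1 + zT (-1) * X ^ (i + 2)) * 1)))) := by
    rw [nProd, iprod_succ (u := fun i => 1 + zT (-1) * X ^ (i + 1))
      (fun i => X_pow_dvd_one_add_zT (by omega)), zero_add]
    ring_nf
  have hI : ShiftsTo d (iprod (fun i => 1 + zT (-1) * X ^ (i + 2)) * 1)
      (iprod (fun i => 1 + zT (-1) * X ^ (d * (i + 1) + (d - 1))) * 1) := by
    refine ShiftsTo.iprod ShiftsTo.one ?_ ?_ fun i A B h => ?_
    · exact fun i => X_pow_dvd_one_add_zT (by omega)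
    · exact fun i => X_pow_dvd_one_add_zT (by have := h2 i; omega)
    · refine h.one_add _ ?_
      push_cast [Nat.cast_sub hd]
      ring
  have hJ := hI.one_add (-1) (n := 1) (N := d - 1) (by push_cast [Nat.cast_sub hd]; ring)
  have hK : ShiftsTo d (iprod (fun i => 1 + zT 1 * X ^ (i + 1)) *
      ((1 + zT (-1) * X ^ 1) * (iprod (fun i => 1 + zT (-1) * X ^ (i + 2)) * 1)))
      (iprod (fun i => 1 + zT 1 * X ^ (d * (i + 1) + 1)) *
      ((1 + zT (-1) * X ^ (d - 1)) *
        (iprod (fun i => 1 + zT (-1) * X ^ (d * (i + 1) + (d - 1))) * 1))) := by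
    refine ShiftsTo.iprod hJ ?_ ?_ fun i A B h => ?_
    · exact fun i => X_pow_dvd_one_add_zT (by omega)
    · exact fun i => X_pow_dvd_one_add_zT (by have := h2 i; omega)
    · refine h.one_add _ ?_
      push_cast
      ring
  have hL := (hK.one_add 1 (n := 0) (N := 1) (by simp)).monomial 1 (n := 0) (N := 1) (by simp)
  rw [e]
  simpa only [pow_one, mul_one] using hL

theorem thetaLike_nProd (hd : d = 1 ∨ d = 2) : ThetaLike d (zT 1 * (1 + zT 1) * nProd) := by
  have hzz : ∀ a b : ℤ, zT a * zT b = zT (a + b) := fun a b => (zT_add a b).symm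
  constructor
  · have h2 : zT 3 * zInv (zT 1 * (1 + zT 1) * nProd) = zT 1 * (1 + zT 1) * nProd := by
      rw [map_mul, map_mul, map_add, map_one, zInv_nProd, zInv_zT]
      have h1 : zT 3 * zT (-1) = zT 1 ^ 2 := by rw [hzz, zT_one_pow]; norm_num
      have h2 : zT 1 ^ 2 * zT (-1) = zT 1 := by rw [zT_one_pow, hzz]; norm_num
      linear_combination ((1 + zT (-1)) * nProd) * h1 + nProd * h2
    intro m
    have := (co_symm_iff 3 _).mpr h2 (-m)
    rw [← this]; congr 1; ring_nf
  · refine ⟨_, ?_, shiftsTo_nProd⟩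
    rw [co_symm_iff]
    simp only [map_mul, zInv_iprod, zInv_zT, zInv_X, map_add, map_one, neg_neg,
      map_pow]
    have h1 : zT 1 * zT (-1) = 1 := by rw [hzz]; simp [zT_zero]
    rcases hd with rfl | rfl
    · have e : ∀ k : ℤ, (1 + zT k * X) * iprod (fun i => 1 + zT k * X ^ (1 * (i + 1) + 1)) =
          iprod fun i => 1 + zT k * X ^ (i + 1) := fun k => by
        rw [iprod_succ (u := fun i => 1 + zT k * X ^ (i + 1))
          (fun i => X_pow_dvd_one_add_zT (by omega))]
        simp
      have e1 := e 1
      have e2 := e (-1)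
      simp only [tsub_self, pow_zero, mul_one, one_mul, add_zero, Nat.cast_one] at e1 e2 ⊢
      set a := iprod fun i => 1 + zT 1 * X ^ (i + 1)
      set b := iprod fun i => 1 + zT (-1) * X ^ (i + 1)
      linear_combination (zT 1 * zT (-1) * X * (1 + zT 1) * a) * e2
        - zT 1 * X * (1 + zT (-1)) * b * e1 + X * a * b * zT 1 * h1
    · have e : ∀ k : ℤ, (1 + zT k * X) * iprod (fun i => 1 + zT k * X ^ (2 * (i + 1) + 1)) =
          iprod fun i => 1 + zT k * X ^ (2 * i + 1) := fun k => by
        rw [iprod_succ (u := fun i => 1 + zT k * X ^ (2 * i + 1))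
          (fun i => X_pow_dvd_one_add_zT (by omega))]
        simp
      have e1 := e 1
      have e2 := e (-1)
      have h3 : zT ((2 : ℕ) : ℤ) * zT (-1) = zT 1 := by rw [hzz]; norm_num
      simp only [Nat.add_one_sub_one, pow_one] at e1 e2 ⊢
      linear_combination (X * (1 + zT (-1) * X) *
        iprod (fun i => 1 + zT (-1) * X ^ (2 * (i + 1) + 1)) * (1 + zT 1 * X) *
        iprod (fun i => 1 + zT 1 * X ^ (2 * (i + 1) + 1))) * h3

theorem yser_proportional (hcd : d * c = 2) :
    emb (co 1 (zT 1 * (1 + zT 1) * nProd)) * (thetaP c ^ 3 * yser c d) =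
      emb (co 1 (thetaP c ^ 3 * yser c d)) * (zT 1 * (1 + zT 1) * nProd) := by
  have hd : d = 1 ∨ d = 2 := (Nat.dvd_prime Nat.prime_two).mp ⟨c, hcd.symm⟩
  exact (thetaLike_yser hcd).proportional hd (thetaLike_nProd hd)

theorem deltaZ_one : deltaZ 1 = 0 := by rw [← map_one emb, deltaZ_emb]

theorem deltaZ_one_add (m : ℤ) (n : ℕ) :
    deltaZ (1 + zT m * X ^ n) = emb (C (m : ℂ)) * zT m * X ^ n := by
  rw [map_add, deltaZ_one, ← emb_X, ← map_pow, mul_comm (zT m), deltaZ_emb_mul, deltaZ_zT]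
  ring

/-- `∑_{m ≥ 1} (-1)^{m-1} q^{a m} (z^m - z^{-m})`. -/
def zalt (a : ℕ) : LP⟦X⟧ :=
  qsum fun j => (-1) ^ j * (X ^ (a * (j + 1)) * (zT (j + 1) - zT (-(j + 1))))

theorem X_pow_dvd_zalt (a : ℕ) : X ^ a ∣ zalt a :=
  X_pow_dvd_qsum fun j => dvd_mul_of_dvd_right
    (dvd_mul_of_dvd_left (pow_dvd_pow _ (by nlinarith)) _) _

theorem qsum_geom_mul (y : LP⟦X⟧) {a : ℕ} (ha : 0 < a) :
    (qsum fun j => (y * X ^ a) ^ (j + 1)) * (1 - y * X ^ a) = y * X ^ a := by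
  have hadm : Adm fun j => (y * X ^ a) ^ (j + 1) := fun j => by
    change X ^ j ∣ (y * X ^ a) ^ (j + 1)
    rw [mul_pow, ← pow_mul]
    exact dvd_mul_of_dvd_right (pow_dvd_pow _ (by nlinarith)) _
  rw [qsum_mul_right hadm]
  have := qsum_telescope hadm
  rw [zero_add, pow_one] at this
  refine Eq.trans ?_ this
  exact qsum_congr fun j => by ring

theorem zalt_mul {a : ℕ} (ha : 0 < a) :
    zalt a * ((1 + zT 1 * X ^ a) * (1 + zT (-1) * X ^ a)) = (zT 1 - zT (-1)) * X ^ a := by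
  have hz : zalt a = (qsum fun j => (-zT (-1) * X ^ a) ^ (j + 1)) -
      qsum fun j => (-zT 1 * X ^ a) ^ (j + 1) := by
    rw [← qsum_sub, zalt]
    refine qsum_congr fun j => ?_
    rw [mul_pow, mul_pow, neg_pow (zT 1), neg_pow (zT (-1)), zT_pow, zT_pow, ← pow_mul]
    push_cast
    rw [mul_one, mul_neg_one]
    ring
  rw [hz]
  linear_combination (1 + zT 1 * X ^ a) * qsum_geom_mul (-zT (-1)) ha -
    (1 + zT (-1) * X ^ a) * qsum_geom_mul (-zT 1) ha

/-- `∑_{n, m ≥ 1} (-1)^{m-1} q^{n m} (z^m - z^{-m})`. -/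
def lam : LP⟦X⟧ := qsum fun i => zalt (i + 1)

theorem adm_lam : Adm fun i => zalt (i + 1) := fun i =>
  (pow_dvd_pow _ (Nat.le_succ i)).trans (X_pow_dvd_zalt _)

theorem deltaZ_nProd : deltaZ nProd = lam * nProd := by
  have hu : ∀ (k : ℤ) (i : ℕ), X ^ (i + 1) ∣ (1 + zT k * X ^ (i + 1)) - 1 :=
    fun k i => X_pow_dvd_one_add_zT le_rfl
  rw [nProd, ← iprod_mul (hu 1) (hu (-1)), deltaZ_iprod (κ := fun i => zalt (i + 1))
    (fun i => X_pow_dvd_mul_sub_one (hu 1 i) (hu (-1) i)) adm_lam, lam]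
  intro i
  rw [zalt_mul (a := i + 1) (Nat.succ_pos i), deltaZ_mul, deltaZ_one_add, deltaZ_one_add]
  simp only [Int.cast_one, Int.cast_neg, map_one, map_neg]
  ring

/-- At `q = 0` the product is `z + z²`. The non-vanishing allows the constant of proportionality to
be cancelled. -/
theorem co_one_nProd_ne_zero : co 1 (zT 1 * (1 + zT 1) * nProd) ≠ 0 := fun h => by
  have hu : ∀ (k : ℤ) (i : ℕ), X ^ 1 ∣ (1 + zT k * X ^ (i + 1)) - 1 :=
    fun k i => (pow_dvd_pow _ (by omega)).trans (X_pow_dvd_one_add_zT (i := i) le_rfl)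
  have h1 : X ^ 1 ∣ nProd - 1 := X_pow_dvd_mul_sub_one (X_pow_dvd_iprod_sub_one (hu 1))
    (X_pow_dvd_iprod_sub_one (hu (-1)))
  have h2 := X_pow_dvd_co (dvd_mul_of_dvd_right h1 (zT 1 * (1 + zT 1))) 1
  rw [mul_sub, map_sub, h, zero_sub, dvd_neg] at h2
  have h3 := X_pow_dvd_iff.mp h2 0 one_pos
  rw [mul_one, mul_add, mul_one, ← zT_add, map_add, co_zT, co_zT] at h3
  norm_num at h3

/-- The logarithmic `δ_z`-derivative of `yser_proportional`; the two unknown factors depend on `q`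
alone and drop out. -/
theorem one_add_mul_deltaZ_yser (hcd : d * c = 2) : (1 + zT 1) * deltaZ (yser c d) =
    ((1 + zT 1) * (3 * kap c + lam) + (1 + 2 * zT 1)) * yser c d := by
  have hc : 0 < c := Nat.pos_of_ne_zero fun h => by simp [h] at hcd
  have h := yser_proportional (c := c) (d := d) hcd
  have hδ := congrArg deltaZ h
  have hg : emb (co 1 (zT 1 * (1 + zT 1) * nProd)) ≠ 0 := fun h0 => by
    refine co_one_nProd_ne_zero ?_
    have := congrArg (co 0) h0
    rwa [co_emb, if_pos rfl, map_zero] at this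
  generalize co 1 (zT 1 * (1 + zT 1) * nProd) = g at *
  generalize co 1 (thetaP c ^ 3 * yser c d) = k at *
  have h3 : deltaZ (thetaP c ^ 3) = -3 * kap c * thetaP c ^ 3 := by
    rw [pow_succ, pow_two, deltaZ_mul, deltaZ_mul, deltaZ_thetaP hc]; ring
  have hz : deltaZ (zT 1) = zT 1 := by rw [deltaZ_zT]; simp
  rw [deltaZ_emb_mul, deltaZ_emb_mul, deltaZ_mul, h3, deltaZ_mul, deltaZ_mul, deltaZ_nProd, map_add,
    deltaZ_one, hz] at hδ
  refine mul_left_cancel₀ (mul_ne_zero hg (pow_ne_zero 3 (isUnit_thetaP hc).ne_zero)) ?_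
  linear_combination (1 + zT 1) * hδ - ((1 + 2 * zT 1) + (1 + zT 1) * lam) * h

end ThetaProducts

end OverpartitionMoments

end

noncomputable section
namespace OverpartitionMoments
open PowerSeries

/-! ### Lambert series and divisor sums -/

section Lambert

/-- `∑_{n, m ≥ 1} w(n, m) q^{c n m}`. -/
def lambert (c : ℕ) (w : ℕ → ℕ → ℂ) : ℂ⟦X⟧ :=
  qsum fun n => qsum fun j => C (w (n + 1) (j + 1)) * X ^ (c * ((n + 1) * (j + 1)))

theorem coeff_lambert {c : ℕ} (hc : 0 < c) (w : ℕ → ℕ → ℂ) (N : ℕ) :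
    coeff N (lambert c w) = ∑ n ∈ Finset.range (N + 1), ∑ j ∈ Finset.range (N + 1),
      if N = c * ((n + 1) * (j + 1)) then w (n + 1) (j + 1) else 0 := by
  have hle : ∀ n j : ℕ, n + j ≤ c * ((n + 1) * (j + 1)) := fun n j =>
    le_trans (by nlinarith) (Nat.le_mul_of_pos_left ((n + 1) * (j + 1)) hc)
  have h1 : ∀ n, Adm fun j => C (w (n + 1) (j + 1)) * X ^ (c * ((n + 1) * (j + 1))) := fun n j =>
    dvd_mul_of_dvd_right (pow_dvd_pow _ ((Nat.le_add_left j n).trans (hle n j))) _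
  have h2 : Adm fun n => qsum fun j => C (w (n + 1) (j + 1)) * X ^ (c * ((n + 1) * (j + 1))) :=
    fun n => X_pow_dvd_qsum fun j =>
      dvd_mul_of_dvd_right (pow_dvd_pow _ ((Nat.le_add_right n j).trans (hle n j))) _
  rw [lambert, coeff_qsum h2 N.lt_succ_self]
  refine Finset.sum_congr rfl fun n _ => ?_
  rw [coeff_qsum (h1 n) N.lt_succ_self]
  refine Finset.sum_congr rfl fun j _ => ?_
  rw [coeff_C_mul, coeff_X_pow, mul_ite, mul_one, mul_zero]

theorem coeff_lambert_snd {c : ℕ} (hc : 0 < c) (w : ℕ → ℂ) (N : ℕ) :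
    coeff N (lambert c fun _ m => w m) =
      if c ∣ N then ∑ m ∈ (N / c).divisors, w m else 0 := by
  rw [coeff_lambert hc]
  split_ifs with h
  · obtain ⟨M, rfl⟩ := h
    rw [Nat.mul_div_cancel_left _ hc, ← Nat.sum_divisorsAntidiagonal' (f := fun _ m => w m),
      ← Finset.sum_product', ← Finset.sum_filter]
    refine Finset.sum_bij (fun x _ => (x.1 + 1, x.2 + 1)) (fun x hx => ?_)
      (fun x _ y _ h => ?_) (fun y hy => ?_) fun x _ => rfl
    · simp only [Finset.mem_filter, Finset.mem_product, Nat.mem_divisorsAntidiagonal] at *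
      have := Nat.eq_of_mul_eq_mul_left hc hx.2
      exact ⟨this.symm, by rw [this]; positivity⟩
    · simp only [Prod.mk.injEq, add_left_inj] at h
      exact Prod.ext h.1 h.2
    · rw [Nat.mem_divisorsAntidiagonal] at hy
      obtain ⟨hy, h0⟩ := hy
      have h1 : 0 < y.1 := Nat.pos_of_ne_zero fun h => h0 (by rw [← hy, h, zero_mul])
      have h2 : 0 < y.2 := Nat.pos_of_ne_zero fun h => h0 (by rw [← hy, h, mul_zero])
      have h3 : y.1 ≤ M := Nat.le_of_dvd (Nat.pos_of_ne_zero h0) ⟨_, hy.symm⟩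
      have h4 : y.2 ≤ M := Nat.le_of_dvd (Nat.pos_of_ne_zero h0) ⟨_, by rw [mul_comm, hy]⟩
      have h5 : M ≤ c * M := Nat.le_mul_of_pos_left _ hc
      refine ⟨(y.1 - 1, y.2 - 1), ?_, ?_⟩
      · simp only [Finset.mem_filter, Finset.mem_product, Finset.mem_range]
        refine ⟨⟨by omega, by omega⟩, ?_⟩
        rw [Nat.sub_add_cancel h1, Nat.sub_add_cancel h2, hy]
      · simp only [Nat.sub_add_cancel h1, Nat.sub_add_cancel h2]
  · refine Finset.sum_eq_zero fun n _ => Finset.sum_eq_zero fun j _ => if_neg fun h' => h ?_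
    exact ⟨_, h'⟩

theorem lambert_swap {c : ℕ} (hc : 0 < c) (w : ℕ → ℕ → ℂ) :
    lambert c w = lambert c fun n m => w m n := by
  ext N
  rw [coeff_lambert hc, coeff_lambert hc, Finset.sum_comm]
  simp only [mul_comm (_ + 1) (_ + 1)]

theorem lambert_one_pow (r : ℕ) : lambert 1 (fun _ m => (m : ℂ) ^ r) = sigmaSeries r := by
  ext N
  rw [coeff_lambert_snd one_pos, if_pos (one_dvd N), sigmaSeries, coeff_mk, Nat.div_one,
    ArithmeticFunction.sigma_apply]
  push_cast
  rfl

theorem lambert_two_pow (r : ℕ) :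
    lambert 2 (fun _ m => (m : ℂ) ^ r) = sqSubst (sigmaSeries r) := by
  ext N
  rw [coeff_lambert_snd two_pos, sqSubst, sigmaSeries, coeff_mk, coeff_mk,
    ArithmeticFunction.sigma_apply]
  push_cast
  exact if_congr (even_iff_two_dvd).symm rfl rfl

/-- The sign subtracts twice the even divisors `2l`, and these correspond to the divisors `l` of `N
/ 2`. -/
theorem lambert_alt_pow (r : ℕ) : lambert 1 (fun _ m => (-1) ^ (m + 1) * (m : ℂ) ^ r) =
    sigmaSeries r - C ((2 : ℂ) ^ (r + 1)) * sqSubst (sigmaSeries r) := by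
  rw [← lambert_two_pow, ← lambert_one_pow]
  ext N
  rw [map_sub, coeff_C_mul, coeff_lambert_snd one_pos, coeff_lambert_snd one_pos,
    coeff_lambert_snd two_pos, if_pos (one_dvd N), if_pos (one_dvd N), Nat.div_one]
  have h1 : ∀ m : ℕ, (-1) ^ (m + 1) * (m : ℂ) ^ r =
      (m : ℂ) ^ r - if Even m then 2 * (m : ℂ) ^ r else 0 := fun m => by
    split_ifs with h
    · rw [h.add_one.neg_one_pow]; ring
    · rw [(Nat.not_even_iff_odd.mp h).add_one.neg_one_pow]; ring
  rw [Finset.sum_congr rfl fun m _ => h1 m, Finset.sum_sub_distrib, ← Finset.sum_filter]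
  congr 1
  by_cases h : 2 ∣ N
  · obtain ⟨K, rfl⟩ := h
    rw [if_pos (dvd_mul_right _ _), Nat.mul_div_cancel_left _ two_pos, Finset.mul_sum]
    symm
    refine Finset.sum_bij (fun m _ => 2 * m) (fun m hm => ?_) (fun m _ m' _ h => ?_)
      (fun m hm => ?_) fun m _ => ?_
    · rw [Nat.mem_divisors] at hm
      rw [Finset.mem_filter, Nat.mem_divisors]
      exact ⟨⟨Nat.mul_dvd_mul_left 2 hm.1, by omega⟩, even_two_mul m⟩
    · omega
    · rw [Finset.mem_filter, Nat.mem_divisors] at hm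
      obtain ⟨l, rfl⟩ := even_iff_two_dvd.mp hm.2
      refine ⟨l, ?_, rfl⟩
      rw [Nat.mem_divisors]
      exact ⟨Nat.dvd_of_mul_dvd_mul_left two_pos hm.1.1, by omega⟩
    · push_cast; ring
  · rw [if_neg h, mul_zero, Finset.sum_eq_zero]
    intro m hm
    rw [Finset.mem_filter, Nat.mem_divisors] at hm
    exact absurd ((even_iff_two_dvd.mp hm.2).trans hm.1.1) h

end Lambert

/-! ### Taylor coefficients of the logarithmic derivatives at `z = 1` -/

section Kappa

theorem ev1_qsum (f : ℕ → LP⟦X⟧) : ev1 (qsum f) = qsum fun s => ev1 (f s) := map_qsum _ _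

theorem iterate_deltaZ_qsum (r : ℕ) (f : ℕ → LP⟦X⟧) :
    deltaZ^[r] (qsum f) = qsum fun s => deltaZ^[r] (f s) := by
  induction r with
  | zero => rfl
  | succ r ih => simp only [Function.iterate_succ_apply', ih, deltaZ_qsum]

theorem iterate_deltaZ_zT (r : ℕ) (m : ℤ) : deltaZ^[r] (zT m) = emb (C ((m : ℂ) ^ r)) * zT m := by
  induction r with
  | zero => simp
  | succ r ih =>
    rw [Function.iterate_succ_apply', ih, deltaZ_emb_mul, deltaZ_zT, ← mul_assoc, ← map_mul,
      ← map_mul, pow_succ]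

theorem iterate_deltaZ_emb_mul (r : ℕ) (a : ℂ⟦X⟧) (F : LP⟦X⟧) :
    deltaZ^[r] (emb a * F) = emb a * deltaZ^[r] F := by
  induction r with
  | zero => rfl
  | succ r ih => rw [Function.iterate_succ_apply', ih, deltaZ_emb_mul, Function.iterate_succ_apply']

theorem iterate_deltaZ_sub (r : ℕ) (F G : LP⟦X⟧) :
    deltaZ^[r] (F - G) = deltaZ^[r] F - deltaZ^[r] G := iterate_map_sub deltaZ r F G

theorem ev1_iterate_deltaZ_term (r e : ℕ) (a : ℂ) (j : ℕ) :
    ev1 (deltaZ^[r] (emb (C a * X ^ e) * (zT (j + 1) - zT (-(j + 1))))) =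
      C ((1 - (-1) ^ r) * (a * ((j + 1 : ℕ) : ℂ) ^ r)) * X ^ e := by
  rw [iterate_deltaZ_emb_mul, iterate_deltaZ_sub, iterate_deltaZ_zT, iterate_deltaZ_zT, map_mul,
    map_sub, map_mul ev1 (emb _) (zT _), map_mul ev1 (emb _) (zT _), ev1_emb, ev1_emb, ev1_emb,
    ev1_zT, ev1_zT]
  push_cast
  rw [neg_pow]
  simp only [map_mul, map_sub, map_one, map_pow, map_add, map_neg]
  ring

theorem ev1_iterate_deltaZ_kap (c r : ℕ) : ev1 (deltaZ^[r] (kap c)) =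
    lambert c fun _ m => (1 - (-1) ^ r) * (m : ℂ) ^ r := by
  rw [kap, iterate_deltaZ_qsum, ev1_qsum, lambert]
  refine qsum_congr fun n => ?_
  rw [zdiff, iterate_deltaZ_qsum, ev1_qsum]
  refine qsum_congr fun j => ?_
  have := ev1_iterate_deltaZ_term r (c * (n + 1) * (j + 1)) 1 j
  rw [map_one, one_mul, map_pow, emb_X] at this
  rw [this, one_mul, mul_assoc c]

theorem ev1_iterate_deltaZ_lam (r : ℕ) : ev1 (deltaZ^[r] lam) =
    lambert 1 fun _ m => (1 - (-1) ^ r) * ((-1) ^ (m + 1) * (m : ℂ) ^ r) := by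
  rw [lam, iterate_deltaZ_qsum, ev1_qsum, lambert]
  refine qsum_congr fun n => ?_
  rw [zalt, iterate_deltaZ_qsum, ev1_qsum]
  refine qsum_congr fun j => ?_
  have := ev1_iterate_deltaZ_term r ((n + 1) * (j + 1)) ((-1) ^ j) j
  have e : emb (C ((-1 : ℂ) ^ j) * X ^ ((n + 1) * (j + 1))) =
      (-1) ^ j * X ^ ((n + 1) * (j + 1)) := by
    simp [emb_X]
  rw [e, mul_assoc] at this
  rw [this, one_mul, show (-1 : ℂ) ^ (j + 1 + 1) = (-1) ^ j by rw [pow_succ, pow_succ]; ring]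

theorem lambert_mul_left {c : ℕ} (hc : 0 < c) (a : ℂ) (w : ℕ → ℕ → ℂ) :
    lambert c (fun n m => a * w n m) = C a * lambert c w := by
  ext N
  rw [coeff_C_mul, coeff_lambert hc, coeff_lambert hc]
  simp only [Finset.mul_sum, mul_ite, mul_zero]

theorem sigmaSeries_mem_of_odd {r : ℕ} (hr : Odd r) :
    sigmaSeries r ∈ qmSeries (r + 1) ∧ sqSubst (sigmaSeries r) ∈ qmSeries (r + 1) := by
  have := sigmaSeries_mem hr.add_one (Nat.succ_ne_zero r)
  simpa using this

theorem C_mul_mem_qmSeries {w : ℕ} (a : ℂ) {p : ℂ⟦X⟧} (h : p ∈ qmSeries w) :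
    C a * p ∈ qmSeries w := by
  rw [← smul_eq_C_mul]; exact Submodule.smul_mem _ a h

/-- Antisymmetry under `z ↦ z⁻¹` removes even `r`; for odd `r` the divisor sum is that of an
Eisenstein series of even weight `r + 1`. -/
theorem ev1_iterate_deltaZ_kap_mem {c : ℕ} (hc : c = 1 ∨ c = 2) (r : ℕ) :
    ev1 (deltaZ^[r] (kap c)) ∈ qmSeries (r + 1) := by
  rw [ev1_iterate_deltaZ_kap, lambert_mul_left (by omega)]
  rcases Nat.even_or_odd r with h | h
  · simp [h.neg_one_pow]
  · refine C_mul_mem_qmSeries _ ?_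
    rcases hc with rfl | rfl
    · rw [lambert_one_pow]; exact (sigmaSeries_mem_of_odd h).1
    · rw [lambert_two_pow]; exact (sigmaSeries_mem_of_odd h).2

theorem ev1_iterate_deltaZ_lam_mem (r : ℕ) : ev1 (deltaZ^[r] lam) ∈ qmSeries (r + 1) := by
  rw [ev1_iterate_deltaZ_lam, lambert_mul_left one_pos]
  rcases Nat.even_or_odd r with h | h
  · simp [h.neg_one_pow]
  · refine C_mul_mem_qmSeries _ ?_
    rw [lambert_alt_pow]
    exact Submodule.sub_mem _ (sigmaSeries_mem_of_odd h).1
      (C_mul_mem_qmSeries _ (sigmaSeries_mem_of_odd h).2)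

end Kappa

/-! ### Quasimodularity of `δ_q P̄ / P̄` -/

section Phi

theorem X_pow_dvd_deltaQ {F : ℂ⟦X⟧} {N : ℕ} (h : X ^ N ∣ F) : X ^ N ∣ deltaQ F := by
  rw [X_pow_dvd_iff] at *
  intro m hm
  rw [coeff_deltaQ, h m hm, mul_zero]

theorem deltaQ_iprod {u κ : ℕ → ℂ⟦X⟧} (hu : ∀ i, X ^ (i + 1) ∣ u i - 1)
    (hκ : ∀ i, X ^ i ∣ κ i) (h : ∀ i, deltaQ (u i) = κ i * u i) :
    deltaQ (iprod u) = qsum κ * iprod u := by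
  refine eq_of_forall_X_pow_dvd_sub fun N => ?_
  have h1 : deltaQ (∏ i ∈ Finset.range N, u i) =
      (∑ i ∈ Finset.range N, κ i) * ∏ i ∈ Finset.range N, u i := by
    induction N with
    | zero => simp [deltaQ_one]
    | succ N ih =>
      rw [Finset.prod_range_succ, deltaQ_mul, ih, h, Finset.sum_range_succ]
      ring
  have h2 := (pow_dvd_pow X (Nat.le_succ N)).trans (X_pow_dvd_iprod_sub hu N)
  have h3 := X_pow_dvd_deltaQ h2
  rw [deltaQ_sub, h1] at h3
  have h4 := dvd_mul_sub_mul (X_pow_dvd_qsum_sub hκ N) h2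
  have := dvd_sub h3 h4
  simpa using this

/-- `q^a / (1 - q^a)`. -/
def geo (a : ℕ) : ℂ⟦X⟧ := qsum fun j => X ^ (a * (j + 1))

theorem geo_mul {a : ℕ} (ha : 0 < a) : geo a * (1 - X ^ a) = X ^ a := by
  have hadm : Adm fun j => (X : ℂ⟦X⟧) ^ (a * (j + 1)) := fun j => pow_dvd_pow _ (by nlinarith)
  rw [geo, qsum_mul_right hadm]
  have := qsum_telescope hadm
  rw [zero_add, mul_one] at this
  refine Eq.trans ?_ this
  exact qsum_congr fun j => by ring

theorem X_pow_dvd_geo (a : ℕ) : X ^ a ∣ geo a :=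
  X_pow_dvd_qsum fun j => pow_dvd_pow _ (by nlinarith)

theorem qsum_mul_geo {c : ℕ} (hc : 0 < c) :
    (qsum fun n => ((n + 1 : ℕ) : ℂ⟦X⟧) * geo (c * (n + 1))) = lambert c fun _ m => (m : ℂ) ^ 1 := by
  rw [lambert_swap hc, lambert]
  refine qsum_congr fun n => ?_
  have hadm : Adm fun j => (X : ℂ⟦X⟧) ^ (c * (n + 1) * (j + 1)) := fun j =>
    pow_dvd_pow _ (by nlinarith [mul_pos hc n.succ_pos])
  rw [geo, qsum_mul_left hadm]
  refine qsum_congr fun j => ?_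
  rw [pow_one, map_natCast, mul_assoc c]

/-- The logarithmic derivative of `∏ (1 + q^n)/(1 - q^n)`, together with `q^n/(1 + q^n) = q^n/(1 -
q^n) - 2 q^(2n)/(1 - q^(2n))`. -/
theorem phi_eq : phi = 2 * (sigmaSeries 1 - sqSubst (sigmaSeries 1)) := by
  have hd : ∀ i : ℕ, X ^ i ∣ geo (i + 1) := fun i =>
    (pow_dvd_pow _ (Nat.le_succ i)).trans (X_pow_dvd_geo _)
  have hd2 : ∀ i : ℕ, X ^ i ∣ geo (2 * (i + 1)) := fun i =>
    (pow_dvd_pow _ (by omega)).trans (X_pow_dvd_geo _)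
  have hu : ∀ i : ℕ, (X : ℂ⟦X⟧) ^ (i + 1) ∣ (1 - X ^ (i + 1)) - 1 := fun i => by simp
  have hv : ∀ i : ℕ, (X : ℂ⟦X⟧) ^ (i + 1) ∣ (1 + X ^ (i + 1)) - 1 := fun i => by simp
  have h1 := deltaQ_iprod (κ := fun i => -(((i + 1 : ℕ) : ℂ⟦X⟧) * geo (i + 1))) hu
    (fun i => (dvd_neg).mpr (dvd_mul_of_dvd_right (hd i) _)) fun i => by
      rw [deltaQ_sub, deltaQ_one, deltaQ_X_pow]
      linear_combination ((i + 1 : ℕ) : ℂ⟦X⟧) * geo_mul (show 0 < i + 1 from i.succ_pos)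
  have h2 := deltaQ_iprod
    (κ := fun i => ((i + 1 : ℕ) : ℂ⟦X⟧) * (geo (i + 1) - 2 * geo (2 * (i + 1)))) hv
    (fun i => dvd_mul_of_dvd_right (dvd_sub (hd i) (dvd_mul_of_dvd_right (hd2 i) _)) _) fun i => by
      rw [deltaQ_add, deltaQ_one, deltaQ_X_pow]
      refine (IsUnit.mul_left_inj (isUnit_one_sub_X_pow (R := ℂ) i)).mp ?_
      have e1 := geo_mul (show 0 < i + 1 from i.succ_pos)
      have e2 := geo_mul (show 0 < 2 * (i + 1) by omega)
      rw [two_mul (i + 1), pow_add] at e2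
      rw [two_mul (i + 1)]
      linear_combination ((i + 1 : ℕ) : ℂ⟦X⟧) * (-(1 + X ^ (i + 1)) * e1 + 2 * e2)
  have h := congrArg deltaQ Pbar_mul_iprod
  rw [deltaQ_mul, h1, h2, ← Pbar_mul_iprod, ← phi_mul_Pbar] at h
  have h3 : phi = (qsum fun i : ℕ => ((i + 1 : ℕ) : ℂ⟦X⟧) * (geo (i + 1) - 2 * geo (2 * (i + 1)))) -
      qsum fun i : ℕ => -(((i + 1 : ℕ) : ℂ⟦X⟧) * geo (i + 1)) := by
    refine (IsUnit.mul_left_inj (isUnit_Pbar.mul (isUnit_iprod hu))).mp ?_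
    linear_combination h
  have e1 := qsum_mul_geo one_pos
  have e2 := qsum_mul_geo two_pos
  simp only [one_mul] at e1
  rw [h3, ← lambert_two_pow, ← lambert_one_pow, ← e1, ← e2, ← qsum_sub, ← qsum_sub]
  have hadm : Adm fun n : ℕ => ((n + 1 : ℕ) : ℂ⟦X⟧) * geo (n + 1) -
      ((n + 1 : ℕ) : ℂ⟦X⟧) * geo (2 * (n + 1)) := fun i =>
    dvd_sub (dvd_mul_of_dvd_right (hd i) _) (dvd_mul_of_dvd_right (hd2 i) _)
  rw [qsum_mul_left hadm]
  exact qsum_congr fun n => by ring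

theorem phi_mem : phi ∈ qmSeries 2 := by
  rw [phi_eq, show (2 : ℂ⟦X⟧) = C (2 : ℂ) from (map_ofNat _ _).symm]
  have := sigmaSeries_mem_of_odd odd_one
  exact C_mul_mem_qmSeries _ (Submodule.sub_mem _ this.1 this.2)

end Phi

end OverpartitionMoments

end

noncomputable section
namespace OverpartitionMoments
open PowerSeries

/-! ### Weights of Taylor coefficients from first order equations -/

section Weights

theorem iterate_deltaZ_add (n : ℕ) (F G : LP⟦X⟧) :
    deltaZ^[n] (F + G) = deltaZ^[n] F + deltaZ^[n] G := iterate_map_add deltaZ n F G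

/-- The Taylor coefficients at `z = 1` of order at most `n` have weight at most `k` plus their
order. -/
def TaylorWeight (n k : ℕ) (F : LP⟦X⟧) : Prop := ∀ i ≤ n, ev1 (deltaZ^[i] F) ∈ qmSeries (i + k)

theorem TaylorWeight.mono {n n' k k' : ℕ} {F : LP⟦X⟧} (h : TaylorWeight n k F) (hn : n' ≤ n)
    (hk : k ≤ k') : TaylorWeight n' k' F := fun i hi =>
  qmSeries_mono (by omega) (h i (hi.trans hn))

theorem TaylorWeight.deltaZ {n k : ℕ} {F : LP⟦X⟧} (h : TaylorWeight (n + 1) k F) :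
    TaylorWeight n (k + 1) (deltaZ F) := fun i hi => by
  have := h (i + 1) (by omega)
  rwa [Function.iterate_succ_apply, show i + 1 + k = i + (k + 1) by ring] at this

theorem TaylorWeight.add {n k : ℕ} {F G : LP⟦X⟧} (hF : TaylorWeight n k F)
    (hG : TaylorWeight n k G) : TaylorWeight n k (F + G) := fun i hi => by
  rw [iterate_deltaZ_add, map_add]
  exact Submodule.add_mem _ (hF i hi) (hG i hi)

theorem TaylorWeight.iterate_mul_mem {n k l : ℕ} {F G : LP⟦X⟧} (hF : TaylorWeight n k F)
    (hG : TaylorWeight n l G) : ev1 (OverpartitionMoments.deltaZ^[n] (F * G)) ∈ qmSeries (n + k + l) := by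
  induction n generalizing F G k l with
  | zero =>
    have := qmSeries_mul (hF 0 le_rfl) (hG 0 le_rfl)
    simpa using this
  | succ n ih =>
    rw [Function.iterate_succ_apply, deltaZ_mul, iterate_deltaZ_add, map_add]
    refine Submodule.add_mem _ ?_ ?_
    · exact qmSeries_mono (by omega) (ih hF.deltaZ (hG.mono (Nat.le_succ n) le_rfl))
    · exact qmSeries_mono (by omega) (ih (hF.mono (Nat.le_succ n) le_rfl) hG.deltaZ)

theorem TaylorWeight.mul {n k l : ℕ} {F G : LP⟦X⟧} (hF : TaylorWeight n k F)
    (hG : TaylorWeight n l G) : TaylorWeight n (k + l) (F * G) := fun i hi => by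
  rw [← add_assoc]
  exact (hF.mono hi le_rfl).iterate_mul_mem (hG.mono hi le_rfl)

/-- Leibniz's rule with its top term set aside: nothing is assumed about the `n`-th derivative of
`G`, which is the unknown in an induction on the order. -/
theorem TaylorWeight.iterate_mul_sub_mem {n k l : ℕ} {A G : LP⟦X⟧} (hA : TaylorWeight n k A)
    (hG : ∀ i < n, ev1 (OverpartitionMoments.deltaZ^[i] G) ∈ qmSeries (i + l)) :
    ev1 (OverpartitionMoments.deltaZ^[n] (A * G)) -
      ev1 A * ev1 (OverpartitionMoments.deltaZ^[n] G) ∈ qmSeries (n + k + l) := by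
  induction n generalizing A G k l with
  | zero => simp
  | succ n ih =>
    rw [Function.iterate_succ_apply, deltaZ_mul, iterate_deltaZ_add, map_add, add_sub_assoc]
    refine Submodule.add_mem _ ?_ ?_
    · refine qmSeries_mono (by omega) (hA.deltaZ.iterate_mul_mem (l := l) fun i hi => ?_)
      exact hG i (by omega)
    · have := ih (G := OverpartitionMoments.deltaZ G) (l := l + 1) (hA.mono (Nat.le_succ n) le_rfl)
        fun i hi => by
        have := hG (i + 1) (by omega)
        rwa [Function.iterate_succ_apply, show i + 1 + l = i + (l + 1) by ring] at this
      rw [Function.iterate_succ_apply]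
      exact qmSeries_mono (by omega) this

/-- Apply `δ_z^n` to the equation and set `z = 1`. The only term of order `n + 1` in `F` is
multiplied by the nonzero constant `a`; all others have weight at most `n + 1` by induction. -/
theorem taylorWeight_of_equation {A B F : LP⟦X⟧} {a b : ℂ} (ha : a ≠ 0) (hA1 : ev1 A = C a)
    (hA : ∀ n, TaylorWeight n 0 A) (hB : ∀ n, TaylorWeight n 1 B) (hF1 : ev1 F = C b)
    (h : A * deltaZ F = B * F) (n : ℕ) : TaylorWeight n 0 F := by
  induction n with
  | zero =>
    intro i hi
    obtain rfl : i = 0 := by omega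
    rw [Function.iterate_zero, id_eq, hF1]
    exact C_mem_qmSeries _ _
  | succ n ih =>
    intro i hi
    rcases Nat.lt_or_ge i (n + 1) with h' | h'
    · exact ih i (by omega)
    obtain rfl : i = n + 1 := by omega
    have h1 := (hA n).iterate_mul_sub_mem (G := deltaZ F) (l := 1) fun i hi => by
      have := ih (i + 1) (by omega)
      rwa [Function.iterate_succ_apply] at this
    have h2 := (hB n).iterate_mul_mem ih
    rw [h] at h1
    have h3 := Submodule.sub_mem _ (qmSeries_mono (by omega) h2) h1
    rw [sub_sub_cancel, hA1, ← Function.iterate_succ_apply] at h3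
    have h4 := C_mul_mem_qmSeries a⁻¹ h3
    rwa [← mul_assoc, ← map_mul, inv_mul_cancel₀ ha, map_one, one_mul] at h4

theorem taylorWeight_emb_C (n : ℕ) (a : ℂ) : TaylorWeight n 0 (emb (C a)) := fun i _ => by
  cases i with
  | zero => rw [Function.iterate_zero, id_eq, ev1_emb]; exact C_mem_qmSeries _ _
  | succ i =>
    rw [Function.iterate_succ_apply, deltaZ_emb, iterate_map_zero, map_zero]
    exact Submodule.zero_mem _

theorem taylorWeight_one (n : ℕ) : TaylorWeight n 0 1 := by
  simpa using taylorWeight_emb_C n 1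

theorem taylorWeight_zT (n : ℕ) (m : ℤ) : TaylorWeight n 0 (zT m) := fun i _ => by
  rw [iterate_deltaZ_zT, map_mul, ev1_emb, ev1_zT, mul_one]
  exact C_mem_qmSeries _ _

theorem taylorWeight_ofNat (n m : ℕ) [m.AtLeastTwo] : TaylorWeight n 0 (OfNat.ofNat m) := by
  have h := taylorWeight_emb_C n (OfNat.ofNat m)
  rwa [map_ofNat, map_ofNat] at h

theorem ev1_one_add_zT (m : ℤ) : ev1 (1 + zT m) = C 2 := by
  rw [map_add, ev1_zT, map_one, map_ofNat, one_add_one_eq_two]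

theorem ev1_yser (c d : ℕ) : ev1 (yser c d) = C 4 := by
  have h1 : ev1 (1 - zT 1) = 0 := by rw [map_sub, ev1_zT, map_one, sub_self]
  have h2 : ev1 (emb ((d : ℂ⟦X⟧) ^ 2 * phi) * ((1 + zT 1) * (1 - zT 1) ^ 2)) = 0 := by
    rw [map_mul ev1, map_mul ev1, map_pow ev1, h1, zero_pow two_ne_zero, mul_zero, mul_zero]
  have h3 : ev1 (2 * (1 - zT 1) ^ 3 * omegaS c d) = 0 := by
    rw [map_mul, map_mul, map_pow, h1, zero_pow three_ne_zero, mul_zero, zero_mul]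
  rw [yser, map_add, map_add, h2, h3, map_mul, map_mul, ev1_one_add_zT, ev1_zT, map_ofNat,
    map_ofNat, map_ofNat]
  ring

theorem taylorWeight_coefficient {c : ℕ} (hc : c = 1 ∨ c = 2) (n : ℕ) :
    TaylorWeight n 1 ((1 + zT 1) * (3 * kap c + lam) + (1 + 2 * zT 1)) := by
  refine TaylorWeight.add ?_ ?_
  · have h4 : TaylorWeight n (0 + 1) (3 * kap c) :=
      (taylorWeight_ofNat n 3).mul fun i _ => ev1_iterate_deltaZ_kap_mem hc i
    have h5 : TaylorWeight n 1 lam := fun i _ => ev1_iterate_deltaZ_lam_mem i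
    rw [zero_add] at h4
    have := ((taylorWeight_one n).add (taylorWeight_zT n 1)).mul (h4.add h5)
    rwa [zero_add] at this
  · have h6 : TaylorWeight n 0 (zT 1 + zT 1) := (taylorWeight_zT n 1).add (taylorWeight_zT n 1)
    rw [two_mul]
    exact ((taylorWeight_one n).add h6).mono le_rfl zero_le_one

theorem taylorWeight_yser {c d : ℕ} [NeZero d] (hcd : d * c = 2) (n : ℕ) :
    TaylorWeight n 0 (yser c d) :=
  taylorWeight_of_equation two_ne_zero (ev1_one_add_zT 1)
    (fun n => (taylorWeight_one n).add (taylorWeight_zT n 1))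
    (taylorWeight_coefficient ((Nat.dvd_prime Nat.prime_two).mp ⟨d, by rw [mul_comm, hcd]⟩))
    (ev1_yser c d) (one_add_mul_deltaZ_yser hcd) n

theorem taylorWeight_crankGF {c : ℕ} (hc : c = 1 ∨ c = 2) (n : ℕ) :
    TaylorWeight n 0 (emb (Ring.inverse Pbar) * crankGF c) := by
  refine taylorWeight_of_equation (a := 1) (b := 1) (A := 1) (B := kap c) one_ne_zero (by simp)
    taylorWeight_one (fun n i _ => ev1_iterate_deltaZ_kap_mem hc i) ?_ ?_ n
  · rw [map_mul, ev1_emb, ev1_crankGF, Ring.inverse_mul_cancel _ isUnit_Pbar, map_one]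
  · rw [deltaZ_emb_mul, deltaZ_crankGF (by omega)]; ring

end Weights

/-! ### Crank moments -/

section CrankMoments

theorem mem_PbarWbar_of_mul {k : ℕ} {p : ℂ⟦X⟧} (hp : p ∈ qmSeries (2 * k))
    (h0 : constantCoeff (Pbar * p) = 0) : Pbar * p ∈ PbarWbar k := by
  refine Submodule.mem_map.mpr ⟨p, mem_Wbar_iff.mpr ⟨?_, hp⟩, rfl⟩
  rw [map_mul] at h0
  exact (mul_eq_zero.mp h0).resolve_left
    (isUnit_Pbar.map (constantCoeff (R := ℂ))).ne_zero

/-- `δ_q (P̄ r) = P̄ (δ_q r + φ r)`, and both terms raise the weight bound by two. -/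
theorem deltaQ_iterate_Pbar_mul {w : ℕ} {p : ℂ⟦X⟧} (hp : p ∈ qmSeries w) (m : ℕ) :
    ∃ r ∈ qmSeries (w + 2 * m), deltaQ^[m] (Pbar * p) = Pbar * r := by
  induction m with
  | zero => exact ⟨p, hp, rfl⟩
  | succ m ih =>
    obtain ⟨r, hr, h⟩ := ih
    refine ⟨deltaQ r + phi * r, Submodule.add_mem _ ?_ ?_, ?_⟩
    · exact qmSeries_mono (by omega) (delta_mem_qmSeries hr)
    · exact qmSeries_mono (by omega) (qmSeries_mul phi_mem hr)
    · rw [Function.iterate_succ_apply', h, deltaQ_mul, ← phi_mul_Pbar]; ring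

theorem constantCoeff_deltaQ (p : ℂ⟦X⟧) : constantCoeff (deltaQ p) = 0 := by simp [deltaQ]

theorem constantCoeff_ev1_iterate_deltaZ {F : LP⟦X⟧} (h : X ∣ deltaZ F) {j : ℕ} (hj : 1 ≤ j) :
    constantCoeff (ev1 (deltaZ^[j] F)) = 0 := by
  have h1 : ∀ i, X ^ 1 ∣ deltaZ^[i + 1] F := fun i => by
    induction i with
    | zero => simpa using h
    | succ i ih => rw [Function.iterate_succ_apply']; exact X_pow_dvd_deltaZ ih
  obtain ⟨i, rfl⟩ : ∃ i, j = i + 1 := ⟨j - 1, by omega⟩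
  have h2 := X_pow_dvd_map (LaurentPolynomial.eval₂ (RingHom.id ℂ) 1) (h1 i)
  rw [pow_one, X_dvd_iff] at h2
  exact h2

theorem crank_moment_mem {c : ℕ} (hc : c = 1 ∨ c = 2) {k m j : ℕ} (hj : 1 ≤ j) (h : j + m ≤ k) :
    deltaQ^[m] (ev1 (deltaZ^[2 * j] (crankGF c))) ∈ PbarWbar k := by
  have h1 := taylorWeight_crankGF hc (2 * j) (2 * j) le_rfl
  rw [iterate_deltaZ_emb_mul, map_mul, ev1_emb] at h1
  obtain ⟨r, hr, h2⟩ := deltaQ_iterate_Pbar_mul h1 m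
  rw [← mul_assoc, Ring.mul_inverse_cancel _ isUnit_Pbar, one_mul] at h2
  have hX : X ∣ deltaZ (crankGF c) := by
    rw [deltaZ_crankGF (by omega)]
    refine dvd_mul_of_dvd_left ?_ _
    have : X ^ 1 ∣ kap c := X_pow_dvd_qsum fun i =>
      (pow_dvd_pow _ (Nat.mul_pos (by omega) i.succ_pos)).trans X_pow_dvd_zdiff
    simpa using this
  rw [h2]
  refine mem_PbarWbar_of_mul (qmSeries_mono (by omega) hr) ?_
  rw [← h2]
  cases m with
  | zero => exact constantCoeff_ev1_iterate_deltaZ hX (by omega)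
  | succ m => rw [Function.iterate_succ_apply', constantCoeff_deltaQ]

end CrankMoments

end OverpartitionMoments

end

noncomputable section
namespace OverpartitionMoments
open PowerSeries

/-! ### Rank moments -/

section RankMoments

theorem sum_range_two_mul_succ {M : Type*} [AddCommMonoid M] (f : ℕ → M) (k : ℕ) :
    ∑ i ∈ Finset.range (2 * k + 1), f i =
      ∑ l ∈ Finset.range (k + 1), f (2 * l) + ∑ l ∈ Finset.range k, f (2 * l + 1) := by
  induction k with
  | zero => simp
  | succ k ih =>
    rw [show 2 * (k + 1) + 1 = 2 * k + 1 + 1 + 1 by ring, Finset.sum_range_succ,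
      Finset.sum_range_succ, ih, Finset.sum_range_succ (fun l => f (2 * l)) (k + 1),
      Finset.sum_range_succ (fun l => f (2 * l + 1)) k, show 2 * (k + 1) = 2 * k + 1 + 1 by ring]
    abel

/-- Bookkeeping for Leibniz's rule: odd moments vanish, so each sum keeps one parity of `i`. Terms
of equal moment order are collected, and those in `D 0` and `r 0` are split off. -/
theorem moment_sum {M : Type*} [AddCommGroup M] [Module ℂ M] {k : ℕ} (hk : 1 ≤ k) (β : ℂ)
    {r D : ℕ → M} (hr : ∀ j, Odd j → r j = 0) (hD : ∀ j, Odd j → D j = 0) :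
    ∑ i ∈ Finset.range (2 * k + 1), (((2 * k).choose i : ℂ) * (0 ^ i - 1 - 2 ^ i + 3 ^ i)) •
        (β • D (2 * k - i) + r (2 * k - i + 2)) +
      ∑ i ∈ Finset.range (2 * k + 1), (4 * (((2 * k).choose i : ℂ) * (1 - 2 ^ i))) •
        r (2 * k - i + 1) +
      ∑ i ∈ Finset.range (2 * k + 1), (2 * (((2 * k).choose i : ℂ) * (1 + 2 ^ i))) • r (2 * k - i) =
    (2 : ℂ) • (((((2 * k : ℕ) : ℂ)) ^ 2 - 3 * (((2 * k : ℕ) : ℂ)) + 2) • r (2 * k)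
        + (β / 2) • ∑ i ∈ Finset.Icc 1 (k - 1),
            (((2 * k).choose (2 * i) : ℂ) * (3 ^ (2 * i) - 2 ^ (2 * i) - 1)) • D (2 * k - 2 * i)
        + ∑ i ∈ Finset.Icc 1 (k - 1),
            (((2 * k).choose (2 * i) : ℂ) * (2 ^ (2 * i) + 1)
              + 2 * ((2 * k).choose (2 * i + 1) : ℂ) * (1 - 2 ^ (2 * i + 1))
              + (1 / 2) * ((2 * k).choose (2 * i + 2) : ℂ)
                * (3 ^ (2 * i + 2) - 2 ^ (2 * i + 2) - 1)) • r (2 * k - 2 * i)) +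
      (β * (3 ^ (2 * k) - 2 ^ (2 * k) - 1)) • D 0 + (2 * (1 + 2 ^ (2 * k)) : ℂ) • r 0 := by
  have odd_sub : ∀ l ∈ Finset.range k, Odd (2 * k - (2 * l + 1)) := fun l hl => by
    rw [Finset.mem_range] at hl
    exact ⟨k - l - 1, by omega⟩
  have odd_sub_add : ∀ l ∈ Finset.range (k + 1), Odd (2 * k - 2 * l + 1) := fun l hl =>
    ⟨k - l, by omega⟩
  have e1 : ∑ i ∈ Finset.range (2 * k + 1),
      (((2 * k).choose i : ℂ) * (0 ^ i - 1 - 2 ^ i + 3 ^ i)) •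
        (β • D (2 * k - i) + r (2 * k - i + 2)) =
      ∑ l ∈ Finset.range k, (((2 * k).choose (2 * l + 2) : ℂ) *
        (3 ^ (2 * l + 2) - 2 ^ (2 * l + 2) - 1)) • (β • D (2 * k - (2 * l + 2)) + r (2 * k - 2 * l)) := by
    rw [sum_range_two_mul_succ, Finset.sum_range_succ', Finset.sum_eq_zero (s := Finset.range k)
      (f := fun l => (((2 * k).choose (2 * l + 1) : ℂ) *
        (0 ^ (2 * l + 1) - 1 - 2 ^ (2 * l + 1) + 3 ^ (2 * l + 1))) •
        (β • D (2 * k - (2 * l + 1)) + r (2 * k - (2 * l + 1) + 2)))]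
    · rw [show (0 : ℂ) ^ (2 * 0) - 1 - 2 ^ (2 * 0) + 3 ^ (2 * 0) = 0 by norm_num, mul_zero, zero_smul,
        add_zero, add_zero]
      refine Finset.sum_congr rfl fun l hl => ?_
      rw [Finset.mem_range] at hl
      rw [show 2 * (l + 1) = 2 * l + 2 by ring, show 2 * k - (2 * l + 2) + 2 = 2 * k - 2 * l by omega,
        zero_pow (by omega)]
      congr 2
      ring
    · intro l hl
      rw [hD _ (odd_sub l hl), hr _ ((odd_sub l hl).add_even even_two), smul_zero, add_zero,
        smul_zero]
  have e2 : ∑ i ∈ Finset.range (2 * k + 1), (4 * (((2 * k).choose i : ℂ) * (1 - 2 ^ i))) •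
        r (2 * k - i + 1) = ∑ l ∈ Finset.range k,
        (4 * (((2 * k).choose (2 * l + 1) : ℂ) * (1 - 2 ^ (2 * l + 1)))) • r (2 * k - 2 * l) := by
    rw [sum_range_two_mul_succ, Finset.sum_eq_zero fun l hl => by
      rw [hr _ (odd_sub_add l hl), smul_zero], zero_add]
    refine Finset.sum_congr rfl fun l hl => ?_
    rw [Finset.mem_range] at hl
    rw [show 2 * k - (2 * l + 1) + 1 = 2 * k - 2 * l by omega]
  have e3 : ∑ i ∈ Finset.range (2 * k + 1), (2 * (((2 * k).choose i : ℂ) * (1 + 2 ^ i))) •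
        r (2 * k - i) = ∑ l ∈ Finset.range k,
        (2 * (((2 * k).choose (2 * l) : ℂ) * (1 + 2 ^ (2 * l)))) • r (2 * k - 2 * l) +
        (2 * (1 + 2 ^ (2 * k)) : ℂ) • r 0 := by
    rw [sum_range_two_mul_succ, Finset.sum_eq_zero (s := Finset.range k) fun l hl => by
      rw [hr _ (odd_sub l hl), smul_zero], add_zero, Finset.sum_range_succ, Nat.sub_self,
      Nat.choose_self, Nat.cast_one, one_mul]
  have e4 : ∑ l ∈ Finset.range k, (((2 * k).choose (2 * l + 2) : ℂ) *
        (3 ^ (2 * l + 2) - 2 ^ (2 * l + 2) - 1)) • β • D (2 * k - (2 * l + 2)) =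
      β • ∑ i ∈ Finset.Icc 1 (k - 1),
            (((2 * k).choose (2 * i) : ℂ) * (3 ^ (2 * i) - 2 ^ (2 * i) - 1)) • D (2 * k - 2 * i) +
      (β * (3 ^ (2 * k) - 2 ^ (2 * k) - 1)) • D 0 := by
    obtain ⟨n, rfl⟩ : ∃ n, k = n + 1 := ⟨k - 1, by omega⟩
    rw [Finset.sum_range_succ, Nat.add_sub_cancel, ← Finset.Ico_add_one_right_eq_Icc,
      Finset.sum_Ico_eq_sum_range, Nat.add_sub_cancel, Finset.smul_sum]
    congr 1
    · refine Finset.sum_congr rfl fun l _ => ?_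
      rw [show 2 * l + 2 = 2 * (1 + l) by ring, smul_comm]
    · rw [show 2 * n + 2 = 2 * (n + 1) by ring, Nat.choose_self, Nat.sub_self, smul_smul,
        Nat.cast_one, one_mul, mul_comm]
  have e5 : ∀ f : ℕ → M, ∑ l ∈ Finset.range k, f l = f 0 + ∑ l ∈ Finset.Icc 1 (k - 1), f l := by
    intro f
    obtain ⟨n, rfl⟩ : ∃ n, k = n + 1 := ⟨k - 1, by omega⟩
    rw [Finset.sum_range_succ', Nat.add_sub_cancel, ← Finset.Ico_add_one_right_eq_Icc,
      Finset.sum_Ico_eq_sum_range, Nat.add_sub_cancel, add_comm]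
    simp only [add_comm 1]
  -- With `a = 2 k`, the terms in `r a` add up to `4 · a(a - 1)/2 - 4a + 4 = 2 (a² - 3a + 2)`.
  have hch : ((2 * k).choose 2 : ℂ) = ((2 * k : ℕ) : ℂ) * (((2 * k : ℕ) : ℂ) - 1) / 2 :=
    Nat.cast_choose_two ℂ (2 * k)
  rw [e1]
  simp only [smul_add (_ * _) (β • _), Finset.sum_add_distrib]
  rw [e2, e3, e4, e5, e5, e5]
  simp only [mul_zero, zero_add, Nat.sub_zero, Nat.choose_zero_right, Nat.choose_one_right, pow_zero,
    pow_one, hch]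
  have e6 : ∑ i ∈ Finset.Icc 1 (k - 1),
            (((2 * k).choose (2 * i) : ℂ) * (2 ^ (2 * i) + 1)
              + 2 * ((2 * k).choose (2 * i + 1) : ℂ) * (1 - 2 ^ (2 * i + 1))
              + (1 / 2) * ((2 * k).choose (2 * i + 2) : ℂ)
                * (3 ^ (2 * i + 2) - 2 ^ (2 * i + 2) - 1)) • r (2 * k - 2 * i) =
      (1 / 2 : ℂ) • (∑ l ∈ Finset.Icc 1 (k - 1), (((2 * k).choose (2 * l + 2) : ℂ) *
        (3 ^ (2 * l + 2) - 2 ^ (2 * l + 2) - 1)) • r (2 * k - 2 * l) +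
      ∑ l ∈ Finset.Icc 1 (k - 1),
        (4 * (((2 * k).choose (2 * l + 1) : ℂ) * (1 - 2 ^ (2 * l + 1)))) • r (2 * k - 2 * l) +
      ∑ l ∈ Finset.Icc 1 (k - 1),
        (2 * (((2 * k).choose (2 * l) : ℂ) * (1 + 2 ^ (2 * l)))) • r (2 * k - 2 * l)) := by
    rw [← Finset.sum_add_distrib, ← Finset.sum_add_distrib, Finset.smul_sum]
    refine Finset.sum_congr rfl fun l _ => ?_
    rw [← add_smul, ← add_smul, smul_smul]
    congr 1
    ring
  rw [e6]
  module

/-- Formally `(1 - z)³` times the heat operator applied to `(1 + z) F / (1 - z)`. The multipliers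
`(1 - z)²`, `2 z (1 - z)` and `z (1 + z)` below come from the derivatives of `1/(1 - z)`, and `φ`
from `δ_q P̄`. -/
theorem rank_equation {c d : ℕ} {F : LP⟦X⟧} (h : (1 + zT 1) * F = emb Pbar * bser c) :
    (1 - zT 1) ^ 2 * (1 + zT 1) * (emb ((d : ℂ⟦X⟧) ^ 2) * deltaQL F + deltaZ (deltaZ F)) +
      4 * (zT 1 * (1 - zT 1)) * deltaZ F + 2 * (zT 1 * (1 + zT 1)) * F = emb Pbar * yser c d := by
  have z1 : deltaZ (zT 1) = zT 1 := by rw [deltaZ_zT]; simp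
  have b : bser c = (1 + zT 1) + emb 2 * ((1 - zT 1) * psi0 c) := by
    rw [bser, map_ofNat, mul_assoc]
  have hz := congrArg deltaZ h
  rw [b, deltaZ_emb_mul, map_add deltaZ (1 + zT 1) (emb 2 * _), deltaZ_emb_mul, deltaZ_mul,
    deltaZ_mul, map_add, map_sub, z1, deltaZ_one, zero_add, zero_sub] at hz
  have hzz := congrArg deltaZ hz
  rw [deltaZ_emb_mul, map_add deltaZ (zT 1) (emb 2 * _), deltaZ_emb_mul, map_add, map_add,
    deltaZ_mul, deltaZ_mul, deltaZ_mul, deltaZ_mul, map_neg, map_add, map_sub, z1, deltaZ_one,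
    zero_add, zero_sub] at hzz
  have q1 : deltaQL 1 = 0 := by rw [← zT_zero, deltaQL_zT]
  have hq := congrArg deltaQL h
  rw [b, deltaQL_mul, deltaQL_mul, map_add deltaQL (1 + zT 1) (emb 2 * _), deltaQL_mul, deltaQL_mul,
    map_add, map_sub, q1, deltaQL_zT, deltaQL_emb, deltaQL_emb, ← phi_mul_Pbar,
    show (2 : ℂ⟦X⟧) = C (2 : ℂ) from (map_ofNat _ _).symm, deltaQ_C, map_ofNat, map_zero, map_mul,
    map_ofNat] at hq
  rw [b] at h
  rw [map_ofNat] at h hz hzz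
  rw [yser, omegaS, map_mul]
  linear_combination (1 - zT 1) ^ 2 * (emb ((d : ℂ⟦X⟧) ^ 2) * hq + hzz) +
    2 * zT 1 * (1 - zT 1) * hz + zT 1 * (1 + zT 1) * h

theorem zInv_deltaZ (F : LP⟦X⟧) : deltaZ (zInv F) = -zInv (deltaZ F) := by
  refine ext_co fun m => ?_
  rw [co_deltaZ, map_neg, co_zInv, co_zInv, co_deltaZ]
  simp

theorem ev1_zInv (F : LP⟦X⟧) : ev1 (zInv F) = ev1 F := by
  ext n
  rw [ev1, evz, zInv, coeff_map, coeff_map, coeff_map]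
  generalize coeff n F = f
  change LaurentPolynomial.eval₂ (RingHom.id ℂ) 1 (LaurentPolynomial.invert f) = _
  induction f using LaurentPolynomial.induction_on' with
  | add p q hp hq => rw [map_add, map_add, map_add, hp, hq]
  | C_mul_T n a => simp

theorem ev1_iterate_deltaZ_of_odd {F : LP⟦X⟧} (hF : zInv F = F) {j : ℕ} (hj : Odd j) :
    ev1 (deltaZ^[j] F) = 0 := by
  have h : ∀ j, deltaZ^[j] (zInv F) = (-1) ^ j * zInv (deltaZ^[j] F) := fun j => by
    induction j with
    | zero => simp
    | succ j ih =>
      have e : ((-1) ^ j : LP⟦X⟧) = emb ((-1) ^ j) := by simp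
      rw [Function.iterate_succ_apply', ih, e, deltaZ_emb_mul, zInv_deltaZ, ← e,
        Function.iterate_succ_apply', pow_succ]
      ring
  have h1 := congrArg ev1 (h j)
  rw [hF, hj.neg_one_pow, neg_one_mul, map_neg, ev1_zInv] at h1
  ext n
  have h2 := congrArg (coeff n) h1
  rw [map_neg] at h2
  rw [map_zero]
  exact CharZero.eq_neg_self_iff.mp h2

theorem iterate_deltaZ_zT_mul (a : ℕ) (k : ℕ) (S : LP⟦X⟧) :
    ev1 (deltaZ^[a] (zT k * S)) = ∑ i ∈ Finset.range (a + 1),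
      ((a.choose i : ℂ) * (k : ℂ) ^ i) • ev1 (deltaZ^[a - i] S) := by
  induction a generalizing S with
  | zero => simp [ev1_zT]
  | succ a ih =>
    have h1 : deltaZ (zT k * S) = zT k * (emb (C (k : ℂ)) * S + deltaZ S) := by
      rw [deltaZ_mul, deltaZ_zT]; push_cast; ring
    have h2 : ∀ n, ev1 (deltaZ^[n] (emb (C (k : ℂ)) * S + deltaZ S)) =
        (k : ℂ) • ev1 (deltaZ^[n] S) + ev1 (deltaZ^[n + 1] S) := fun n => by
      rw [iterate_deltaZ_add, map_add, iterate_deltaZ_emb_mul, map_mul, ev1_emb,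
        ← smul_eq_C_mul, Function.iterate_succ_apply]
    rw [Function.iterate_succ_apply, h1, ih]
    simp only [h2, smul_add, Finset.sum_add_distrib, smul_smul]
    rw [Finset.sum_range_succ' _ (a + 1), Finset.sum_range_succ' (fun i =>
      ((a.choose i : ℂ) * (k : ℂ) ^ i) • ev1 (deltaZ^[a - i + 1] S))]
    have h3 : ∀ i ∈ Finset.range (a + 1), (((a + 1).choose (i + 1) : ℂ) * (k : ℂ) ^ (i + 1)) •
        ev1 (deltaZ^[a + 1 - (i + 1)] S) = ((a.choose i : ℂ) * (k : ℂ) ^ i * k) • ev1 (deltaZ^[a - i] S)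
        + ((a.choose (i + 1) : ℂ) * (k : ℂ) ^ (i + 1)) • ev1 (deltaZ^[a - i] S) := fun i _ => by
      rw [Nat.choose_succ_succ, Nat.add_sub_add_right, ← add_smul]
      congr 1
      push_cast; ring
    rw [Finset.sum_congr rfl h3, Finset.sum_add_distrib, Finset.sum_range_succ (fun i =>
      ((a.choose (i + 1) : ℂ) * (k : ℂ) ^ (i + 1)) • ev1 (deltaZ^[a - i] S)), Nat.choose_succ_self]
    have h4 : ∀ i ∈ Finset.range a, ((a.choose (i + 1) : ℂ) * (k : ℂ) ^ (i + 1)) •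
        ev1 (deltaZ^[a - (i + 1) + 1] S) =
        ((a.choose (i + 1) : ℂ) * (k : ℂ) ^ (i + 1)) • ev1 (deltaZ^[a - i] S) := fun i hi => by
      rw [Finset.mem_range] at hi
      rw [show a - (i + 1) + 1 = a - i by omega]
    rw [Finset.sum_congr rfl h4]
    simp [add_assoc]

theorem iterate_deltaZ_deltaQL (j : ℕ) (F : LP⟦X⟧) :
    deltaZ^[j] (deltaQL F) = deltaQL (deltaZ^[j] F) := by
  induction j with
  | zero => rfl
  | succ j ih => rw [Function.iterate_succ_apply', ih, deltaZ_deltaQL, Function.iterate_succ_apply']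

/-- `δ_z^(2k)` of `rank_equation` at `z = 1`. Since `(1 - z)²(1 + z) = 1 - z - z² + z³` and `δ_z^i
z^n = n^i z^n`, the first operator contributes the numbers `0^i - 1 - 2^i + 3^i`. -/
theorem moment_identity {c d k : ℕ} (hk : 1 ≤ k) {F : LP⟦X⟧} (hF : zInv F = F)
    (h : (1 + zT 1) * F = emb Pbar * bser c) :
    Pbar * ev1 (deltaZ^[2 * k] (yser c d)) =
    (2 : ℂ) • (((((2 * k : ℕ) : ℂ)) ^ 2 - 3 * (((2 * k : ℕ) : ℂ)) + 2) • ev1 (deltaZ^[2 * k] F)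
        + ((d : ℂ) ^ 2 / 2) • ∑ i ∈ Finset.Icc 1 (k - 1),
            (((2 * k).choose (2 * i) : ℂ) * (3 ^ (2 * i) - 2 ^ (2 * i) - 1)) •
              deltaQ (ev1 (deltaZ^[2 * k - 2 * i] F))
        + ∑ i ∈ Finset.Icc 1 (k - 1),
            (((2 * k).choose (2 * i) : ℂ) * (2 ^ (2 * i) + 1)
              + 2 * ((2 * k).choose (2 * i + 1) : ℂ) * (1 - 2 ^ (2 * i + 1))
              + (1 / 2) * ((2 * k).choose (2 * i + 2) : ℂ)
                * (3 ^ (2 * i + 2) - 2 ^ (2 * i + 2) - 1)) • ev1 (deltaZ^[2 * k - 2 * i] F)) +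
      ((d : ℂ) ^ 2 * (3 ^ (2 * k) - 2 ^ (2 * k) - 1)) • deltaQ (ev1 F) +
      (2 * (1 + 2 ^ (2 * k)) : ℂ) • ev1 F := by
  have hr : ∀ j, Odd j → ev1 (deltaZ^[j] F) = 0 := fun j hj => ev1_iterate_deltaZ_of_odd hF hj
  have hsum := moment_sum hk ((d : ℂ) ^ 2) hr
    (D := fun j => deltaQ (ev1 (deltaZ^[j] F))) fun j hj => by simp only [hr j hj, deltaQ_zero]
  simp only [Function.iterate_zero, id_eq] at hsum
  rw [← hsum]
  clear hsum
  set S := emb ((d : ℂ⟦X⟧) ^ 2) * deltaQL F + deltaZ (deltaZ F) with hS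
  have hs : ∀ j, ev1 (deltaZ^[j] S) =
      ((d : ℂ) ^ 2) • deltaQ (ev1 (deltaZ^[j] F)) + ev1 (deltaZ^[j + 2] F) := fun j => by
    rw [hS, iterate_deltaZ_add, map_add, iterate_deltaZ_emb_mul, map_mul, ev1_emb,
      iterate_deltaZ_deltaQL, ev1_deltaQL, smul_eq_C_mul, Function.iterate_add_apply]
    simp
  have e : emb Pbar * yser c d = zT (0 : ℕ) * S - zT (1 : ℕ) * S - zT (2 : ℕ) * S + zT (3 : ℕ) * S +
      emb (C 4) * (zT (1 : ℕ) * deltaZ F - zT (2 : ℕ) * deltaZ F) +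
      emb (C 2) * (zT (1 : ℕ) * F + zT (2 : ℕ) * F) := by
    rw [← rank_equation (d := d) h, ← zT_one_pow 0, ← zT_one_pow 1, ← zT_one_pow 2, ← zT_one_pow 3,
      map_ofNat, map_ofNat, map_ofNat, map_ofNat, ← hS]
    ring
  have h0 : Pbar * ev1 (deltaZ^[2 * k] (yser c d)) = ev1 (deltaZ^[2 * k] (emb Pbar * yser c d)) := by
    rw [iterate_deltaZ_emb_mul, map_mul, ev1_emb]
  have hsucc : ∀ n, deltaZ^[n] (deltaZ F) = deltaZ^[n + 1] F := fun n => rfl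
  rw [h0, e]
  simp only [iterate_deltaZ_add, iterate_deltaZ_sub, iterate_deltaZ_emb_mul, map_add, map_sub,
    map_mul ev1 (emb _) _, ev1_emb, iterate_deltaZ_zT_mul, hs, hsucc, ← smul_eq_C_mul]
  simp only [← Finset.sum_sub_distrib, ← Finset.sum_add_distrib, Finset.smul_sum]
  refine Finset.sum_congr rfl fun i _ => ?_
  push_cast
  rw [one_pow]
  module

/-- Modulo `q` the series `Ψ` vanishes, and `X` is prime and does not divide `1 + z`, so `F` is
constant in `z` modulo `q`. This makes the constant terms of the positive moments vanish. -/
theorem X_dvd_deltaZ_of_one_add_mul {c : ℕ} {F : LP⟦X⟧}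
    (h : (1 + zT 1) * F = emb Pbar * bser c) : X ∣ deltaZ F := by
  have h1 : X ∣ psi0 c := by
    have : X ^ 1 ∣ psi0 c := X_pow_dvd_qsum fun k =>
      dvd_mul_of_dvd_left (dvd_mul_of_dvd_right (pow_dvd_pow _ (Nat.one_le_pow _ _ k.succ_pos)) _) _
    simpa using this
  have h2 : X ∣ (1 + zT 1) * (F - emb Pbar) := by
    have e : (1 + zT 1) * (F - emb Pbar) = emb Pbar * (2 * (1 - zT 1)) * psi0 c := by
      rw [bser] at h
      linear_combination h
    rw [e]
    exact dvd_mul_of_dvd_right h1 _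
  have h3 : X ∣ F - emb Pbar := (X_prime.dvd_or_dvd h2).resolve_left fun h3 => by
    have h4 : X ^ 1 ∣ 1 + zT 1 := by simpa using h3
    have h5 := X_pow_dvd_iff.mp (X_pow_dvd_co h4 0) 0 one_pos
    rw [map_add, co_one, co_zT, if_pos rfl, if_neg (by norm_num)] at h5
    simp at h5
  have h6 : X ^ 1 ∣ F - emb Pbar := by simpa using h3
  have h7 := X_pow_dvd_deltaZ h6
  rw [map_sub, deltaZ_emb, sub_zero] at h7
  simpa using h7

/-- `moment_identity` is solved for the combination; the extra terms are `φ P̄` and `P̄`, of weight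
at most `2 ≤ 2k`. The constant term is checked on the combination itself, as the separate
quasimodular terms need not vanish at `q = 0`. -/
theorem rank_moment_mem {c d k : ℕ} [NeZero d] (hcd : d * c = 2) (hk : 1 ≤ k) {F : LP⟦X⟧}
    (hF : RankForm c F) (hF1 : ev1 F = Pbar) :
    ((((2 * k : ℕ) : ℂ)) ^ 2 - 3 * (((2 * k : ℕ) : ℂ)) + 2) • ev1 (deltaZ^[2 * k] F)
        + ((d : ℂ) ^ 2 / 2) • ∑ i ∈ Finset.Icc 1 (k - 1),
            (((2 * k).choose (2 * i) : ℂ) * (3 ^ (2 * i) - 2 ^ (2 * i) - 1)) •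
              deltaQ (ev1 (deltaZ^[2 * k - 2 * i] F))
        + ∑ i ∈ Finset.Icc 1 (k - 1),
            (((2 * k).choose (2 * i) : ℂ) * (2 ^ (2 * i) + 1)
              + 2 * ((2 * k).choose (2 * i + 1) : ℂ) * (1 - 2 ^ (2 * i + 1))
              + (1 / 2) * ((2 * k).choose (2 * i + 2) : ℂ)
                * (3 ^ (2 * i + 2) - 2 ^ (2 * i + 2) - 1)) • ev1 (deltaZ^[2 * k - 2 * i] F)
      ∈ PbarWbar k := by
  have hc : 0 < c := Nat.pos_of_ne_zero fun h => by simp [h] at hcd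
  have hsymm : zInv F = F := ext_co fun m => by rw [co_zInv, ← hF.1]
  have hA := hF.one_add_mul hc hF1
  have key := moment_identity (d := d) hk hsymm hA
  have h0 : ∀ j, 1 ≤ j → constantCoeff (ev1 (deltaZ^[j] F)) = 0 := fun j hj =>
    constantCoeff_ev1_iterate_deltaZ (X_dvd_deltaZ_of_one_add_mul hA) hj
  have hconst : ∀ (a b : ℂ) (u v : ℕ → ℂ), constantCoeff (a • ev1 (deltaZ^[2 * k] F)
        + b • ∑ i ∈ Finset.Icc 1 (k - 1), u i • deltaQ (ev1 (deltaZ^[2 * k - 2 * i] F))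
        + ∑ i ∈ Finset.Icc 1 (k - 1), v i • ev1 (deltaZ^[2 * k - 2 * i] F)) = 0 := by
    intro a b u v
    rw [map_add, map_add, constantCoeff_smul, constantCoeff_smul, map_sum, map_sum,
      h0 _ (by omega), Finset.sum_eq_zero, Finset.sum_eq_zero]
    · simp
    · intro i hi
      rw [Finset.mem_Icc] at hi
      rw [constantCoeff_smul, h0 _ (by omega), smul_zero]
    · intro i _
      rw [constantCoeff_smul, constantCoeff_deltaQ, smul_zero]
  have hc0 := hconst ((((2 * k : ℕ) : ℂ)) ^ 2 - 3 * (((2 * k : ℕ) : ℂ)) + 2) ((d : ℂ) ^ 2 / 2)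
    (fun i => ((2 * k).choose (2 * i) : ℂ) * (3 ^ (2 * i) - 2 ^ (2 * i) - 1))
    (fun i => ((2 * k).choose (2 * i) : ℂ) * (2 ^ (2 * i) + 1)
              + 2 * ((2 * k).choose (2 * i + 1) : ℂ) * (1 - 2 ^ (2 * i + 1))
              + (1 / 2) * ((2 * k).choose (2 * i + 2) : ℂ)
                * (3 ^ (2 * i + 2) - 2 ^ (2 * i + 2) - 1))
  rw [hF1, ← phi_mul_Pbar] at key
  generalize ((((2 * k : ℕ) : ℂ)) ^ 2 - 3 * (((2 * k : ℕ) : ℂ)) + 2) • ev1 (deltaZ^[2 * k] F)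
        + ((d : ℂ) ^ 2 / 2) • ∑ i ∈ Finset.Icc 1 (k - 1),
            (((2 * k).choose (2 * i) : ℂ) * (3 ^ (2 * i) - 2 ^ (2 * i) - 1)) •
              deltaQ (ev1 (deltaZ^[2 * k - 2 * i] F))
        + ∑ i ∈ Finset.Icc 1 (k - 1),
            (((2 * k).choose (2 * i) : ℂ) * (2 ^ (2 * i) + 1)
              + 2 * ((2 * k).choose (2 * i + 1) : ℂ) * (1 - 2 ^ (2 * i + 1))
              + (1 / 2) * ((2 * k).choose (2 * i + 2) : ℂ)
                * (3 ^ (2 * i + 2) - 2 ^ (2 * i + 2) - 1)) • ev1 (deltaZ^[2 * k - 2 * i] F) = T at *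
  have hT : T = Pbar * ((1 / 2 : ℂ) • ev1 (deltaZ^[2 * k] (yser c d)) -
      ((d : ℂ) ^ 2 * (3 ^ (2 * k) - 2 ^ (2 * k) - 1) / 2) • phi -
      C (1 + 2 ^ (2 * k) : ℂ)) := by
    rw [mul_sub, mul_sub, mul_smul_comm, key, mul_smul_comm, mul_comm Pbar (C _), ← smul_eq_C_mul,
      mul_comm Pbar phi]
    module
  rw [hT] at hc0 ⊢
  refine mem_PbarWbar_of_mul (Submodule.sub_mem _ (Submodule.sub_mem _ ?_ ?_) ?_) hc0
  · exact Submodule.smul_mem _ _ (taylorWeight_yser hcd (2 * k) (2 * k) le_rfl)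
  · exact Submodule.smul_mem _ _ (qmSeries_mono (by omega) phi_mem)
  · exact C_mem_qmSeries _ _

end RankMoments

end OverpartitionMoments

end

/-! ### The main theorem -/

open OverpartitionMoments in
theorem theorem1p1 (k : ℕ) (hk : 1 ≤ k) :
    (∀ m j : ℕ, 1 ≤ j → j ≤ k → j + m ≤ k → deltaQ^[m] (Cbar (2 * j)) ∈ PbarWbar k) ∧
    (∀ m j : ℕ, 1 ≤ j → j ≤ k → j + m ≤ k → deltaQ^[m] (C2bar (2 * j)) ∈ PbarWbar k) ∧
    (∀ a : ℕ, a = 2 * k →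
      ((a : ℂ) ^ 2 - 3 * (a : ℂ) + 2) • Rbar a
        + (2 : ℂ) • ∑ i ∈ Finset.Icc 1 (a / 2 - 1),
            ((a.choose (2 * i) : ℂ) * (3 ^ (2 * i) - 2 ^ (2 * i) - 1)) • deltaQ (Rbar (a - 2 * i))
        + ∑ i ∈ Finset.Icc 1 (a / 2 - 1),
            ((a.choose (2 * i) : ℂ) * (2 ^ (2 * i) + 1)
              + 2 * (a.choose (2 * i + 1) : ℂ) * (1 - 2 ^ (2 * i + 1))
              + (1 / 2) * (a.choose (2 * i + 2) : ℂ) * (3 ^ (2 * i + 2) - 2 ^ (2 * i + 2) - 1))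
            • Rbar (a - 2 * i)
        ∈ PbarWbar k) ∧
    (∀ a : ℕ, a = 2 * k →
      ((a : ℂ) ^ 2 - 3 * (a : ℂ) + 2) • R2bar a
        + (1 / 2 : ℂ) • ∑ i ∈ Finset.Icc 1 (a / 2 - 1),
            ((a.choose (2 * i) : ℂ) * (3 ^ (2 * i) - 2 ^ (2 * i) - 1)) • deltaQ (R2bar (a - 2 * i))
        + ∑ i ∈ Finset.Icc 1 (a / 2 - 1),
            ((a.choose (2 * i) : ℂ) * (2 ^ (2 * i) + 1)
              + 2 * (a.choose (2 * i + 1) : ℂ) * (1 - 2 ^ (2 * i + 1))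
              + (1 / 2) * (a.choose (2 * i + 2) : ℂ) * (3 ^ (2 * i + 2) - 2 ^ (2 * i + 2) - 1))
            • R2bar (a - 2 * i)
        ∈ PbarWbar k) := by
  refine ⟨fun m j hj _ h => ?_, fun m j hj _ h => ?_, fun a ha => ?_, fun a ha => ?_⟩
  · rw [Cbar_eq]
    exact crank_moment_mem (Or.inl rfl) hj h
  · rw [C2bar_eq]
    exact crank_moment_mem (Or.inr rfl) hj h
  · subst ha
    -- The coefficient `d²/2` of the `δ_q`-sum is `2` for the rank (`d = 2`) and `1/2` for the
    -- `M2`-rank (`d = 1`).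
    have h := rank_moment_mem (d := 2) (c := 1) rfl hk rankForm_rankGF (ev1_statGF _)
    simp only [← Rbar_eq] at h
    rw [Nat.mul_div_cancel_left k two_pos]
    rwa [show (((2 : ℕ) : ℂ) ^ 2 / 2) = 2 by norm_num] at h
  · subst ha
    have h := rank_moment_mem (d := 1) (c := 2) rfl hk rankForm_m2GF (ev1_statGF _)
    simp only [← R2bar_eq] at h
    rw [Nat.mul_div_cancel_left k two_pos]
    rwa [show (((1 : ℕ) : ℂ) ^ 2 / 2) = 1 / 2 by norm_num] at h
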